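/- Let $K$ be a complete ultrametric valued field of mixed characteristic $(0,p)$ and let $X=\mathrm{D}^+(c_0,R_0)-\bigcup_{i=1}^n\mathrm{D}^-(c_i,R_i)$ be a $K$-affinoid, with $R_i>0$, $c_i\in K$, $|c_i-c_0|\le R_0$. Put $r_X=\min(R_0,\dots,R_n)$, $s_X=\max(|c_0|,R_0)$. Let $\mathcal H_K(X)$ be the completion, for the sup-norm on $X$, of the ring of rational functions in $K(T)$ without poles in $X(K^{\mathrm{alg}})$, let $\delta_1=T\frac{d}{dT}$, let $\mathcal Q(X)$ be the group of those $q\in K^\times$ for which $x\mapsto qx$ is a bijection of $X$, and $\sigma_q:f(T)\mapsto f(qT)$ for $q\in\mathcal Q(X)$. For $S\subseteq\mathcal Q(X)$, a $\sigma$-module over $S$ is a finite free $\mathcal H_K(X)$-module $M$ with a group morphism $\langle S\rangle\to\mathrm{Aut}_K^{\mathrm{cont}}(M)$, $q\mapsto\sigma_q^M$, such that $\sigma_q^M$ is $\sigma_q$-semilinear for all $q\in S$; a $(\sigma,\delta)$-module over $S$ is moreover endowed with a connection $\delta_1^M$, i.e. $\delta_1^M(fm)=\delta_1(f)m+f\delta_1^M(m)$.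 Morphisms are the $\mathcal H_K(X)$-linear maps commuting with $\sigma_q^M$ for all $q\in S$ (and with $\delta_1^M$). In a basis, $\sigma_q^M$ and $\delta_1^M$ are given by equations $\sigma_q(Y)=A(q,T)Y$ and $\delta_1(Y)=G(1,T)Y$. For $0<R\le r_X$ let $\mathcal U_R=\{(x,y)\in X\times X:|x-y|<R\}$. For $0<r\le r_X$, $\sigma\text{-}\mathrm{Mod}_S^{[r]}$ is the full subcategory of the $\sigma$-modules over $S$ such that $S\subseteq\mathrm{D}^-(1,r/s_X)$ and such that, for some $R$ with $r\le R\le r_X$, there is a matrix $Y(x,y)$, analytic on $\mathcal U_R$, with $Y(x,x)=\mathrm{Id}$ and $Y(qx,y)=A(q,x)Y(x,y)$ for all $q\in S$. Likewise $(\sigma,\delta)\text{-}\mathrm{Mod}_S^{[r]}$ is the full subcategory of the $(\sigma,\delta)$-modules over $S$ such that $S\subseteq\mathrm{D}^-(1,r/s_X)$ and such that, for some $R$ with $r\le R\le r_X$, the Taylor solution $Y_G(x,y)=\sum_{n\ge0}G_{[n]}(y)\frac{(x-y)^n}{n!}$ of the differential equation (where $G_{[n]}$ is the matrix of $(d/dT)^n$)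 is analytic on $\mathcal U_R$ and satisfies $Y_G(qx,y)=A(q,x)Y_G(x,y)$ for all $q\in S$. Write $\mathrm{Mod}^{\mathrm{adm}}_S$ for the union of the $\mathrm{Mod}^{[r]}_S$ over all $r\leq r_X$. For $S=\{q\}$ one writes $\sigma_q\text{-}\mathrm{Mod}$, $(\sigma_q,\delta_q)\text{-}\mathrm{Mod}$, and $\delta_1\text{-}\mathrm{Mod}$ for $(\sigma_1,\delta_1)\text{-}\mathrm{Mod}$. Let $0<r\le r_X$ and $\mathrm D=\mathrm{D}^-(1,r/s_X)\subseteq\mathcal Q(X)$. Then: (1) For every $S\subseteq\mathrm D$ and every $q\in S$ which is not a root of unity, all functors of the diagram formed by the restrictions $\mathrm{Res}^S_{\{q\}}:\sigma\text{-}\mathrm{Mod}_S^{[r]}\to\sigma_q\text{-}\mathrm{Mod}^{[r]}$, $\mathrm{Res}^S_{\{q\}}:(\sigma,\delta)\text{-}\mathrm{Mod}_S^{[r]}\to(\sigma_q,\delta_q)\text{-}\mathrm{Mod}^{[r]}$ and the forgetful functors $(\sigma,\delta)\text{-}\mathrm{Mod}_S^{[r]}\to\sigma\text{-}\mathrm{Mod}_S^{[r]}$,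 $(\sigma_q,\delta_q)\text{-}\mathrm{Mod}^{[r]}\to\sigma_q\text{-}\mathrm{Mod}^{[r]}$ are equivalences, and the diagram commutes. (2) For every $q\in\mathrm D$ which is not a root of unity, the same holds for the diagram formed by $\bigcup_{t}\sigma\text{-}\mathrm{Mod}^{\mathrm{adm}}_{\mathrm{D}^-(1,t/s_X)}$, $\bigcup_{t}(\sigma,\delta)\text{-}\mathrm{Mod}^{\mathrm{adm}}_{\mathrm{D}^-(1,t/s_X)}$, $\sigma_q\text{-}\mathrm{Mod}^{\mathrm{adm}}$ and $(\sigma_q,\delta_q)\text{-}\mathrm{Mod}^{\mathrm{adm}}$, where $t$ runs through the real numbers $t>|q-1|s_X$ (a morphism in such a union is an $\mathcal H_K(X)$-linear map which is a morphism over $\mathrm{D}^-(1,t/s_X)$ for some small enough $t>|q-1|s_X$). (3) If $q,q'\in\mathrm D$ are not roots of unity, then $\mathrm{Res}^{\mathrm D}_{q'}\circ(\mathrm{Res}^{\mathrm D}_q)^{-1}:\sigma_q\text{-}\mathrm{Mod}^{[r]}\to\sigma_{q'}\text{-}\mathrm{Mod}^{[r]}$ is defined ($\mathrm{Res}^{\mathrm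 D}_q$ is an equivalence) and is an equivalence. For all $q,q'\in\mathrm D$, roots of unity or not, the same holds for $\mathrm{Def}_{q,q'}=\mathrm{Res}^{\mathrm D}_{q'}\circ(\mathrm{Res}^{\mathrm D}_q)^{-1}:(\sigma_q,\delta_q)\text{-}\mathrm{Mod}^{[r]}\to(\sigma_{q'},\delta_{q'})\text{-}\mathrm{Mod}^{[r]}$. (4) If $q\in\mathrm D$ is not a root of unity, then $\mathrm{Conf}_q^{\mathrm{Tay}}=\mathrm{Def}_{q,1}\circ(\mathrm{Forget}\ \delta_q)^{-1}:\sigma_q\text{-}\mathrm{Mod}^{[r]}\to\delta_1\text{-}\mathrm{Mod}^{[r]}$ is an equivalence. It sends a $q$-difference module $M$ to a differential module with the same generic Taylor solution: for a suitable identification of the underlying $\mathcal H_K(X)$-modules, in every basis and for all $(x,y)\in\mathcal U_r$, $\sum_{n\ge0}H_n(y)\frac{(x-y)_{q,n}}{[n]_q^!}=\sum_{n\ge 0}G_{[n]}(y)\frac{(x-y)^n}{n!}$, both series being convergent, where $H_n$ is the matrix of $d_q^n$, $d_q=\frac{\sigma_q-1}{(q-1)T}$, $(x-y)_{q,n}=\prod_{i=0}^{n-1}(x-q^iy)$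 and $[n]_q^!=\prod_{i=1}^n(1+q+\dots+q^{i-1})$. -/

import Mathlib

open Filter Topology CategoryTheory Polynomial BoundedContinuousFunction

universe u

noncomputable section

namespace QDiff

section Field

variable (K : Type u) [NontriviallyNormedField K] [IsUltrametricDist K] [CompleteSpace K]

/-- An algebraic closure of the ultrametric field `K`, with the unique absolute value extending
that of `K`. -/
def AlgCl : Type u := AlgebraicClosure K

instance : NormedField (AlgCl K) := spectralNorm.normedField K (AlgebraicClosure K)

instance : NormedAlgebra K (AlgCl K) := spectralNorm.normedAlgebra K (AlgebraicClosure K)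

/-- The completion of the algebraic closure of `K`. -/
abbrev CC : Type u := UniformSpace.Completion (AlgCl K)

end Field

/-- An affinoid `D⁺(c 0, R 0) - ⋃_{1 ≤ i ≤ n} D⁻(c i, R i)` of the affine line over `K`, with all
the centers `c i` in `D⁺(c 0, R 0)`. -/
structure Affinoid (K : Type u) [NontriviallyNormedField K] where
  /-- the number of holes -/
  n : ℕ
  /-- the centers -/
  c : Fin (n + 1) → K
  /-- the radii -/
  R : Fin (n + 1) → ℝ
  R_pos : ∀ i, 0 < R i
  c_mem : ∀ i, ‖c i - c 0‖ ≤ R 0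

namespace Affinoid

variable {K : Type u} [NontriviallyNormedField K] [IsUltrametricDist K] [CompleteSpace K]
  (X : Affinoid K)

/-- `r_X = min (R 0, …, R n)`. -/
def rX : ℝ := Finset.univ.inf' Finset.univ_nonempty X.R

/-- `s_X = max (|c 0|, R 0)`. -/
def sX : ℝ := max ‖X.c 0‖ (X.R 0)

/-- The set of points of `X` with values in the completion of the algebraic closure of `K`. -/
def pts : Set (CC K) :=
  {x | ‖x - algebraMap K (CC K) (X.c 0)‖ ≤ X.R 0 ∧
    ∀ i, i ≠ 0 → X.R i ≤ ‖x - algebraMap K (CC K) (X.c i)‖}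

/-- The points of `X`, as a type. -/
abbrev Pt : Type u := X.pts

/-- The rational functions `P / Q` with coefficients in `K` and without poles on `X`
(they are automatically bounded and continuous on `X`). -/
def ratFun : Subalgebra K (X.Pt →ᵇ CC K) where
  carrier := {f | ∃ P Q : K[X], (∀ x : X.Pt, aeval (x : CC K) Q ≠ 0) ∧
    ∀ x : X.Pt, f x = aeval (x : CC K) P / aeval (x : CC K) Q}
  mul_mem' := by
    rintro f g ⟨P, Q, hQ, hf⟩ ⟨P', Q', hQ', hg⟩
    refine ⟨P * P', Q * Q', fun x => ?_, fun x => ?_⟩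
    · rw [map_mul]; exact mul_ne_zero (hQ x) (hQ' x)
    · rw [BoundedContinuousFunction.mul_apply, hf, hg, map_mul, map_mul, div_mul_div_comm]
  add_mem' := by
    rintro f g ⟨P, Q, hQ, hf⟩ ⟨P', Q', hQ', hg⟩
    refine ⟨P * Q' + Q * P', Q * Q', fun x => ?_, fun x => ?_⟩
    · rw [map_mul]; exact mul_ne_zero (hQ x) (hQ' x)
    · rw [BoundedContinuousFunction.add_apply, hf, hg, map_add, map_mul, map_mul, map_mul,
        div_add_div _ _ (hQ x) (hQ' x)]
  algebraMap_mem' := fun a => ⟨Polynomial.C a, 1, fun x => by simp, fun x => by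
    rw [map_one, div_one, aeval_C]; rfl⟩

/-- The closure of the ring of rational functions without poles on `X`, for the sup-norm. -/
def analyticElements : Subalgebra K (X.Pt →ᵇ CC K) := X.ratFun.topologicalClosure

/-- The ring `H_K(X)` of analytic elements on `X`: the completion of the ring of rational functions
without poles on `X` for the sup-norm on `X`, realized as a ring of functions on `X`. -/
def H : Type u := X.analyticElements

instance : NormedCommRing X.H := inferInstanceAs (NormedCommRing X.analyticElements)

instance : NormedAlgebra K X.H := inferInstanceAs (NormedAlgebra K X.analyticElements)

instance : CoeFun X.H (fun _ => X.Pt → CC K) := ⟨fun f => f.1⟩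

/-- The coordinate function `T`. -/
def T : X.H :=
  ⟨BoundedContinuousFunction.ofNormedAddCommGroup (fun x : X.Pt => (x : CC K))
      continuous_subtype_val (X.R 0 + ‖algebraMap K (CC K) (X.c 0)‖) (fun x => by
        have h := x.2.1
        calc ‖(x : CC K)‖
            = ‖((x : CC K) - algebraMap K (CC K) (X.c 0)) + algebraMap K (CC K) (X.c 0)‖ := by
              rw [sub_add_cancel]
          _ ≤ _ := (norm_add_le _ _).trans (by gcongr)),
    subset_closure ⟨Polynomial.X, 1, fun x => by simp, fun x => by simp⟩⟩

/-- The group `Q(X)` of those `q` for which `x ↦ q x` is a bijection of `X`. -/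
def Q : Subgroup Kˣ where
  carrier := {q | ∀ x : CC K, algebraMap K (CC K) q * x ∈ X.pts ↔ x ∈ X.pts}
  mul_mem' := by
    intro a b ha hb x
    rw [Units.val_mul, map_mul, mul_assoc, ha, hb]
  one_mem' := by intro x; simp
  inv_mem' := by
    intro a ha x
    rw [← ha, ← mul_assoc, ← map_mul, Units.mul_inv, map_one, one_mul]

/-- The bijection `x ↦ q x` of `X`. -/
def mulPt (q : X.Q) (x : X.Pt) : X.Pt :=
  ⟨algebraMap K (CC K) ((q : Kˣ) : K) * x, (q.2 x).2 x.2⟩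

theorem continuous_mulPt (q : X.Q) : Continuous (X.mulPt q) :=
  Continuous.subtype_mk (continuous_const.mul continuous_subtype_val) _

/-- `f(T) ↦ f(qT)` on bounded continuous functions. -/
def compMul (q : X.Q) : (X.Pt →ᵇ CC K) →ₐ[K] (X.Pt →ᵇ CC K) where
  toFun f := f.compContinuous ⟨X.mulPt q, X.continuous_mulPt q⟩
  map_one' := rfl
  map_mul' _ _ := rfl
  map_zero' := rfl
  map_add' _ _ := rfl
  commutes' _ := rfl

theorem compMul_mem (q : X.Q) {f : X.Pt →ᵇ CC K} (hf : f ∈ X.analyticElements) :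
    X.compMul q f ∈ X.analyticElements := by
  have hc : Continuous (X.compMul q) :=
    (LipschitzWith.of_dist_le_mul (K := 1) fun f g => by
      rw [NNReal.coe_one, one_mul]
      exact (BoundedContinuousFunction.dist_le dist_nonneg).2
        fun x => BoundedContinuousFunction.dist_coe_le_dist (f := f) (g := g)
          (X.mulPt q x)).continuous
  refine map_mem_closure hc hf ?_
  rintro g ⟨P, R, hR, hg⟩
  have key : ∀ (S : K[X]) (x : X.Pt),
      aeval (x : CC K) (S.comp (Polynomial.C ((q : Kˣ) : K) * Polynomial.X)) =
        aeval (X.mulPt q x : CC K) S := by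
    intro S x
    rw [aeval_comp]
    simp [mulPt]
  refine ⟨P.comp (Polynomial.C ((q : Kˣ) : K) * Polynomial.X),
    R.comp (Polynomial.C ((q : Kˣ) : K) * Polynomial.X), fun x => ?_, fun x => ?_⟩
  · rw [key]; exact hR _
  · rw [key, key]; exact hg _

/-- The automorphism `σ_q : f(T) ↦ f(qT)` of `H_K(X)`. -/
def sigma (q : X.Q) : X.H →ₐ[K] X.H :=
  ((X.compMul q).comp X.analyticElements.val).codRestrict X.analyticElements
    fun f => X.compMul_mem q f.2

/-- `g` is the derivative of the function `f` on `X`. -/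
def IsDeriv (f g : X.H) : Prop :=
  ∀ x : X.Pt, Tendsto (fun y : X.Pt => (f y - f x) / ((y : CC K) - x)) (𝓝[≠] x) (𝓝 (g x))

/-- The derivation `d/dT` of `H_K(X)`. (Every analytic element has a derivative, which is again an
analytic element, so that the second case below does not occur.) -/
def ddT (f : X.H) : X.H :=
  open Classical in if h : ∃ g, X.IsDeriv f g then h.choose else 0

/-- The derivation `δ₁ = T d/dT` of `H_K(X)`. -/
def delta (f : X.H) : X.H := X.T * X.ddT f

/-- The disk `D⁻(1, r / s_X)`. (For `r ≤ r_X` every `q ∈ K` with `|q - 1| < r / s_X` stabilizes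
the outer disk and each of the holes, hence belongs to `Q(X)`.) -/
def disk (r : ℝ) : Set X.Q := {q | ‖((q : Kˣ) : K) - 1‖ < r / X.sX}

theorem one_mem_disk {X : Affinoid K} {r : ℝ} {q : X.Q} (hq : {q} ⊆ X.disk r) :
    {1} ⊆ X.disk r := by
  have h : ‖((q : Kˣ) : K) - 1‖ < r / X.sX := hq (Set.mem_singleton q)
  refine Set.singleton_subset_iff.2 ?_
  change ‖(((1 : X.Q) : Kˣ) : K) - 1‖ < r / X.sX
  simpa using (norm_nonneg _).trans_lt h

end Affinoid

section Modules

variable {K : Type u} [NontriviallyNormedField K] [IsUltrametricDist K] [CompleteSpace K]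

/-- A discrete `σ`-module over `S`: a finite free `H_K(X)`-module with a morphism from the
group `⟨S⟩` to its `K`-linear automorphisms, `σ_q`-semilinear for `q ∈ S`.
(Semilinearity implies continuity for the product topology, since `σ_q` is continuous.) -/
structure SigmaMod (X : Affinoid K) (S : Set X.Q) where
  /-- the underlying module -/
  carrier : Type u
  [addCommGroup : AddCommGroup carrier]
  [moduleK : Module K carrier]
  [moduleH : Module X.H carrier]
  [isScalarTower : IsScalarTower K X.H carrier]
  [free : Module.Free X.H carrier]
  [finite : Module.Finite X.H carrier]
  /-- the action of `⟨S⟩` -/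
  σ : Subgroup.closure S →* (carrier ≃ₗ[K] carrier)
  σ_smul : ∀ (q : X.Q) (hq : q ∈ S) (f : X.H) (m : carrier),
    σ ⟨q, Subgroup.subset_closure hq⟩ (f • m) =
      X.sigma q f • σ ⟨q, Subgroup.subset_closure hq⟩ m

attribute [instance] SigmaMod.addCommGroup SigmaMod.moduleK SigmaMod.moduleH
  SigmaMod.isScalarTower SigmaMod.free SigmaMod.finite

/-- A discrete `(σ, δ)`-module over `S`: a discrete `σ`-module with a connection `δ₁`. -/
structure SigmaDeltaMod (X : Affinoid K) (S : Set X.Q) extends SigmaMod X S where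
  /-- the connection -/
  δ : carrier →ₗ[K] carrier
  leibniz : ∀ (f : X.H) (m : carrier), δ (f • m) = X.delta f • m + f • δ m

variable {X : Affinoid K} {S : Set X.Q}

/-- The operator `σ_q` of `M`, for `q ∈ S`. -/
def SigmaMod.op (M : SigmaMod X S) (q : X.Q) (hq : q ∈ S) : M.carrier ≃ₗ[K] M.carrier :=
  M.σ ⟨q, Subgroup.subset_closure hq⟩

/-- Morphisms of discrete `σ`-modules. -/
@[ext]
structure SigmaMod.Hom (M N : SigmaMod X S) where
  /-- the underlying linear map -/
  lin : M.carrier →ₗ[X.H] N.carrier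
  comm : ∀ (q : X.Q) (hq : q ∈ S) (m : M.carrier), lin (M.op q hq m) = N.op q hq (lin m)

instance : Category (SigmaMod X S) where
  Hom := SigmaMod.Hom
  id M := ⟨LinearMap.id, fun _ _ _ => rfl⟩
  comp f g := ⟨g.lin.comp f.lin, fun q hq m => by simp [f.comm, g.comm]⟩

/-- Morphisms of discrete `(σ, δ)`-modules. -/
@[ext]
structure SigmaDeltaMod.Hom (M N : SigmaDeltaMod X S) where
  /-- the underlying linear map -/
  lin : M.carrier →ₗ[X.H] N.carrier
  comm : ∀ (q : X.Q) (hq : q ∈ S) (m : M.carrier), lin (M.op q hq m) = N.op q hq (lin m)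
  comm_δ : ∀ m : M.carrier, lin (M.δ m) = N.δ (lin m)

instance : Category (SigmaDeltaMod X S) where
  Hom := SigmaDeltaMod.Hom
  id M := ⟨LinearMap.id, fun _ _ _ => rfl, fun _ => rfl⟩
  comp f g := ⟨g.lin.comp f.lin, fun q hq m => by simp [f.comm, g.comm],
    fun m => by simp [f.comm_δ, g.comm_δ]⟩

/-- The object obtained from a `σ`-module by restriction of `S` to a subset. -/
def SigmaMod.restrict {S' : Set X.Q} (h : S' ⊆ S) (M : SigmaMod X S) : SigmaMod X S' where
  carrier := M.carrier
  σ := M.σ.comp (Subgroup.inclusion (Subgroup.closure_mono h))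
  σ_smul q hq f m := M.σ_smul q (h hq) f m

/-- The object obtained from a `(σ, δ)`-module by restriction of `S` to a subset. -/
def SigmaDeltaMod.restrict {S' : Set X.Q} (h : S' ⊆ S) (M : SigmaDeltaMod X S) :
    SigmaDeltaMod X S' where
  toSigmaMod := M.toSigmaMod.restrict h
  δ := M.δ
  leibniz := M.leibniz

/-- The restriction functor on discrete `σ`-modules. -/
def resσ {S' : Set X.Q} (h : S' ⊆ S) : SigmaMod X S ⥤ SigmaMod X S' where
  obj M := M.restrict h
  map f := ⟨f.lin, fun q hq m => f.comm q (h hq) m⟩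

/-- The restriction functor on discrete `(σ, δ)`-modules. -/
def resσδ {S' : Set X.Q} (h : S' ⊆ S) : SigmaDeltaMod X S ⥤ SigmaDeltaMod X S' where
  obj M := M.restrict h
  map f := ⟨f.lin, fun q hq m => f.comm q (h hq) m, f.comm_δ⟩

variable (X S) in
/-- The functor forgetting the connection. -/
def forgetδ : SigmaDeltaMod X S ⥤ SigmaMod X S where
  obj M := M.toSigmaMod
  map f := ⟨f.lin, f.comm⟩

/-! ### Taylor solutions -/

/-- The matrix `A(q, T)` of `σ_q` in the basis `b`: `σ_q (b i) = ∑ j, A i j • b j`. -/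
def SigmaMod.matσ (M : SigmaMod X S) (q : X.Q) (hq : q ∈ S) {n : ℕ}
    (b : Module.Basis (Fin n) X.H M.carrier) : Matrix (Fin n) (Fin n) X.H :=
  Matrix.of fun i j => b.repr (M.op q hq (b i)) j

/-- The matrix `G(1, T)` of `δ₁` in the basis `b`: `δ₁ (b i) = ∑ j, G i j • b j`. -/
def SigmaDeltaMod.matδ (M : SigmaDeltaMod X S) {n : ℕ}
    (b : Module.Basis (Fin n) X.H M.carrier) : Matrix (Fin n) (Fin n) X.H :=
  Matrix.of fun i j => b.repr (M.δ (b i)) j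

/-- `Y(x, y) = ∑ k, Y k (y) (x - y) ^ k` is analytic on `{(x, y) ∈ X × X : |x - y| < R}`
(for `R ≤ r_X` this domain is the product of `X` and of the open disk of radius `R`, through
`(x, y) ↦ (y, x - y)`). -/
def ConvergesOn (R : ℝ) {n : ℕ} (Y : ℕ → Matrix (Fin n) (Fin n) X.H) : Prop :=
  ∀ ρ : ℝ, 0 ≤ ρ → ρ < R → ∀ i j, Tendsto (fun k => ‖Y k i j‖ * ρ ^ k) atTop (𝓝 0)

/-- The value `Y(x, y) = ∑ k, Y k (y) (x - y) ^ k`. -/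
def diagEval {n : ℕ} (Y : ℕ → Matrix (Fin n) (Fin n) X.H) (x y : X.Pt) :
    Matrix (Fin n) (Fin n) (CC K) :=
  Matrix.of fun i j => ∑' k : ℕ, Y k i j y * ((x : CC K) - y) ^ k

/-- `Y(q x, y) = A(x) Y(x, y)` whenever `|x - y| < R`. -/
def IsSolution (R : ℝ) (q : X.Q) {n : ℕ} (A : Matrix (Fin n) (Fin n) X.H)
    (Y : ℕ → Matrix (Fin n) (Fin n) X.H) : Prop :=
  ∀ x y : X.Pt, ‖(x : CC K) - y‖ < R →
    diagEval Y (X.mulPt q x) y = A.map (fun f => f x) * diagEval Y x y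

/-- `F k` is the matrix of `(d/dT)^k` for the differential equation `δ₁(Y) = G Y`, i.e.
`F 0 = 1` and `F (k + 1) = (F k)' + F k * (G / T)`. -/
def IsDerivMatrices {n : ℕ} (G : Matrix (Fin n) (Fin n) X.H)
    (F : ℕ → Matrix (Fin n) (Fin n) X.H) : Prop :=
  F 0 = 1 ∧ ∀ k, X.T • F (k + 1) = (F k).map X.delta + F k * G

/-- The coefficients `F k / k!` of `∑ k, F k (y) (x - y) ^ k / k!`. -/
def taylorCoeff {n : ℕ} (F : ℕ → Matrix (Fin n) (Fin n) X.H) (k : ℕ) :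
    Matrix (Fin n) (Fin n) X.H :=
  ((k.factorial : K)⁻¹) • F k

/-- `H k` is the matrix of `(d_q)^k`, where `d_q = (σ_q - 1) / ((q - 1) T)`, for the `q`-difference
equation `σ_q(Y) = A Y`, i.e. `H 0 = 1` and `(q - 1) T H (k + 1) = σ_q(H k) A - H k`. -/
def IsQDerivMatrices (q : X.Q) {n : ℕ} (A : Matrix (Fin n) (Fin n) X.H)
    (H : ℕ → Matrix (Fin n) (Fin n) X.H) : Prop :=
  H 0 = 1 ∧ ∀ k, ((((q : Kˣ) : K) - 1) • X.T) • H (k + 1) = (H k).map (X.sigma q) * A - H k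

/-- `[n]_q! = ∏_{i = 1}^n (1 + q + ⋯ + q ^ (i - 1))`. -/
def qFactorial (q : K) (n : ℕ) : K := ∏ i ∈ Finset.range n, ∑ j ∈ Finset.range (i + 1), q ^ j

/-- `(x - y)_{q, n} = (x - y)(x - q y)⋯(x - q ^ (n - 1) y)`. -/
def qPow (q : K) (x y : CC K) (n : ℕ) : CC K :=
  ∏ i ∈ Finset.range n, (x - algebraMap K (CC K) (q ^ i) * y)

/-- The `q`-Taylor series `∑ k, H k (y) (x - y)_{q, k} / [k]_q!` converges to `Y(x, y)` whenever
`|x - y| < R`. -/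
def HasQTaylorSum (R : ℝ) (q : X.Q) {n : ℕ} (H : ℕ → Matrix (Fin n) (Fin n) X.H)
    (Y : ℕ → Matrix (Fin n) (Fin n) X.H) : Prop :=
  ∀ x y : X.Pt, ‖(x : CC K) - y‖ < R → ∀ i j,
    HasSum (fun k => H k i j y * qPow ((q : Kˣ) : K) x y k /
      algebraMap K (CC K) (qFactorial ((q : Kˣ) : K) k)) (diagEval Y x y i j)

/-! ### Taylor admissible modules -/

variable (X S) in
/-- The objects of `σ-Mod(H_K(X))_S^{[r]}`: Taylor admissible `σ`-modules over `S`, of generic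
radius at least `r`. The solution `Y(x, y)` is normalized by `Y(x, x) = 1`. -/
def admσ (r : ℝ) : ObjectProperty (SigmaMod X S) := fun M =>
  S ⊆ X.disk r ∧ ∃ (n : ℕ) (b : Module.Basis (Fin n) X.H M.carrier) (R : ℝ)
    (Y : ℕ → Matrix (Fin n) (Fin n) X.H),
    r ≤ R ∧ R ≤ X.rX ∧ Y 0 = 1 ∧ ConvergesOn R Y ∧
      ∀ (q : X.Q) (hq : q ∈ S), IsSolution R q (M.matσ q hq b) Y

variable (X S) in
/-- The objects of `(σ, δ)-Mod(H_K(X))_S^{[r]}`: Taylor admissible `(σ, δ)`-modules over `S`, of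
generic radius at least `r`: the Taylor solution of the differential equation converges for
`|x - y| < R` with `r ≤ R ≤ r_X`, and is a solution of the equations of all `σ_q`, `q ∈ S`. -/
def admσδ (r : ℝ) : ObjectProperty (SigmaDeltaMod X S) := fun M =>
  S ⊆ X.disk r ∧ ∃ (n : ℕ) (b : Module.Basis (Fin n) X.H M.carrier) (R : ℝ)
    (F : ℕ → Matrix (Fin n) (Fin n) X.H),
    r ≤ R ∧ R ≤ X.rX ∧ IsDerivMatrices (M.matδ b) F ∧ ConvergesOn R (taylorCoeff F) ∧
      ∀ (q : X.Q) (hq : q ∈ S), IsSolution R q (M.matσ q hq b) (taylorCoeff F)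

variable (X S) in
/-- The objects of `σ-Mod(H_K(X))_S^{adm}`. -/
def admσAny : ObjectProperty (SigmaMod X S) := fun M => ∃ r, r ≤ X.rX ∧ admσ X S r M

variable (X S) in
/-- The objects of `(σ, δ)-Mod(H_K(X))_S^{adm}`. -/
def admσδAny : ObjectProperty (SigmaDeltaMod X S) := fun M => ∃ r, r ≤ X.rX ∧ admσδ X S r M

variable (X S) in
/-- `σ-Mod(H_K(X))_S^{[r]}`. For `S = {q}` this is `σ_q-Mod(H_K(X))^{[r]}`. -/
abbrev SigmaModr (r : ℝ) := (admσ X S r).FullSubcategory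

variable (X S) in
/-- `(σ, δ)-Mod(H_K(X))_S^{[r]}`. For `S = {q}` this is `(σ_q, δ_q)-Mod(H_K(X))^{[r]}`, and for
`S = {1}` this is `δ₁-Mod(H_K(X))^{[r]}`. -/
abbrev SigmaDeltaModr (r : ℝ) := (admσδ X S r).FullSubcategory

theorem admσ_restrict {S' : Set X.Q} (h : S' ⊆ S) {r : ℝ} (M : SigmaMod X S)
    (hM : admσ X S r M) : admσ X S' r (M.restrict h) := by
  obtain ⟨hS, n, b, R, Y, h1, h2, h3, h4, h5⟩ := hM
  exact ⟨h.trans hS, n, b, R, Y, h1, h2, h3, h4, fun q hq => h5 q (h hq)⟩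

theorem admσδ_restrict {S' : Set X.Q} (h : S' ⊆ S) {r : ℝ} (M : SigmaDeltaMod X S)
    (hM : admσδ X S r M) : admσδ X S' r (M.restrict h) := by
  obtain ⟨hS, n, b, R, F, h1, h2, h3, h4, h5⟩ := hM
  exact ⟨h.trans hS, n, b, R, F, h1, h2, h3, h4, fun q hq => h5 q (h hq)⟩

theorem admσ_forget {r : ℝ} (M : SigmaDeltaMod X S) (hM : admσδ X S r M) :
    admσ X S r M.toSigmaMod := by
  obtain ⟨hS, n, b, R, F, h1, h2, h3, h4, h5⟩ := hM
  exact ⟨hS, n, b, R, taylorCoeff F, h1, h2, by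
    rw [taylorCoeff, h3.1, Nat.factorial_zero, Nat.cast_one, inv_one, one_smul], h4, h5⟩

/-- `Res : σ-Mod(H_K(X))_S^{[r]} ⥤ σ-Mod(H_K(X))_{S'}^{[r]}` for `S' ⊆ S`. -/
def resσr {S' : Set X.Q} (h : S' ⊆ S) (r : ℝ) : SigmaModr X S r ⥤ SigmaModr X S' r :=
  ObjectProperty.lift _ ((admσ X S r).ι ⋙ resσ h) fun M => admσ_restrict h M.1 M.2

/-- `Res : (σ, δ)-Mod(H_K(X))_S^{[r]} ⥤ (σ, δ)-Mod(H_K(X))_{S'}^{[r]}` for `S' ⊆ S`. -/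
def resσδr {S' : Set X.Q} (h : S' ⊆ S) (r : ℝ) :
    SigmaDeltaModr X S r ⥤ SigmaDeltaModr X S' r :=
  ObjectProperty.lift _ ((admσδ X S r).ι ⋙ resσδ h) fun M => admσδ_restrict h M.1 M.2

variable (X S) in
/-- `Forget δ : (σ, δ)-Mod(H_K(X))_S^{[r]} ⥤ σ-Mod(H_K(X))_S^{[r]}`. -/
def forgetδr (r : ℝ) : SigmaDeltaModr X S r ⥤ SigmaModr X S r :=
  ObjectProperty.lift _ ((admσδ X S r).ι ⋙ forgetδ X S) fun M => admσ_forget M.1 M.2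

variable (X S) in
/-- `Forget δ : (σ, δ)-Mod(H_K(X))_S^{adm} ⥤ σ-Mod(H_K(X))_S^{adm}`. -/
def forgetδAny : (admσδAny X S).FullSubcategory ⥤ (admσAny X S).FullSubcategory :=
  ObjectProperty.lift _ ((admσδAny X S).ι ⋙ forgetδ X S) fun M =>
    let ⟨r, hr, h⟩ := M.2; ⟨r, hr, admσ_forget M.1 h⟩

/-! ### Deformation and confluence -/

/-- The deformation functor
`Res_{q'} ∘ (Res_q)⁻¹ : σ_q-Mod(H_K(X))^{[r]} ⥤ σ_{q'}-Mod(H_K(X))^{[r]}`, where `Res_q`, `Res_{q'}`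
are the restrictions from the disk `D⁻(1, r / s_X)`. -/
def defσ (r : ℝ) {q q' : X.Q} (hq : {q} ⊆ X.disk r) (hq' : {q'} ⊆ X.disk r)
    [(resσr hq r).IsEquivalence] : SigmaModr X {q} r ⥤ SigmaModr X {q'} r :=
  (resσr hq r).inv ⋙ resσr hq' r

/-- The deformation functor
`Res_{q'} ∘ (Res_q)⁻¹ : (σ_q, δ_q)-Mod(H_K(X))^{[r]} ⥤ (σ_{q'}, δ_{q'})-Mod(H_K(X))^{[r]}`. -/
def defσδ (r : ℝ) {q q' : X.Q} (hq : {q} ⊆ X.disk r) (hq' : {q'} ⊆ X.disk r)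
    [(resσδr hq r).IsEquivalence] : SigmaDeltaModr X {q} r ⥤ SigmaDeltaModr X {q'} r :=
  (resσδr hq r).inv ⋙ resσδr hq' r

/-- The confluence functor
`Def_{q, 1} ∘ (Forget δ_q)⁻¹ : σ_q-Mod(H_K(X))^{[r]} ⥤ δ₁-Mod(H_K(X))^{[r]}`. -/
def conf (r : ℝ) {q : X.Q} (hq : {q} ⊆ X.disk r)
    [(forgetδr X {q} r).IsEquivalence] [(resσδr hq r).IsEquivalence] :
    SigmaModr X {q} r ⥤ SigmaDeltaModr X {1} r :=
  (forgetδr X {q} r).inv ⋙ defσδ r hq (Affinoid.one_mem_disk hq)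

/-- The `q`-difference module `M` and the differential module `N` have the same generic Taylor
solution, for `|x - y| < r`: for a suitable identification `φ` of their underlying modules, and for
all bases, `∑ k, H k (y) (x - y)_{q, k} / [k]_q! = ∑ k, F k (y) (x - y) ^ k / k!`. -/
def SameTaylorSolution (r : ℝ) {q : X.Q} (M : SigmaMod X {q}) (N : SigmaDeltaMod X {1}) : Prop :=
  ∃ φ : M.carrier ≃ₗ[X.H] N.carrier, ∀ (n : ℕ) (b : Module.Basis (Fin n) X.H M.carrier),
    ∃ H F : ℕ → Matrix (Fin n) (Fin n) X.H,
      IsQDerivMatrices q (M.matσ q rfl b) H ∧ IsDerivMatrices (N.matδ (b.map φ)) F ∧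
        ConvergesOn r (taylorCoeff F) ∧ HasQTaylorSum r q H (taylorCoeff F)

/-! ### Unions over the disks around `q` -/

/-- The objects of `⋃_r σ-Mod(H_K(X))_{D⁻(1, r / s_X)}^{adm}`, where `r` runs through the real
numbers with `q ∈ D⁻(1, r / s_X)`. -/
structure GermSigma (X : Affinoid K) (q : X.Q) where
  /-- the radius -/
  r : ℝ
  mem : q ∈ X.disk r
  /-- the module -/
  obj : SigmaMod X (X.disk r)
  adm : admσAny X (X.disk r) obj

/-- The objects of `⋃_r (σ, δ)-Mod(H_K(X))_{D⁻(1, r / s_X)}^{adm}`. -/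
structure GermSigmaDelta (X : Affinoid K) (q : X.Q) where
  /-- the radius -/
  r : ℝ
  mem : q ∈ X.disk r
  /-- the module -/
  obj : SigmaDeltaMod X (X.disk r)
  adm : admσδAny X (X.disk r) obj

variable {q : X.Q}

/-- Morphisms in the union of the categories of `σ`-modules over the disks `D⁻(1, t / s_X)`
containing `q`: linear maps which are morphisms over one of these disks. -/
@[ext]
structure GermSigma.Hom (M N : GermSigma X q) where
  /-- the underlying linear map -/
  lin : M.obj.carrier →ₗ[X.H] N.obj.carrier
  comm : ∃ t : ℝ, q ∈ X.disk t ∧ ∀ q' ∈ X.disk t, ∀ (hM : q' ∈ X.disk M.r) (hN : q' ∈ X.disk N.r)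
    (m : M.obj.carrier), lin (M.obj.op q' hM m) = N.obj.op q' hN (lin m)

/-- Morphisms in the union of the categories of `(σ, δ)`-modules over the disks `D⁻(1, t / s_X)`
containing `q`. -/
@[ext]
structure GermSigmaDelta.Hom (M N : GermSigmaDelta X q) where
  /-- the underlying linear map -/
  lin : M.obj.carrier →ₗ[X.H] N.obj.carrier
  comm : ∃ t : ℝ, q ∈ X.disk t ∧ ∀ q' ∈ X.disk t, ∀ (hM : q' ∈ X.disk M.r) (hN : q' ∈ X.disk N.r)
    (m : M.obj.carrier), lin (M.obj.op q' hM m) = N.obj.op q' hN (lin m)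
  comm_δ : ∀ m : M.obj.carrier, lin (M.obj.δ m) = N.obj.δ (lin m)

theorem sX_pos {K : Type u} [NontriviallyNormedField K] (X : Affinoid K) : 0 < X.sX :=
  lt_max_of_lt_right (X.R_pos 0)

theorem mem_disk_min {q' : X.Q} {s t : ℝ} :
    q' ∈ X.disk (min s t) ↔ q' ∈ X.disk s ∧ q' ∈ X.disk t := by
  simp only [Affinoid.disk, Set.mem_ofPred_eq, lt_div_iff₀ (sX_pos X), lt_min_iff]

theorem germ_comp_comm (M N P : GermSigma X q) (f : M.obj.carrier →ₗ[X.H] N.obj.carrier)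
    (g : N.obj.carrier →ₗ[X.H] P.obj.carrier)
    (hf : ∃ t : ℝ, q ∈ X.disk t ∧ ∀ q' ∈ X.disk t, ∀ (hM : q' ∈ X.disk M.r)
      (hN : q' ∈ X.disk N.r) (m : M.obj.carrier), f (M.obj.op q' hM m) = N.obj.op q' hN (f m))
    (hg : ∃ t : ℝ, q ∈ X.disk t ∧ ∀ q' ∈ X.disk t, ∀ (hM : q' ∈ X.disk N.r)
      (hN : q' ∈ X.disk P.r) (m : N.obj.carrier), g (N.obj.op q' hM m) = P.obj.op q' hN (g m)) :
    ∃ t : ℝ, q ∈ X.disk t ∧ ∀ q' ∈ X.disk t, ∀ (hM : q' ∈ X.disk M.r)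
      (hN : q' ∈ X.disk P.r) (m : M.obj.carrier),
      g.comp f (M.obj.op q' hM m) = P.obj.op q' hN (g.comp f m) := by
  obtain ⟨t, ht, hf⟩ := hf
  obtain ⟨s, hs, hg⟩ := hg
  refine ⟨min (min t s) N.r, mem_disk_min.2 ⟨mem_disk_min.2 ⟨ht, hs⟩, N.mem⟩, ?_⟩
  intro q' hq' hM hP m
  obtain ⟨h12, hN⟩ := mem_disk_min.1 hq'
  obtain ⟨h1, h2⟩ := mem_disk_min.1 h12
  rw [LinearMap.comp_apply, hf q' h1 hM hN, hg q' h2 hN hP, LinearMap.comp_apply]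

theorem germδ_adm (M : GermSigmaDelta X q) : admσAny X (X.disk M.r) M.obj.toSigmaMod :=
  let ⟨r, hr, h⟩ := M.adm; ⟨r, hr, admσ_forget M.obj h⟩

/-- The `σ`-module underlying a `(σ, δ)`-module. -/
def GermSigmaDelta.toGermSigma (M : GermSigmaDelta X q) : GermSigma X q :=
  ⟨M.r, M.mem, M.obj.toSigmaMod, germδ_adm M⟩

instance : Category (GermSigma X q) where
  Hom := GermSigma.Hom
  id M := ⟨LinearMap.id, M.r, M.mem, fun _ _ _ _ _ => rfl⟩
  comp {M N P} f g := ⟨g.lin.comp f.lin, germ_comp_comm M N P f.lin g.lin f.comm g.comm⟩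

instance : Category (GermSigmaDelta X q) where
  Hom := GermSigmaDelta.Hom
  id M := ⟨LinearMap.id, ⟨M.r, M.mem, fun _ _ _ _ _ => rfl⟩, fun _ => rfl⟩
  comp {M N P} f g := ⟨g.lin.comp f.lin,
    germ_comp_comm M.toGermSigma N.toGermSigma P.toGermSigma f.lin g.lin f.comm g.comm,
    fun m => by simp [f.comm_δ, g.comm_δ]⟩

variable (X q) in
/-- The restriction functor `⋃_r σ-Mod(H_K(X))_{D⁻(1, r / s_X)}^{adm} ⥤ σ_q-Mod(H_K(X))^{adm}`. -/
def germResσ : GermSigma X q ⥤ (admσAny X {q}).FullSubcategory where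
  obj M := ⟨M.obj.restrict (Set.singleton_subset_iff.2 M.mem),
    let ⟨r, hr, h⟩ := M.adm
    ⟨r, hr, admσ_restrict (Set.singleton_subset_iff.2 M.mem) M.obj h⟩⟩
  map {M N} f := ObjectProperty.homMk ⟨f.lin, fun q' hq' m => by
    obtain ⟨t, ht, hf⟩ := f.comm
    cases hq'
    exact hf q ht M.mem N.mem m⟩

variable (X q) in
/-- The restriction functor
`⋃_r (σ, δ)-Mod(H_K(X))_{D⁻(1, r / s_X)}^{adm} ⥤ (σ_q, δ_q)-Mod(H_K(X))^{adm}`. -/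
def germResσδ : GermSigmaDelta X q ⥤ (admσδAny X {q}).FullSubcategory where
  obj M := ⟨M.obj.restrict (Set.singleton_subset_iff.2 M.mem),
    let ⟨r, hr, h⟩ := M.adm
    ⟨r, hr, admσδ_restrict (Set.singleton_subset_iff.2 M.mem) M.obj h⟩⟩
  map {M N} f := ObjectProperty.homMk ⟨f.lin, fun q' hq' m => by
    obtain ⟨t, ht, hf⟩ := f.comm
    cases hq'
    exact hf q ht M.mem N.mem m, f.comm_δ⟩

variable (X q) in
/-- The functor forgetting the connection, on the unions of categories. -/
def germForgetδ : GermSigmaDelta X q ⥤ GermSigma X q where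
  obj M := M.toGermSigma
  map f := ⟨f.lin, f.comm⟩

end Modules

end QDiff

end

open QDiff

/-! Everything is encoded in the normalized solution Y(x, y) = ∑ Y_k(y) (x - y)^k with Y_0 = 1. It
is called horizontal (`IsHorizontal`) when (k + 1) Y_{k+1} = Y_k' + Y_k Y_1, that is, when it is the
Taylor solution of the differential equation δ₁(Y) = T Y_1 Y. A horizontal Y satisfies the cocycle
relation Y(z, y) Y(y, x) = Y(z, x) (`IsHorizontal.solEval_mul_solEval`). Hence A(q, x) = Y(qx, x)
defines an action of the whole disk (`sigMat`, `diskAction`), and the connection of an admissible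
(σ, δ)-module determines its operators σ_q and its morphisms. This handles restriction of (σ,
δ)-modules, roots of unity included (`exists_extension`, `comm_op_of_comm_conn`).

The passage from σ_q to δ₁ is an accumulation argument. In mixed characteristic q^(p^N) tends to 1,
and if q is not a root of unity the points q^(p^N) z differ from z and converge to it, for z ≠ 0.
Iterating the q-difference equation gives the cocycle relation at these points, and a power series
is determined by its values along such a sequence (`eq_of_frequently_ev_eq`). The relation therefore
holds on a disk, and expanding it to first order shows that Y is horizontal
(`isHorizontal_of_isSolution`). Applied to a linear map commuting with σ_q, the same argument shows
that it commutes with δ₁ (`mul_eq_of_sigma`). So forgetting δ is an equivalence, and restriction of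
σ-modules is one because it is the remaining side of a commutative square.

The analytic input is that f ∈ H_K(X) satisfies ‖D^k f / k!‖ r_X^k ≤ ‖f‖ and equals its Taylor
series on each open disk of radius r_X (`norm_hs_le`, `apply_eq_ev`). For a quotient P / Q this
comes from Cauchy estimates for split polynomials, and it passes to the completion by density of the
rational functions.

For confluence, (x - y)^k is expanded in the products (x - y)_{q,n}, with coefficients of size at
most |q - 1|^j |y|^j for j = k - n. Rearranging the resulting double series turns the Taylor series
into a q-Taylor series, and the identity `sum_choose_mul_qCoeff` shows that its coefficients are the
matrices of d_q^n / [n]_q!. -/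

namespace QDiff

/-! ### Power series with geometrically bounded coefficients -/

section Series

/-- The sequence `‖a k‖ * ρ ^ k` is bounded. -/
def GeoBdd {E : Type*} [NormedAddCommGroup E] (ρ : ℝ) (a : ℕ → E) : Prop :=
  ∃ C, 0 ≤ C ∧ ∀ k, ‖a k‖ * ρ ^ k ≤ C

/-- The sum of a power series at `u`. -/
noncomputable def ev {F : Type*} [NormedField F] (a : ℕ → F) (u : F) : F := ∑' k, a k * u ^ k

/-- The Cauchy product of two sequences. -/
def cauchyMul {R : Type*} [NonUnitalNonAssocSemiring R] (a b : ℕ → R) (k : ℕ) : R :=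
  ∑ p ∈ Finset.HasAntidiagonal.antidiagonal k, a p.1 * b p.2

/-- The coefficients of the expansion of `∑ a m (u + v) ^ m` in powers of `u`. -/
noncomputable def recenter {F : Type*} [NormedField F] (a : ℕ → F) (v : F) (k : ℕ) : F :=
  ev (fun m => ((m + k).choose k : F) * a (m + k)) v

theorem GeoBdd.mono {E : Type*} [NormedAddCommGroup E] {ρ ρ' : ℝ} (h0 : 0 ≤ ρ) (h : ρ ≤ ρ')
    {a : ℕ → E} (ha : GeoBdd ρ' a) : GeoBdd ρ a := by
  obtain ⟨C, hC, h'⟩ := ha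
  exact ⟨C, hC, fun k => (by gcongr : _ ≤ ‖a k‖ * ρ' ^ k).trans (h' k)⟩

theorem GeoBdd.of_norm_le {E E' : Type*} [NormedAddCommGroup E] [NormedAddCommGroup E'] {ρ : ℝ}
    (hρ : 0 ≤ ρ) {a : ℕ → E} {b : ℕ → E'} (ha : GeoBdd ρ a) (h : ∀ k, ‖b k‖ ≤ ‖a k‖) :
    GeoBdd ρ b := by
  obtain ⟨C, hC, h'⟩ := ha
  exact ⟨C, hC, fun k => (mul_le_mul_of_nonneg_right (h k) (pow_nonneg hρ k)).trans (h' k)⟩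

theorem GeoBdd.tendsto {E : Type*} [NormedAddCommGroup E] {ρ σ : ℝ} (hσ : 0 ≤ σ) (h : σ < ρ)
    {a : ℕ → E} (ha : GeoBdd ρ a) : Summable fun k => ‖a k‖ * σ ^ k := by
  obtain ⟨C, hC, h'⟩ := ha
  have hρ : 0 < ρ := hσ.trans_lt h
  refine Summable.of_nonneg_of_le (fun k => by positivity) (fun k => ?_)
    ((summable_geometric_of_lt_one (div_nonneg hσ hρ.le) ((div_lt_one hρ).2 h)).mul_left C)
  calc ‖a k‖ * σ ^ k = ‖a k‖ * ρ ^ k * (σ / ρ) ^ k := by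
        rw [div_pow]; field_simp
    _ ≤ C * (σ / ρ) ^ k := by gcongr; exact h' k

theorem GeoBdd.cauchyMul {E : Type*} [NormedRing E] [IsUltrametricDist E] {ρ : ℝ}
    (hρ : 0 ≤ ρ) {a b : ℕ → E} (ha : GeoBdd ρ a) (hb : GeoBdd ρ b) : GeoBdd ρ (cauchyMul a b) := by
  obtain ⟨C, hC, h⟩ := ha
  obtain ⟨D, hD, h'⟩ := hb
  refine ⟨C * D, by positivity, fun k => ?_⟩
  -- The general argument divides by ρ^k, so ρ = 0 is separate; since 0^0 = 1, only the coefficient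
  -- of index 0 matters there.
  rcases hρ.eq_or_lt with rfl | hρ
  · rcases k with _ | k
    · have h1 := h 0
      have h2 := h' 0
      simp only [pow_zero, mul_one] at h1 h2
      simp only [QDiff.cauchyMul, Finset.HasAntidiagonal.antidiagonal_zero, Finset.sum_singleton, pow_zero, mul_one]
      exact (norm_mul_le _ _).trans (by gcongr)
    · simp; positivity
  rw [← le_div_iff₀ (by positivity)]
  refine IsUltrametricDist.norm_sum_le_of_forall_le_of_nonneg (by positivity) fun p hp => ?_
  rw [Finset.HasAntidiagonal.mem_antidiagonal] at hp
  rw [le_div_iff₀ (by positivity), ← hp, pow_add]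
  calc ‖a p.1 * b p.2‖ * (ρ ^ p.1 * ρ ^ p.2) ≤ (‖a p.1‖ * ‖b p.2‖) * (ρ ^ p.1 * ρ ^ p.2) := by
        gcongr; exact norm_mul_le _ _
    _ = (‖a p.1‖ * ρ ^ p.1) * (‖b p.2‖ * ρ ^ p.2) := by ring
    _ ≤ C * D := by
        gcongr
        · exact h _
        · exact h' _

theorem GeoBdd.add {E : Type*} [NormedAddCommGroup E] {ρ : ℝ} (hρ : 0 ≤ ρ) {a b : ℕ → E}
    (ha : GeoBdd ρ a) (hb : GeoBdd ρ b) : GeoBdd ρ (fun k => a k + b k) := by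
  obtain ⟨C, hC, h⟩ := ha
  obtain ⟨D, hD, h'⟩ := hb
  refine ⟨C + D, by positivity, fun k => ?_⟩
  calc ‖a k + b k‖ * ρ ^ k ≤ (‖a k‖ + ‖b k‖) * ρ ^ k := by gcongr; exact norm_add_le _ _
    _ ≤ C + D := by rw [add_mul]; exact add_le_add (h k) (h' k)

theorem GeoBdd.zero {E : Type*} [NormedAddCommGroup E] {ρ : ℝ} :
    GeoBdd ρ (fun _ => (0 : E)) := ⟨0, le_rfl, fun k => by simp⟩

theorem GeoBdd.sum {E ι : Type*} [NormedAddCommGroup E] {ρ : ℝ} (hρ : 0 ≤ ρ) (s : Finset ι)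
    {a : ι → ℕ → E} (ha : ∀ i ∈ s, GeoBdd ρ (a i)) : GeoBdd ρ (fun k => ∑ i ∈ s, a i k) := by
  classical
  induction s using Finset.induction_on with
  | empty => simpa using GeoBdd.zero
  | insert i s hi ih =>
    simp only [Finset.sum_insert hi]
    exact (ha i (Finset.mem_insert_self _ _)).add hρ
      (ih fun j hj => ha j (Finset.mem_insert_of_mem hj))

theorem GeoBdd.mul_const {E : Type*} [NormedRing E] {ρ : ℝ} (hρ : 0 ≤ ρ) {a : ℕ → E}
    (ha : GeoBdd ρ a) (c : E) : GeoBdd ρ (fun k => a k * c) := by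
  obtain ⟨C, hC, h⟩ := ha
  refine ⟨C * ‖c‖, by positivity, fun k => ?_⟩
  calc ‖a k * c‖ * ρ ^ k ≤ ‖a k‖ * ‖c‖ * ρ ^ k := by gcongr; exact norm_mul_le _ _
    _ = ‖a k‖ * ρ ^ k * ‖c‖ := by ring
    _ ≤ _ := by gcongr; exact h k

variable {F : Type*} [NormedField F]

theorem GeoBdd.neg {ρ : ℝ} {a : ℕ → F} (ha : GeoBdd ρ a) : GeoBdd ρ (fun k => - a k) := by
  simpa only [GeoBdd, norm_neg] using ha

theorem ev_zero_right (a : ℕ → F) : ev a 0 = a 0 := by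
  rw [ev, tsum_eq_single 0 (fun k hk => by rw [zero_pow hk, mul_zero])]
  simp

theorem summable_norm_ev {ρ : ℝ} {a : ℕ → F} (ha : GeoBdd ρ a) {u : F}
    (hu : ‖u‖ < ρ) : Summable fun k => ‖a k * u ^ k‖ := by
  simpa only [norm_mul, norm_pow] using ha.tendsto (norm_nonneg u) hu

/-- In the ultrametric setting a sum is bounded by the supremum of its terms. No convergence is
required, since a divergent series has the value 0; this is why the boundary ‖u‖ = ρ is allowed. -/
theorem norm_ev_le [IsUltrametricDist F] {ρ C : ℝ} (hC : 0 ≤ C) {a : ℕ → F}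
    (ha : ∀ k, ‖a k‖ * ρ ^ k ≤ C) {u : F} (hu : ‖u‖ ≤ ρ) : ‖ev a u‖ ≤ C := by
  refine (IsUltrametricDist.norm_tsum_le _).trans (Real.iSup_le (fun k => ?_) hC)
  rw [norm_mul, norm_pow]
  exact le_trans (by gcongr) (ha k)

theorem ev_mul_const (a : ℕ → F) (c u : F) : ev (fun k => a k * c) u = ev a u * c := by
  rw [ev, ev, ← tsum_mul_right]
  exact tsum_congr fun k => by ring

theorem norm_natCast_mul_le [IsUltrametricDist F] (n : ℕ) (x : F) : ‖(n : F) * x‖ ≤ ‖x‖ := by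
  rw [norm_mul]
  exact mul_le_of_le_one_left (norm_nonneg _) (IsUltrametricDist.norm_natCast_le_one F n)

theorem GeoBdd.shift [IsUltrametricDist F] {ρ : ℝ} (hρ : 0 < ρ) {a : ℕ → F} (ha : GeoBdd ρ a) (k : ℕ) :
    GeoBdd ρ (fun m => ((m + k).choose k : F) * a (m + k)) := by
  obtain ⟨C, hC, h⟩ := ha
  refine ⟨C / ρ ^ k, by positivity, fun m => ?_⟩
  rw [le_div_iff₀ (by positivity), mul_assoc, ← pow_add]
  exact (mul_le_mul_of_nonneg_right (norm_natCast_mul_le _ _) (by positivity)).trans (h _)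

/-- Binomial coefficients have norm at most 1, so moving the center inside an ultrametric disk costs
nothing: radius and bound are unchanged. -/
theorem GeoBdd.recenter [IsUltrametricDist F] {ρ : ℝ} (hρ : 0 < ρ) {a : ℕ → F} (ha : GeoBdd ρ a) {v : F}
    (hv : ‖v‖ < ρ) : GeoBdd ρ (recenter a v) := by
  obtain ⟨C, hC, h⟩ := ha
  refine ⟨C, hC, fun k => ?_⟩
  rw [← le_div_iff₀ (by positivity)]
  refine norm_ev_le (ρ := ρ) (by positivity) (fun m => ?_) hv.le
  rw [le_div_iff₀ (by positivity), mul_assoc, ← pow_add]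
  exact (mul_le_mul_of_nonneg_right (norm_natCast_mul_le _ _) (by positivity)).trans (h _)

theorem GeoBdd.succ {ρ : ℝ} (hρ : 0 < ρ) {a : ℕ → F} (ha : GeoBdd ρ a) :
    GeoBdd ρ (fun m => a (m + 1)) := by
  obtain ⟨C, hC, h⟩ := ha
  refine ⟨C / ρ, by positivity, fun m => ?_⟩
  rw [le_div_iff₀ hρ, mul_assoc, ← pow_succ]
  exact h _

variable [CompleteSpace F]


theorem hasSum_ev {ρ : ℝ} {a : ℕ → F} (ha : GeoBdd ρ a) {u : F} (hu : ‖u‖ < ρ) :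
    HasSum (fun k => a k * u ^ k) (ev a u) :=
  (summable_norm_ev ha hu).of_norm.hasSum

theorem ev_eq_add_mul {ρ : ℝ} {a : ℕ → F} (ha : GeoBdd ρ a) {u : F} (hu : ‖u‖ < ρ) :
    ev a u = a 0 + u * ev (fun m => a (m + 1)) u := by
  rw [ev, (hasSum_ev ha hu).summable.tsum_eq_zero_add, ev, ← tsum_mul_left]
  simp only [pow_zero, mul_one]
  congr 1
  exact tsum_congr fun k => by ring

theorem ev_mul {ρ : ℝ} {a b : ℕ → F} (ha : GeoBdd ρ a) (hb : GeoBdd ρ b) {u : F} (hu : ‖u‖ < ρ) :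
    ev (cauchyMul a b) u = ev a u * ev b u := by
  rw [ev, ev, ev, tsum_mul_tsum_eq_tsum_sum_antidiagonal_of_summable_norm
    (summable_norm_ev ha hu) (summable_norm_ev hb hu)]
  refine tsum_congr fun k => ?_
  rw [cauchyMul, Finset.sum_mul]
  refine Finset.sum_congr rfl fun p hp => ?_
  rw [← Finset.HasAntidiagonal.mem_antidiagonal.1 hp, pow_add]
  ring

theorem ev_sub {ρ : ℝ} {a b : ℕ → F} (ha : GeoBdd ρ a) (hb : GeoBdd ρ b) {u : F} (hu : ‖u‖ < ρ) :
    ev (fun k => a k - b k) u = ev a u - ev b u := by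
  simp only [ev, sub_mul]
  exact (hasSum_ev ha hu).summable.tsum_sub (hasSum_ev hb hu).summable

theorem ev_sum {ι : Type*} {ρ : ℝ} (s : Finset ι) {a : ι → ℕ → F}
    (ha : ∀ i ∈ s, GeoBdd ρ (a i)) {u : F} (hu : ‖u‖ < ρ) :
    ev (fun k => ∑ i ∈ s, a i k) u = ∑ i ∈ s, ev (a i) u := by
  simp only [ev, Finset.sum_mul]
  exact Summable.tsum_finsetSum fun i hi => (hasSum_ev (ha i hi) hu).summable

variable [IsUltrametricDist F]

/-- The double series of all binomial terms is dominated by a product of two geometric series.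
Grouping by the power of u gives one side; grouping by total degree and using the binomial theorem
gives the other. -/
theorem ev_recenter {ρ : ℝ} {a : ℕ → F} (ha : GeoBdd ρ a) {u v : F} (hu : ‖u‖ < ρ)
    (hv : ‖v‖ < ρ) : ev (recenter a v) u = ev a (u + v) := by
  have hρ : 0 < ρ := (norm_nonneg u).trans_lt hu
  obtain ⟨C, hC, h⟩ := id ha
  let g : ℕ × ℕ → F := fun p => ((p.1 + p.2).choose p.2 : F) * a (p.1 + p.2) * v ^ p.1 * u ^ p.2
  have hg : Summable g := by
    have h1 := summable_geometric_of_lt_one (div_nonneg (norm_nonneg v) hρ.le)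
      ((div_lt_one hρ).2 hv)
    have h2 := summable_geometric_of_lt_one (div_nonneg (norm_nonneg u) hρ.le)
      ((div_lt_one hρ).2 hu)
    have h3 := (h1.mul_of_nonneg h2 (fun _ => by positivity) (fun _ => by positivity)).mul_left C
    refine Summable.of_norm_bounded h3 fun p => ?_
    calc ‖g p‖ ≤ ‖a (p.1 + p.2)‖ * ‖v‖ ^ p.1 * ‖u‖ ^ p.2 := by
          simp only [g]
          rw [norm_mul, norm_mul, norm_pow, norm_pow]
          gcongr
          exact norm_natCast_mul_le _ _
      _ = ‖a (p.1 + p.2)‖ * ρ ^ (p.1 + p.2) * ((‖v‖ / ρ) ^ p.1 * (‖u‖ / ρ) ^ p.2) := by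
          rw [div_pow, div_pow, pow_add]; field_simp
      _ ≤ C * ((‖v‖ / ρ) ^ p.1 * (‖u‖ / ρ) ^ p.2) := by gcongr; exact h _
  have e1 : ∑' p, g p = ev (recenter a v) u := by
    rw [← (Equiv.prodComm ℕ ℕ).tsum_eq g]
    refine (Summable.tsum_prod
      ((Equiv.prodComm ℕ ℕ).summable_iff.2 hg)).trans ?_
    refine tsum_congr fun k => ?_
    rw [recenter, ev, ← tsum_mul_right]
    rfl
  have e2 : ∑' p, g p = ev a (u + v) := by
    have h4 := (Finset.HasAntidiagonal.sigmaAntidiagonalEquivProd (A := ℕ)).tsum_eq g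
    rw [← h4]
    refine (Summable.tsum_sigma' (fun n => (hasSum_fintype _).summable)
      ((Finset.HasAntidiagonal.sigmaAntidiagonalEquivProd (A := ℕ)).summable_iff.2 hg)).trans ?_
    refine tsum_congr fun n => ?_
    rw [tsum_fintype, add_comm u v, (Commute.all v u).add_pow', Finset.mul_sum]
    rw [← Finset.sum_coe_sort (Finset.HasAntidiagonal.antidiagonal n)]
    refine Finset.sum_congr rfl fun p _ => ?_
    obtain ⟨⟨i, j⟩, hp⟩ := p
    have hp' : i + j = n := Finset.HasAntidiagonal.mem_antidiagonal.1 hp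
    subst hp'
    rw [nsmul_eq_mul, Nat.choose_symm_add]
    change ((i + j).choose j : F) * a (i + j) * v ^ i * u ^ j = _
    ring
  rw [← e1, e2]

theorem norm_ev_sub_le {ρ C : ℝ} (hρ : 0 < ρ) (hC : 0 ≤ C) {a : ℕ → F}
    (ha : ∀ k, ‖a k‖ * ρ ^ k ≤ C) {u : F} (hu : ‖u‖ < ρ) : ‖ev a u - a 0‖ ≤ C / ρ * ‖u‖ := by
  rw [ev_eq_add_mul ⟨C, hC, ha⟩ hu, add_sub_cancel_left, norm_mul, mul_comm]
  gcongr
  refine norm_ev_le (by positivity) (fun k => ?_) hu.le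
  rw [le_div_iff₀ hρ, mul_assoc, ← pow_succ]
  exact ha _

/-- Isolated zeros: near 0 a nonzero constant term would dominate the rest, so it vanishes; then
divide by u and repeat. Zeros accumulating at 0 suffice, which is what the orbit of a point under
powers of q provides. -/
theorem eq_zero_of_frequently_ev_eq_zero {ρ : ℝ} (hρ : 0 < ρ) (k : ℕ) :
    ∀ {a : ℕ → F}, GeoBdd ρ a → (∃ᶠ u in 𝓝[≠] (0 : F), ev a u = 0) → a k = 0 := by
  have hball : ∀ᶠ u in 𝓝[≠] (0 : F), ‖u‖ < ρ :=
    nhdsWithin_le_nhds (by filter_upwards [Metric.ball_mem_nhds (0 : F) hρ] with u hu; simpa using hu)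
  have h0 : ∀ {a : ℕ → F}, GeoBdd ρ a → (∃ᶠ u in 𝓝[≠] (0 : F), ev a u = 0) → a 0 = 0 := by
    intro a ha hf
    obtain ⟨C, hC, h⟩ := ha.succ hρ
    by_contra hne
    have : ∀ᶠ u in 𝓝[≠] (0 : F), ‖u‖ * C < ‖a 0‖ := by
      refine nhdsWithin_le_nhds ?_
      have : Tendsto (fun u : F => ‖u‖ * C) (𝓝 0) (𝓝 (‖(0 : F)‖ * C)) :=
        (continuous_norm.mul continuous_const).tendsto _
      rw [norm_zero, zero_mul] at this
      exact this.eventually_lt_const (norm_pos_iff.2 hne)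
    obtain ⟨u, hu, hu', hu''⟩ := (hf.and_eventually (this.and hball)).exists
    rw [ev_eq_add_mul ha hu''] at hu
    have h1 : ‖a 0‖ = ‖u * ev (fun m => a (m + 1)) u‖ := by
      rw [eq_neg_of_add_eq_zero_left hu, norm_neg]
    rw [norm_mul] at h1
    have h2 := norm_ev_le hC h hu''.le
    have h3 : ‖u‖ * ‖ev (fun m => a (m + 1)) u‖ ≤ ‖u‖ * C := by gcongr
    linarith
  induction k with
  | zero => exact h0
  | succ k ih =>
    intro a ha hf
    refine ih (ha.succ hρ) ?_
    have ha0 := h0 ha hf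
    refine (hf.and_eventually (hball.and eventually_mem_nhdsWithin)).mono ?_
    rintro u ⟨hu, hu', hu''⟩
    rw [ev_eq_add_mul ha hu', ha0, zero_add] at hu
    exact (mul_eq_zero.1 hu).resolve_left hu''

theorem eq_of_frequently_ev_eq {ρ : ℝ} (hρ : 0 < ρ) {a b : ℕ → F} (ha : GeoBdd ρ a)
    (hb : GeoBdd ρ b) (h : ∃ᶠ u in 𝓝[≠] (0 : F), ev a u = ev b u) : a = b := by
  funext k
  refine sub_eq_zero.1 (eq_zero_of_frequently_ev_eq_zero hρ k (a := fun k => a k - b k) ?_ ?_)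
  · simpa only [sub_eq_add_neg] using ha.add hρ.le hb.neg
  · have hball : ∀ᶠ u in 𝓝[≠] (0 : F), ‖u‖ < ρ :=
      nhdsWithin_le_nhds (by filter_upwards [Metric.ball_mem_nhds (0 : F) hρ] with u hu; simpa using hu)
    refine (h.and_eventually hball).mono fun u hu => ?_
    rw [ev_sub ha hb hu.2, hu.1, sub_self]

end Series

/-! ### The field `CC K` -/

section Field

variable (K : Type u) [NontriviallyNormedField K] [IsUltrametricDist K] [CompleteSpace K]

instance instIsUltrametricDistAlgCl : IsUltrametricDist (AlgCl K) :=
  IsUltrametricDist.isUltrametricDist_of_forall_norm_add_le_max_norm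
    (isNonarchimedean_spectralNorm (K := K) (L := AlgebraicClosure K))

instance instIsUltrametricDistCC : IsUltrametricDist (CC K) := by
  refine IsUltrametricDist.isUltrametricDist_of_forall_norm_add_le_max_norm fun x y => ?_
  induction x, y using UniformSpace.Completion.induction_on₂ with
  | hp => exact isClosed_le (by fun_prop) (by fun_prop)
  | ih x y =>
    rw [← UniformSpace.Completion.coe_add]
    simp only [UniformSpace.Completion.norm_coe]
    exact IsUltrametricDist.norm_add_le_max x y

instance instIsAlgClosedAlgCl : IsAlgClosed (AlgCl K) := inferInstanceAs (IsAlgClosed (AlgebraicClosure K))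

noncomputable instance instNontriviallyNormedFieldCC : NontriviallyNormedField (CC K) where
  non_trivial := by
    obtain ⟨x, hx⟩ := NontriviallyNormedField.non_trivial (α := K)
    exact ⟨algebraMap K (CC K) x, by rwa [norm_algebraMap']⟩

variable {K}

/-- Only polynomials over K are needed, and these already split in the algebraic closure; algebraic
closedness of the completion is never used. -/
theorem splits_map_CC (P : K[X]) : (P.map (algebraMap K (CC K))).Splits := by
  have h := IsAlgClosed.splits (P.map (algebraMap K (AlgCl K)))
  have h2 := h.map (algebraMap (AlgCl K) (CC K))
  rw [Polynomial.map_map] at h2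
  exact h2

/-- The absolute values of `CC K` are dense. -/
theorem exists_norm_mem_Ioo {a b : ℝ} (ha : 0 < a) (hab : a < b) :
    ∃ x : CC K, a < ‖x‖ ∧ ‖x‖ < b := by
  obtain ⟨c, hc⟩ := NormedField.exists_one_lt_norm K
  have hba : 1 < b / a := (one_lt_div ha).2 hab
  -- For this n, an n-th root z of c satisfies 1 < ‖z‖ < b / a, so the powers of ‖z‖ are spaced too
  -- closely to jump over the interval.
  obtain ⟨n, hn⟩ := pow_unbounded_of_one_lt ‖c‖ hba
  have hn0 : n ≠ 0 := by
    rintro rfl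
    simp at hn
    exact absurd hn (not_lt.2 hc.le)
  obtain ⟨z, hz⟩ := IsAlgClosed.exists_pow_nat_eq (algebraMap K (AlgCl K) c) (Nat.pos_of_ne_zero hn0)
  have hzn : ‖z‖ ^ n = ‖c‖ := by rw [← norm_pow, hz, norm_algebraMap']
  have hz1 : 1 < ‖z‖ := by
    rw [← one_lt_pow_iff_of_nonneg (norm_nonneg z) hn0, hzn]; exact hc
  have hz2 : ‖z‖ < b / a := by
    rw [← hzn] at hn
    exact lt_of_pow_lt_pow_left₀ n (by positivity) hn
  obtain ⟨m, hm1, hm2⟩ := exists_mem_Ioc_zpow ha hz1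
  by_cases hb : ‖z‖ ^ (m + 1) = a
  · refine ⟨(z : CC K) ^ (m + 2), ?_, ?_⟩
    · rw [norm_zpow, UniformSpace.Completion.norm_coe, ← hb]
      exact zpow_lt_zpow_right₀ hz1 (by omega)
    · rw [norm_zpow, UniformSpace.Completion.norm_coe,
        show m + 2 = (m + 1) + 1 by ring, zpow_add_one₀ (by positivity), hb]
      rwa [lt_div_iff₀ ha, mul_comm] at hz2
  · refine ⟨(z : CC K) ^ (m + 1), ?_, ?_⟩
    · rw [norm_zpow, UniformSpace.Completion.norm_coe]
      exact lt_of_le_of_ne hm2 (Ne.symm hb)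
    · rw [norm_zpow, UniformSpace.Completion.norm_coe, zpow_add_one₀ (by positivity)]
      calc ‖z‖ ^ m * ‖z‖ < a * ‖z‖ := by gcongr
        _ < b := by rwa [lt_div_iff₀ ha, mul_comm] at hz2

end Field

end QDiff

namespace QDiff

/-! ### Polynomials on disks -/

section Gauss

/-- When ‖β‖ differs from the norm of every root α, each factor takes at β the value of norm
max(‖β‖, ‖α‖), which is its Gauss norm for the radius ‖β‖. The product thus attains its Gauss norm
at β. -/
theorem norm_coeff_prod_le {F : Type*} [NormedField F] [IsUltrametricDist F] (β : F)
    (s : Multiset F) (hs : ∀ α ∈ s, ‖β‖ ≠ ‖α‖) (k : ℕ) :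
    ‖(s.map fun α => Polynomial.X - Polynomial.C α).prod.coeff k‖ * ‖β‖ ^ k ≤
      ‖eval β (s.map fun α => Polynomial.X - Polynomial.C α).prod‖ := by
  induction s using Multiset.induction_on generalizing k with
  | empty =>
    rcases k with _ | k
    · simp
    · simp [Polynomial.coeff_one]
  | cons α s ih =>
    have ih' := ih fun a ha => hs a (Multiset.mem_cons_of_mem ha)
    rw [Multiset.map_cons, Multiset.prod_cons, eval_mul, norm_mul]
    set P := (s.map fun α => Polynomial.X - Polynomial.C α).prod
    have hβ : ‖eval β (Polynomial.X - Polynomial.C α)‖ = max ‖β‖ ‖α‖ := by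
      have := IsUltrametricDist.norm_add_eq_max_of_norm_ne_norm (x := β) (y := -α)
        (by rw [norm_neg]; exact hs α (Multiset.mem_cons_self _ _))
      simpa [sub_eq_add_neg] using this
    rw [hβ, sub_mul, coeff_sub, coeff_C_mul]
    have h2 : ‖α * P.coeff k‖ * ‖β‖ ^ k ≤ max ‖β‖ ‖α‖ * ‖eval β P‖ := by
      rw [norm_mul, mul_assoc]
      exact mul_le_mul (le_max_right _ _) (ih' k) (by positivity) (by positivity)
    rcases k with _ | k
    · rw [coeff_X_mul_zero, zero_sub, norm_neg]
      exact h2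
    · rw [coeff_X_mul]
      have h1 : ‖P.coeff k‖ * ‖β‖ ^ (k + 1) ≤ max ‖β‖ ‖α‖ * ‖eval β P‖ := by
        rw [pow_succ, ← mul_assoc, mul_comm]
        exact mul_le_mul (le_max_left _ _) (ih' k) (by positivity) (by positivity)
      calc ‖P.coeff k - α * P.coeff (k + 1)‖ * ‖β‖ ^ (k + 1)
          ≤ max ‖P.coeff k‖ ‖α * P.coeff (k + 1)‖ * ‖β‖ ^ (k + 1) := by
            gcongr
            rw [sub_eq_add_neg, ← norm_neg (α * _)]
            exact IsUltrametricDist.norm_add_le_max _ _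
        _ = max (‖P.coeff k‖ * ‖β‖ ^ (k + 1)) (‖α * P.coeff (k + 1)‖ * ‖β‖ ^ (k + 1)) :=
            max_mul_of_nonneg _ _ (by positivity)
        _ ≤ _ := max_le h1 h2

theorem eval_eq_ev_taylor {F : Type*} [NormedField F] (P : F[X]) (x y : F) :
    eval x P = ev (fun k => (taylor y P).coeff k) (x - y) := by
  rw [ev, tsum_eq_sum (s := Finset.range ((taylor y P).natDegree + 1)), ← eval_eq_sum_range,
    taylor_eval, sub_add_cancel]
  intro k hk
  rw [coeff_eq_zero_of_natDegree_lt (by simpa using hk), zero_mul]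

variable {K : Type u} [NontriviallyNormedField K] [IsUltrametricDist K] [CompleteSpace K]

/-- Cauchy estimates. The radius ρ may fail to be the norm of an element or may meet a root, so the
estimate is made at nearby good radii below ρ and passed to the limit. -/
theorem norm_coeff_taylor_le {P : (CC K)[X]} (hP : P.Splits) {x : CC K} {ρ M : ℝ} (hρ : 0 < ρ)
    (hM : ∀ z, ‖z - x‖ < ρ → ‖eval z P‖ ≤ M) (k : ℕ) :
    ‖(taylor x P).coeff k‖ * ρ ^ k ≤ M := by
  classical
  let s := P.roots.map fun α => α - x
  have htay : taylor x P = Polynomial.C P.leadingCoeff *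
      (s.map fun α => Polynomial.X - Polynomial.C α).prod := by
    conv_lhs => rw [hP.eq_prod_roots]
    rw [taylor_mul, taylor_C]
    congr 1
    refine (map_multiset_prod (taylorAlgHom x) _).trans ?_
    rw [Multiset.map_map, Multiset.map_map]
    congr 2
    funext α
    simp [taylor_X, sub_eq_add_neg, add_assoc]
  -- Norms of elements are dense and only finitely many radii are norms of roots, so good radii
  -- accumulate at ρ from below.
  have hfreq : ∃ᶠ t in 𝓝[<] ρ, ‖(taylor x P).coeff k‖ * t ^ k ≤ M := by
    have hfin : (s.toFinset.image fun α => ‖α‖ : Set ℝ).Finite := Finset.finite_toSet _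
    have h1 : ∀ᶠ t in 𝓝[<] ρ, t ∉ (s.toFinset.image fun α => ‖α‖ : Set ℝ) := by
      have h2 : ∀ᶠ t in 𝓝[≠] ρ, t ∉ (s.toFinset.image fun α => ‖α‖ : Set ℝ) := by
        rw [eventually_nhdsWithin_iff]
        have h3 : ((s.toFinset.image fun α => ‖α‖ : Set ℝ) \ {ρ})ᶜ ∈ 𝓝 ρ :=
          (hfin.subset Set.sdiff_subset).isClosed.isOpen_compl.mem_nhds (by simp)
        filter_upwards [h3] with t ht hne hmem
        exact ht ⟨hmem, hne⟩
      exact h2.filter_mono (nhdsWithin_mono _ fun t ht => ne_of_lt ht)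
    have h4 : ∃ᶠ t in 𝓝[<] ρ, ∃ β : CC K, ‖β‖ = t ∧ t < ρ := by
      rw [Filter.frequently_iff]
      intro U hU
      obtain ⟨l, hl, hlU⟩ := (mem_nhdsLT_iff_exists_Ioo_subset' (by linarith : ρ - 1 < ρ)).1 hU
      obtain ⟨β, hβ1, hβ2⟩ := exists_norm_mem_Ioo (K := K) (a := max (ρ / 2) l) (b := ρ)
        (by positivity) (max_lt (by linarith) hl)
      exact ⟨‖β‖, hlU ⟨(le_max_right _ _).trans_lt hβ1, hβ2⟩, β, rfl, hβ2⟩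
    refine (h4.and_eventually h1).mono ?_
    rintro t ⟨⟨β, rfl, hβρ⟩, hβ⟩
    refine le_trans ?_ (hM (x + β) (by rwa [add_sub_cancel_left]))
    have h5 : eval (x + β) P = eval β (taylor x P) := by rw [taylor_eval, add_comm]
    rw [h5, htay, coeff_C_mul, eval_mul, eval_C, norm_mul, norm_mul, mul_assoc]
    gcongr
    refine norm_coeff_prod_le β s (fun α hα he => hβ ?_) k
    simp only [Finset.coe_image, Set.mem_image, Finset.mem_coe, Multiset.mem_toFinset]
    exact ⟨α, hα, he.symm⟩
  by_contra! hlt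
  have hc : Tendsto (fun t : ℝ => ‖(taylor x P).coeff k‖ * t ^ k) (𝓝[<] ρ)
      (𝓝 (‖(taylor x P).coeff k‖ * ρ ^ k)) :=
    ((continuous_const.mul (continuous_pow k)).tendsto ρ).mono_left nhdsWithin_le_nhds
  obtain ⟨t, ht, ht'⟩ := (hfreq.and_eventually (hc.eventually_const_lt hlt)).exists
  exact absurd ht (not_le.2 ht')

theorem norm_multiset_prod {F : Type*} [NormedField F] (s : Multiset F) :
    ‖s.prod‖ = (s.map fun x => ‖x‖).prod :=
  map_multiset_prod (normHom : F →*₀ ℝ) s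

/-- Each root α lies outside the disk, so |z - α| = |x - α| for z in the disk; multiply over the
roots. -/
theorem norm_eval_eq_of_ne_zero {F : Type*} [NormedField F] [IsUltrametricDist F]
    {Q : F[X]} (hQ : Q.Splits) {x : F} {ρ : ℝ}
    (h0 : ∀ z, ‖z - x‖ < ρ → eval z Q ≠ 0) {z : F} (hz : ‖z - x‖ < ρ) :
    ‖eval z Q‖ = ‖eval x Q‖ := by
  have key : ∀ w, ‖eval w Q‖ = ‖Q.leadingCoeff‖ * (Q.roots.map fun α => ‖w - α‖).prod := by
    intro w
    conv_lhs => rw [hQ.eq_prod_roots]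
    rw [eval_mul, eval_C, norm_mul, eval_multiset_prod, Multiset.map_map]
    congr 1
    rw [norm_multiset_prod, Multiset.map_map]
    congr 2
    funext α
    simp
  rw [key, key]
  congr 2
  refine Multiset.map_congr rfl fun α hα => ?_
  have hα' : ρ ≤ ‖x - α‖ := by
    by_contra! hlt
    rw [norm_sub_rev] at hlt
    exact h0 α hlt (isRoot_of_mem_roots hα)
  have h1 : ‖z - x‖ ≠ ‖x - α‖ := (hz.trans_le hα').ne
  rw [IsUltrametricDist.norm_sub_eq_max_of_norm_sub_ne_norm_sub z x α h1,
    max_eq_right (hz.trans_le hα').le]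

/-- Every linear factor has norm at least ρ on S. This is what makes a quotient without poles on X a
bounded function. -/
theorem exists_le_norm_eval {F : Type*} [NormedField F] {Q : F[X]} (hQ : Q.Splits) {S : Set F}
    {ρ : ℝ} (hρ : 0 < ρ) (h0 : ∀ z, Q.IsRoot z → ∀ x ∈ S, ρ ≤ ‖x - z‖) (hQ0 : Q ≠ 0) :
    ∃ c, 0 < c ∧ ∀ x ∈ S, c ≤ ‖eval x Q‖ := by
  refine ⟨‖Q.leadingCoeff‖ * ρ ^ (Multiset.card Q.roots), ?_, fun x hx => ?_⟩
  · have := leadingCoeff_ne_zero.2 hQ0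
    positivity
  conv_rhs => rw [hQ.eq_prod_roots]
  rw [eval_mul, eval_C, norm_mul, eval_multiset_prod, Multiset.map_map]
  refine mul_le_mul_of_nonneg_left ?_ (norm_nonneg _)
  rw [norm_multiset_prod, Multiset.map_map, ← Multiset.prod_replicate, ← Multiset.map_const']
  refine Multiset.prod_map_le_prod_map₀ _ _ (fun _ _ => hρ.le) fun α hα => ?_
  simpa using h0 α (isRoot_of_mem_roots hα) x hx

end Gauss

/-! ### Geometry of the affinoid -/

namespace Affinoid

variable {K : Type u} [NontriviallyNormedField K]

theorem rX_pos (X : Affinoid K) : 0 < X.rX :=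
  (Finset.lt_inf'_iff _).2 fun i _ => X.R_pos i

theorem rX_le (X : Affinoid K) (i : Fin (X.n + 1)) : X.rX ≤ X.R i :=
  Finset.inf'_le _ (Finset.mem_univ i)

theorem rX_le_sX (X : Affinoid K) : X.rX ≤ X.sX := (X.rX_le 0).trans (le_max_right _ _)

variable [IsUltrametricDist K] [CompleteSpace K] (X : Affinoid K)

variable {X}

theorem mem_pts_of_norm_sub_lt {x y : CC K} (hx : x ∈ X.pts) (h : ‖y - x‖ < X.rX) :
    y ∈ X.pts := by
  refine ⟨?_, fun i hi => ?_⟩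
  · rw [← sub_add_sub_cancel y x]
    exact (IsUltrametricDist.norm_add_le_max _ _).trans
      (max_le (h.le.trans (X.rX_le 0)) hx.1)
  · by_contra! hlt
    refine absurd (hx.2 i hi) (not_le.2 ?_)
    rw [← sub_add_sub_cancel x y]
    refine (IsUltrametricDist.norm_add_le_max _ _).trans_lt (max_lt ?_ hlt)
    rw [norm_sub_rev]
    exact h.trans_le (X.rX_le i)

theorem norm_coe_le (x : X.Pt) : ‖(x : CC K)‖ ≤ X.sX := by
  rw [← sub_add_cancel (x : CC K) (algebraMap K (CC K) (X.c 0))]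
  refine (IsUltrametricDist.norm_add_le_max _ _).trans ?_
  rw [norm_algebraMap', sX, max_comm]
  exact max_le_max le_rfl x.2.1

theorem nhds_pts (x : X.Pt) : X.pts ∈ 𝓝 (x : CC K) := by
  filter_upwards [Metric.ball_mem_nhds (x : CC K) X.rX_pos] with y hy
  exact mem_pts_of_norm_sub_lt x.2 (by simpa [dist_eq_norm] using hy)

/-- X is open in `CC K`, so limits of slopes along X are ordinary derivatives, and X has no isolated
point. -/
theorem map_coe_nhdsNE (x : X.Pt) :
    Filter.map (fun y : X.Pt => (y : CC K)) (𝓝[≠] x) = 𝓝[≠] (x : CC K) := by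
  rw [nhdsWithin, Filter.map_inf Subtype.val_injective, map_nhds_subtype_coe_eq_nhds x.2
    (nhds_pts x), Filter.map_principal, nhdsWithin]
  refine Filter.ext fun s => ?_
  simp only [mem_inf_principal]
  constructor
  · intro hs
    filter_upwards [hs, nhds_pts x] with y hy hyX hne
    exact hy ⟨⟨y, hyX⟩, fun h => hne (congrArg Subtype.val h), rfl⟩
  · intro hs
    filter_upwards [hs] with y hy
    rintro ⟨z, hz, rfl⟩
    exact hy fun h => hz (Subtype.ext h)

instance neBot_nhdsNE (x : X.Pt) : (𝓝[≠] x).NeBot := by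
  have : (Filter.map (fun y : X.Pt => (y : CC K)) (𝓝[≠] x)).NeBot := by
    rw [map_coe_nhdsNE]; infer_instance
  exact this.of_map

theorem tendsto_coe_sub (x : X.Pt) :
    Tendsto (fun z : X.Pt => (z : CC K) - x) (𝓝[≠] x) (𝓝[≠] 0) := by
  refine tendsto_nhdsWithin_iff.2 ⟨?_, ?_⟩
  · have : Tendsto (fun z : X.Pt => (z : CC K) - x) (𝓝 x) (𝓝 ((x : CC K) - x)) :=
      (continuous_subtype_val.sub continuous_const).tendsto x
    rw [sub_self] at this
    exact this.mono_left nhdsWithin_le_nhds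
  · filter_upwards [eventually_mem_nhdsWithin] with z hz h
    exact hz (Subtype.ext (sub_eq_zero.1 h))

/-! ### The ring of analytic elements -/

instance instCompleteSpaceH : CompleteSpace X.H :=
  (Subalgebra.isClosed_topologicalClosure X.ratFun).completeSpace_coe

theorem norm_apply_le (f : X.H) (x : X.Pt) : ‖f x‖ ≤ ‖f‖ := f.1.norm_coe_le_norm x

theorem norm_le_iff {f : X.H} {C : ℝ} (hC : 0 ≤ C) : ‖f‖ ≤ C ↔ ∀ x, ‖f x‖ ≤ C :=
  BoundedContinuousFunction.norm_le hC

instance instIsUltrametricDistH : IsUltrametricDist X.H := by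
  refine IsUltrametricDist.isUltrametricDist_of_forall_norm_add_le_max_norm fun f g => ?_
  refine (norm_le_iff (le_max_of_le_left (norm_nonneg f))).2 fun x => ?_
  exact (IsUltrametricDist.norm_add_le_max (f x) (g x)).trans
    (max_le_max (norm_apply_le f x) (norm_apply_le g x))

theorem H_ext {f g : X.H} (h : ∀ x, f x = g x) : f = g :=
  Subtype.ext (BoundedContinuousFunction.ext h)

/-- Evaluation at a point. -/
noncomputable def evalAt (x : X.Pt) : X.H →ₐ[K] CC K where
  toFun f := f x
  map_one' := rfl
  map_mul' _ _ := rfl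
  map_zero' := rfl
  map_add' _ _ := rfl
  commutes' _ := rfl

theorem evalAt_apply (x : X.Pt) (f : X.H) : evalAt x f = f x := rfl

theorem mul_apply (f g : X.H) (x : X.Pt) : (f * g) x = f x * g x := rfl
theorem add_apply (f g : X.H) (x : X.Pt) : (f + g) x = f x + g x := rfl
theorem sub_apply (f g : X.H) (x : X.Pt) : (f - g) x = f x - g x := rfl
theorem smul_apply (a : K) (f : X.H) (x : X.Pt) : (a • f) x = algebraMap K (CC K) a * f x := by
  rw [← Algebra.smul_def]; rfl
theorem T_apply (x : X.Pt) : X.T x = x := rfl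
theorem sigma_apply (q : X.Q) (f : X.H) (x : X.Pt) : X.sigma q f x = f (X.mulPt q x) := rfl

theorem continuous_apply (f : X.H) : Continuous fun x => f x := f.1.continuous

theorem continuous_evalAt (x : X.Pt) : Continuous (evalAt x : X.H → CC K) :=
  (LipschitzWith.of_dist_le_mul (K := 1) fun f g => by
    rw [dist_eq_norm, dist_eq_norm, NNReal.coe_one, one_mul, ← map_sub]
    exact norm_apply_le (f - g) x).continuous

/-- The origin may belong to X; there T vanishes and multiplication by q moves nothing. By
continuity it can be ignored, which allows T to be cancelled although it need not be invertible. -/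
theorem eq_zero_of_apply_eq_zero {f : X.H} (h : ∀ x : X.Pt, (x : CC K) ≠ 0 → f x = 0) : f = 0 := by
  refine H_ext fun x => ?_
  have h1 : Tendsto (fun y => f y) (𝓝[≠] x) (𝓝 (f x)) :=
    ((continuous_apply f).tendsto x).mono_left nhdsWithin_le_nhds
  refine tendsto_nhds_unique_of_frequently_eq h1 tendsto_const_nhds (Eventually.frequently ?_)
  by_cases hx : (x : CC K) = 0
  · filter_upwards [eventually_mem_nhdsWithin] with y hy
    exact h y fun h0 => hy (Subtype.ext (h0.trans hx.symm))
  · have : ∀ᶠ y : X.Pt in 𝓝 x, (y : CC K) ≠ 0 :=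
      continuous_subtype_val.continuousAt.eventually_ne hx
    filter_upwards [nhdsWithin_le_nhds this] with y hy
    exact h y hy

theorem eq_of_T_mul_eq {f g : X.H} (h : X.T * f = X.T * g) : f = g := by
  refine sub_eq_zero.1 (eq_zero_of_apply_eq_zero fun x hx => ?_)
  have := congrArg (fun f : X.H => f x) h
  simp only [mul_apply, T_apply] at this
  rw [sub_apply, mul_left_cancel₀ hx this, sub_self]

/-- A rational function without poles on `X`. -/
def IsRational (f : X.H) : Prop := f.1 ∈ X.ratFun

theorem induction_on_rational {p : X.H → Prop} (hp : IsClosed {f | p f})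
    (h : ∀ f, IsRational f → p f) (f : X.H) : p f := by
  have hd : f ∈ closure {f : X.H | IsRational f} := by
    refine Metric.mem_closure_iff.2 fun ε hε => ?_
    obtain ⟨g, hg, hfg⟩ := Metric.mem_closure_iff.1 f.2 ε hε
    exact ⟨⟨g, subset_closure hg⟩, hg, hfg⟩
  exact hp.closure_subset_iff.2 h hd

theorem aeval_T_apply (P : K[X]) (x : X.Pt) : (aeval X.T P) x = aeval (x : CC K) P := by
  rw [← evalAt_apply, ← aeval_algHom_apply]
  rfl

theorem aeval_eq_eval_map (P : K[X]) (x : CC K) :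
    aeval x P = eval x (P.map (algebraMap K (CC K))) := by
  rw [eval_map_algebraMap]

theorem le_norm_sub_of_notMem {x z : CC K} (hx : x ∈ X.pts) (hz : z ∉ X.pts) :
    X.rX ≤ ‖x - z‖ := by
  by_contra! h
  rw [norm_sub_rev] at h
  exact hz (mem_pts_of_norm_sub_lt hx h)

theorem exists_rational (P Q : K[X]) (hQ : ∀ x : X.Pt, aeval (x : CC K) Q ≠ 0) :
    ∃ f : X.H, IsRational f ∧ ∀ x : X.Pt, f x = aeval (x : CC K) P / aeval (x : CC K) Q := by
  have hQ' : ∃ c, 0 < c ∧ ∀ x : X.Pt, c ≤ ‖aeval (x : CC K) Q‖ := by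
    by_cases hne : Q = 0
    · exact ⟨1, one_pos, fun x => absurd (by rw [hne, map_zero]) (hQ x)⟩
    obtain ⟨c, hc, h⟩ := exists_le_norm_eval (splits_map_CC Q) (S := X.pts) X.rX_pos
      (fun z hz x hx => le_norm_sub_of_notMem hx fun hzX => hQ ⟨z, hzX⟩ (by
        rw [aeval_eq_eval_map]; exact hz))
      ((Polynomial.map_ne_zero_iff (algebraMap K (CC K)).injective).2 hne)
    exact ⟨c, hc, fun x => by rw [aeval_eq_eval_map]; exact h x x.2⟩
  obtain ⟨c, hc, h⟩ := hQ'
  let g : X.Pt →ᵇ CC K := BoundedContinuousFunction.ofNormedAddCommGroup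
    (fun x : X.Pt => aeval (x : CC K) P / aeval (x : CC K) Q)
    (((P.continuous_aeval).comp continuous_subtype_val).div
      ((Q.continuous_aeval).comp continuous_subtype_val) hQ) (‖aeval X.T P‖ / c) (fun x => by
        rw [norm_div, ← aeval_T_apply]
        exact div_le_div₀ (norm_nonneg _) (norm_apply_le _ x) hc (h x))
  have hg : g ∈ X.ratFun := ⟨P, Q, hQ, fun x => rfl⟩
  exact ⟨⟨g, subset_closure hg⟩, hg, fun x => rfl⟩

end Affinoid

end QDiff

namespace QDiff

/-! ### Divided powers of a derivation -/

section Hasse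

variable {K : Type*} [Field K] {R : Type*} [CommRing R] [Algebra K R]

/-- The divided power `D ^ k / k!`. -/
noncomputable def hs {V : Type*} [AddCommGroup V] [Module K V] (D : V →ₗ[K] V) (k : ℕ) :
    V →ₗ[K] V := ((k.factorial : K)⁻¹) • D ^ k

theorem hs_zero {V : Type*} [AddCommGroup V] [Module K V] (D : V →ₗ[K] V) (v : V) :
    hs D 0 v = v := by simp [hs]

theorem hs_one {V : Type*} [AddCommGroup V] [Module K V] (D : V →ₗ[K] V) (v : V) :
    hs D 1 v = D v := by simp [hs]

/-- After shifting indices, the term (i, j) receives the weight i from one sum and j from the other,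
and i + j = m + 1. This is the inductive step of the Leibniz formula for divided powers. -/
theorem sum_antidiagonal_succ_smul {N : Type*} [AddCommGroup N] [Module K N] (m : ℕ)
    (g : ℕ → ℕ → N) :
    ∑ p ∈ Finset.HasAntidiagonal.antidiagonal m, (((p.1 : K) + 1) • g (p.1 + 1) p.2 +
      ((p.2 : K) + 1) • g p.1 (p.2 + 1)) =
    ((m : K) + 1) • ∑ p ∈ Finset.HasAntidiagonal.antidiagonal (m + 1), g p.1 p.2 := by
  have h1 : ∑ p ∈ Finset.HasAntidiagonal.antidiagonal m, ((p.1 : K) + 1) • g (p.1 + 1) p.2 =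
      ∑ p ∈ Finset.HasAntidiagonal.antidiagonal (m + 1), (p.1 : K) • g p.1 p.2 := by
    rw [Finset.Nat.sum_antidiagonal_succ]
    simp
  have h2 : ∑ p ∈ Finset.HasAntidiagonal.antidiagonal m, ((p.2 : K) + 1) • g p.1 (p.2 + 1) =
      ∑ p ∈ Finset.HasAntidiagonal.antidiagonal (m + 1), (p.2 : K) • g p.1 p.2 := by
    rw [Finset.Nat.sum_antidiagonal_succ']
    simp
  rw [Finset.sum_add_distrib, h1, h2, ← Finset.sum_add_distrib, Finset.smul_sum]
  refine Finset.sum_congr rfl fun p hp => ?_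
  rw [← add_smul, ← Nat.cast_add, Finset.HasAntidiagonal.mem_antidiagonal.1 hp, Nat.cast_succ]

variable [CharZero K]

theorem succ_smul_hs_succ {V : Type*} [AddCommGroup V] [Module K V] (D : V →ₗ[K] V) (k : ℕ)
    (v : V) : ((k : K) + 1) • hs D (k + 1) v = D (hs D k v) := by
  have h1 : (k.factorial : K) ≠ 0 := by exact_mod_cast k.factorial_ne_zero
  have h2 : (k : K) + 1 ≠ 0 := Nat.cast_add_one_ne_zero k
  rw [hs, hs, LinearMap.smul_apply, LinearMap.smul_apply, smul_smul, map_smul, pow_succ',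
    Module.End.mul_apply, Nat.factorial_succ]
  congr 1
  push_cast
  field_simp

/-- The Leibniz formula for divided powers of a connection. -/
theorem eq_sum_hs_smul {N : Type*} [AddCommGroup N] [Module K N] [Module R N]
    [IsScalarTower K R N] (D : R →ₗ[K] R) (nab : N →ₗ[K] N)
    (leib : ∀ (f : R) (v : N), nab (f • v) = D f • v + f • nab v) {ι : Type*} [Fintype ι]
    (f : ι → R) (y : ι → ℕ → N) (w : ℕ → N)
    (hy : ∀ i (j : ℕ), ((j : K) + 1) • y i (j + 1) = nab (y i j))
    (hw : ∀ j : ℕ, ((j : K) + 1) • w (j + 1) = nab (w j)) (h0 : w 0 = ∑ i, f i • y i 0) (m : ℕ) :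
    w m = ∑ i, ∑ p ∈ Finset.HasAntidiagonal.antidiagonal m, hs D p.1 (f i) • y i p.2 := by
  induction m with
  | zero => simpa [hs_zero] using h0
  | succ m ih =>
    have hm : (m : K) + 1 ≠ 0 := Nat.cast_add_one_ne_zero m
    refine smul_right_injective N hm ?_
    simp only
    rw [hw, ih, map_sum, Finset.smul_sum]
    refine Finset.sum_congr rfl fun i _ => ?_
    rw [map_sum, ← sum_antidiagonal_succ_smul m fun a b => hs D a (f i) • y i b]
    refine Finset.sum_congr rfl fun p _ => ?_
    rw [leib, ← succ_smul_hs_succ, ← hy, smul_assoc, smul_comm (_ : K) (hs D p.1 (f i))]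

theorem hs_mul (D : R →ₗ[K] R) (leib : ∀ f g : R, D (f * g) = D f * g + f * D g) (f g : R)
    (m : ℕ) : hs D m (f * g) = cauchyMul (fun i => hs D i f) (fun i => hs D i g) m := by
  have := eq_sum_hs_smul (N := R) (ι := Unit) D D leib (fun _ => f) (fun _ j => hs D j g)
    (fun j => hs D j (f * g)) (fun _ j => succ_smul_hs_succ D j g)
    (fun j => succ_smul_hs_succ D j _) (by simp [hs_zero]) m
  simpa [cauchyMul] using this

end Hasse

/-! ### The derivation of the ring of analytic elements -/

namespace Affinoid

variable {K : Type u} [NontriviallyNormedField K] [IsUltrametricDist K] [CompleteSpace K]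
  {X : Affinoid K}

theorem IsDeriv.unique {f g g' : X.H} (h : X.IsDeriv f g) (h' : X.IsDeriv f g') : g = g' :=
  H_ext fun x => tendsto_nhds_unique (h x) (h' x)

theorem IsDeriv.add {f g f' g' : X.H} (h : X.IsDeriv f f') (h' : X.IsDeriv g g') :
    X.IsDeriv (f + g) (f' + g') := fun x => by
  refine ((h x).add (h' x)).congr fun y => ?_
  rw [add_apply, add_apply]
  ring

theorem IsDeriv.const_smul {f f' : X.H} (h : X.IsDeriv f f') (a : K) :
    X.IsDeriv (a • f) (a • f') := fun x => by
  have e := (h x).const_mul (algebraMap K (CC K) a)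
  rw [← smul_apply] at e
  refine e.congr fun y => ?_
  simp only [smul_apply]
  ring

theorem IsDeriv.mul {f g f' g' : X.H} (h : X.IsDeriv f f') (h' : X.IsDeriv g g') :
    X.IsDeriv (f * g) (f' * g + f * g') := fun x => by
  have hg : Tendsto (fun y => g y) (𝓝[≠] x) (𝓝 (g x)) :=
    ((continuous_apply g).tendsto x).mono_left nhdsWithin_le_nhds
  rw [add_apply, mul_apply, mul_apply]
  refine (((h x).mul hg).add ((h' x).const_mul (f x))).congr fun y => ?_
  simp only [mul_apply]
  ring

theorem isDeriv_of_hasDerivAt {f g : X.H} (φ : CC K → CC K) (hφ : ∀ x : X.Pt, f x = φ x)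
    (h : ∀ x : X.Pt, HasDerivAt φ (g x) (x : CC K)) : X.IsDeriv f g := fun x => by
  have h1 := (h x).tendsto_slope
  rw [← map_coe_nhdsNE] at h1
  refine (tendsto_map'_iff.1 h1).congr fun y => ?_
  rw [Function.comp_apply, slope_def_field, hφ, hφ]

theorem IsRational.exists_isDeriv {f : X.H} (hf : IsRational f) : ∃ g, X.IsDeriv f g := by
  obtain ⟨P, Q, hQ, hPQ⟩ := hf
  obtain ⟨g, -, hg⟩ := exists_rational (X := X)
    (derivative P * Q - P * derivative Q) (Q ^ 2) fun x => by
      rw [map_pow]; exact pow_ne_zero _ (hQ x)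
  refine ⟨g, isDeriv_of_hasDerivAt (fun z => aeval z P / aeval z Q) hPQ fun x => ?_⟩
  have := (P.hasDerivAt_aeval (x : CC K)).div (Q.hasDerivAt_aeval (x : CC K)) (hQ x)
  rw [hg x]
  simp only [map_pow, map_sub, map_mul]
  exact this

/-- On the disk of radius r_X about x the denominator has no zero, so |Q| is constant and |P| ≤ ‖f‖
|Q(x)|; the Cauchy estimates then apply to P and Q. All bounds are relative to |Q(x)|, which cancels
in the quotient. -/
theorem IsRational.exists_bound {f : X.H} (hf : IsRational f) : ∃ P Q : K[X],
    (∀ x : X.Pt, aeval (x : CC K) Q ≠ 0) ∧ aeval X.T P = f * aeval X.T Q ∧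
    (∀ x y : X.Pt, ‖(y : CC K) - x‖ < X.rX →
      ‖aeval (y : CC K) Q‖ = ‖aeval (x : CC K) Q‖) ∧
    (∀ (x : X.Pt) (k : ℕ), ‖(taylor (x : CC K) (P.map (algebraMap K (CC K)))).coeff k‖ *
      X.rX ^ k ≤ ‖f‖ * ‖aeval (x : CC K) Q‖) ∧
    (∀ (x : X.Pt) (k : ℕ), ‖(taylor (x : CC K) (Q.map (algebraMap K (CC K)))).coeff k‖ *
      X.rX ^ k ≤ ‖aeval (x : CC K) Q‖) := by
  obtain ⟨P, Q, hQ, hPQ⟩ := hf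
  have hc : ∀ x : X.Pt, ∀ z : CC K, ‖z - x‖ < X.rX →
      ‖aeval z Q‖ = ‖aeval (x : CC K) Q‖ := fun x z hz => by
    rw [aeval_eq_eval_map, aeval_eq_eval_map]
    refine norm_eval_eq_of_ne_zero (splits_map_CC Q) (fun w hw => ?_) hz
    rw [← aeval_eq_eval_map]
    exact hQ ⟨w, mem_pts_of_norm_sub_lt x.2 hw⟩
  refine ⟨P, Q, hQ, H_ext fun x => ?_, fun x y h => hc x y h, fun x k => ?_, fun x k => ?_⟩
  · rw [mul_apply, aeval_T_apply, aeval_T_apply, hPQ, div_mul_cancel₀ _ (hQ x)]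
  · refine norm_coeff_taylor_le (splits_map_CC P) X.rX_pos (fun z hz => ?_) k
    rw [← aeval_eq_eval_map, ← hc x z hz]
    have h1 := hPQ ⟨z, mem_pts_of_norm_sub_lt x.2 hz⟩
    have h2 : aeval z P = f ⟨z, mem_pts_of_norm_sub_lt x.2 hz⟩ * aeval z Q := by
      rw [h1, div_mul_cancel₀ _ (hQ ⟨z, mem_pts_of_norm_sub_lt x.2 hz⟩)]
    rw [h2, norm_mul]
    gcongr
    exact norm_apply_le _ _
  · refine norm_coeff_taylor_le (splits_map_CC Q) X.rX_pos (fun z hz => ?_) k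
    rw [← aeval_eq_eval_map, hc x z hz]

/-- A Schwarz-type estimate whose constant depends on f only through ‖f‖, so it survives passage to
the completion. For f = P / Q it follows from (f(y) - f(x)) Q(y) = (P(y) - P(x)) - f(x) (Q(y) -
Q(x)). -/
theorem norm_apply_sub_le (f : X.H) (x y : X.Pt) (h : ‖(y : CC K) - x‖ < X.rX) :
    ‖f y - f x‖ ≤ ‖f‖ / X.rX * ‖(y : CC K) - x‖ := by
  refine induction_on_rational (p := fun f =>
    ‖f y - f x‖ ≤ ‖f‖ / X.rX * ‖(y : CC K) - x‖) ?_ (fun f hf => ?_) f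
  · refine isClosed_le ?_ (by fun_prop)
    exact ((continuous_evalAt y).sub (continuous_evalAt x)).norm
  have hr := X.rX_pos
  obtain ⟨P, Q, hQ, hPQ, hc, hP, hQk⟩ := hf.exists_bound
  have hv : ∀ z : X.Pt, aeval (z : CC K) P = f z * aeval (z : CC K) Q := fun z => by
    rw [← aeval_T_apply, hPQ, mul_apply, aeval_T_apply]
  have hPd := norm_ev_sub_le hr (by positivity) (hP x) h
  have hQd := norm_ev_sub_le hr (by positivity) (hQk x) h
  rw [← eval_eq_ev_taylor, ← aeval_eq_eval_map, taylor_coeff_zero, ← aeval_eq_eval_map]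
    at hPd hQd
  have hQx : 0 < ‖aeval (x : CC K) Q‖ := norm_pos_iff.2 (hQ x)
  have h1 : (f y - f x) * aeval (y : CC K) Q = (aeval (y : CC K) P - aeval (x : CC K) P) +
      -(f x * (aeval (y : CC K) Q - aeval (x : CC K) Q)) := by
    rw [hv, hv]; ring
  refine le_of_mul_le_mul_right ?_ hQx
  rw [← hc x y h, ← norm_mul, h1, hc x y h]
  refine (IsUltrametricDist.norm_add_le_max _ _).trans (max_le (hPd.trans_eq (by ring)) ?_)
  rw [norm_neg, norm_mul]
  calc ‖f x‖ * ‖aeval (y : CC K) Q - aeval (x : CC K) Q‖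
      ≤ ‖f‖ * (‖aeval (x : CC K) Q‖ / X.rX * ‖(y : CC K) - x‖) := by
        gcongr
        exact norm_apply_le f x
    _ = _ := by ring

theorem norm_slope_le (f : X.H) (x y : X.Pt) (h : ‖(y : CC K) - x‖ < X.rX) :
    ‖(f y - f x) / ((y : CC K) - x)‖ ≤ ‖f‖ / X.rX := by
  rw [norm_div]
  exact div_le_of_le_mul₀ (norm_nonneg _) (div_nonneg (norm_nonneg _) X.rX_pos.le)
    (norm_apply_sub_le f x y h)

theorem eventually_norm_sub_lt (x : X.Pt) {ρ : ℝ} (hρ : 0 < ρ) :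
    ∀ᶠ y : X.Pt in 𝓝[≠] x, ‖(y : CC K) - x‖ < ρ := by
  refine nhdsWithin_le_nhds ?_
  filter_upwards [Metric.ball_mem_nhds x hρ] with y hy
  rwa [← dist_eq_norm]

theorem IsDeriv.norm_le {f g : X.H} (h : X.IsDeriv f g) : ‖g‖ ≤ ‖f‖ / X.rX := by
  refine (norm_le_iff (div_nonneg (norm_nonneg _) X.rX_pos.le)).2 fun x => ?_
  refine le_of_tendsto (h x).norm ?_
  filter_upwards [eventually_norm_sub_lt x X.rX_pos] with y hy
  exact norm_slope_le f x y hy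

/-- The bound ‖g‖ ≤ ‖f‖ / r_X makes the derivatives of a convergent sequence Cauchy, and the same
bound on slopes makes their convergence uniform, so the two limits can be exchanged. -/
theorem isClosed_exists_isDeriv : IsClosed {f : X.H | ∃ g, X.IsDeriv f g} := by
  have hr := X.rX_pos
  refine isClosed_of_closure_subset fun f hf => ?_
  obtain ⟨F, hF, hlim⟩ := mem_closure_iff_seq_limit.1 hf
  choose G hG using hF
  have hsub : ∀ m n, X.IsDeriv (F m - F n) (G m - G n) := fun m n => by
    have := (hG m).add ((hG n).const_smul (-1))
    simpa only [neg_one_smul, ← sub_eq_add_neg] using this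
  have hC : CauchySeq G := by
    refine Metric.cauchySeq_iff.2 fun ε hε => ?_
    obtain ⟨N, hN⟩ := Metric.cauchySeq_iff.1 hlim.cauchySeq (ε * X.rX) (by positivity)
    refine ⟨N, fun m hm n hn => ?_⟩
    rw [dist_eq_norm]
    refine (hsub m n).norm_le.trans_lt ((div_lt_iff₀ hr).2 ?_)
    rw [← dist_eq_norm]
    exact hN m hm n hn
  obtain ⟨g, hg⟩ := cauchySeq_tendsto_of_complete hC
  refine ⟨g, fun x => ?_⟩
  refine Metric.tendsto_nhds.2 fun ε hε => ?_
  obtain ⟨n, hn1, hn2⟩ := ((Metric.tendsto_nhds.1 hlim (ε * X.rX) (by positivity)).and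
    (Metric.tendsto_nhds.1 hg ε hε)).exists
  filter_upwards [eventually_norm_sub_lt x hr, Metric.tendsto_nhds.1 (hG n x) ε hε] with y hy hy'
  have e : (f y - f x) / ((y : CC K) - x) - g x = ((f - F n) y - (f - F n) x) / ((y : CC K) - x) +
      (((F n y - F n x) / ((y : CC K) - x) - G n x) + (G n - g) x) := by
    simp only [sub_apply]; ring
  rw [dist_eq_norm, e]
  refine (IsUltrametricDist.norm_add_le_max _ _).trans_lt (max_lt ?_
    ((IsUltrametricDist.norm_add_le_max _ _).trans_lt (max_lt ?_ ?_)))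
  · refine (norm_slope_le (f - F n) x y hy).trans_lt ((div_lt_iff₀ hr).2 ?_)
    rwa [← dist_eq_norm, dist_comm]
  · rwa [← dist_eq_norm]
  · refine (norm_apply_le (G n - g) x).trans_lt ?_
    rwa [← dist_eq_norm]

theorem isDeriv_ddT (f : X.H) : X.IsDeriv f (X.ddT f) := by
  have h : ∃ g, X.IsDeriv f g := induction_on_rational isClosed_exists_isDeriv
    (fun f hf => hf.exists_isDeriv) f
  rw [ddT, dif_pos h]
  exact h.choose_spec

theorem IsDeriv.ddT_eq {f g : X.H} (h : X.IsDeriv f g) : X.ddT f = g := (isDeriv_ddT f).unique h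

theorem ddT_mul (f g : X.H) : X.ddT (f * g) = X.ddT f * g + f * X.ddT g :=
  ((isDeriv_ddT f).mul (isDeriv_ddT g)).ddT_eq

variable (X) in
/-- The derivation `d/dT`, as a linear map. -/
noncomputable def D : X.H →ₗ[K] X.H where
  toFun := X.ddT
  map_add' f g := ((isDeriv_ddT f).add (isDeriv_ddT g)).ddT_eq
  map_smul' a f := ((isDeriv_ddT f).const_smul a).ddT_eq

theorem D_apply (f : X.H) : X.D f = X.ddT f := rfl

variable (X) in
/-- The derivation `δ₁`, as a linear map. -/
noncomputable def deltaL : X.H →ₗ[K] X.H where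
  toFun := X.delta
  map_add' f g := by rw [delta, ← D_apply, map_add, mul_add]; rfl
  map_smul' a f := by rw [delta, ← D_apply, map_smul, mul_smul_comm]; rfl

theorem deltaL_apply (f : X.H) : X.deltaL f = X.delta f := rfl

theorem delta_mul (f g : X.H) : X.delta (f * g) = X.delta f * g + f * X.delta g := by
  rw [delta, delta, delta, ddT_mul]; ring

theorem continuous_D : Continuous X.D :=
  AddMonoidHomClass.continuous_of_bound X.D (1 / X.rX) fun f =>
    (isDeriv_ddT f).norm_le.trans_eq (by ring)

theorem geoBdd_apply {ρ : ℝ} (hρ : 0 ≤ ρ) {Y : ℕ → X.H} (h : GeoBdd ρ Y) (x : X.Pt) :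
    GeoBdd ρ (fun k => Y k x) := h.of_norm_le hρ fun k => norm_apply_le (Y k) x

theorem D_aeval_T (P : K[X]) : X.D (aeval X.T P) = aeval X.T (derivative P) :=
  (isDeriv_of_hasDerivAt (fun z => aeval z P) (aeval_T_apply P) fun x => by
    rw [aeval_T_apply]; exact P.hasDerivAt_aeval (x : CC K)).ddT_eq

variable [CharZero K]

theorem continuous_hs (k : ℕ) : Continuous (hs X.D k) := by
  induction k with
  | zero => exact continuous_id.congr fun f => (hs_zero X.D f).symm
  | succ k ih =>
    have : ∀ f, hs X.D (k + 1) f = ((k : K) + 1)⁻¹ • X.D (hs X.D k f) := fun f => by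
      rw [← succ_smul_hs_succ, inv_smul_smul₀ (Nat.cast_add_one_ne_zero k)]
    rw [show ⇑(hs X.D (k + 1)) = _ from funext this]
    exact (continuous_D.comp ih).const_smul (((k : K) + 1)⁻¹)

/-- In characteristic zero dividing by k! recovers the Hasse derivative, which links the divided
powers of d/dT to the Taylor coefficients of polynomials. -/
theorem hs_aeval_T (P : K[X]) (k : ℕ) : hs X.D k (aeval X.T P) = aeval X.T (hasseDeriv k P) := by
  have h : ∀ k, (X.D ^ k) (aeval X.T P) = aeval X.T (derivative^[k] P) := fun k => by
    induction k with
    | zero => simp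
    | succ k ih => rw [pow_succ', Module.End.mul_apply, ih, D_aeval_T, Function.iterate_succ_apply']
  have h1 : (k.factorial : K) ≠ 0 := by exact_mod_cast k.factorial_ne_zero
  rw [hs, LinearMap.smul_apply, h, ← factorial_smul_hasseDeriv, LinearMap.smul_apply, map_nsmul,
    ← Nat.cast_smul_eq_nsmul K, inv_smul_smul₀ h1]

theorem hs_aeval_T_apply (P : K[X]) (k : ℕ) (x : X.Pt) :
    hs X.D k (aeval X.T P) x = (taylor (x : CC K) (P.map (algebraMap K (CC K)))).coeff k := by
  rw [hs_aeval_T, aeval_T_apply, taylor_coeff, aeval_eq_eval_map]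
  congr 1
  ext n
  simp [hasseDeriv_coeff]

/-- By Leibniz, P = f Q makes the Taylor coefficients of P the Cauchy product of those of f and Q.
Solving for the k-th coefficient of f bounds it by strong induction; multiplying the series and
dividing by Q(x) ≠ 0 gives the expansion. -/
theorem IsRational.hasse {f : X.H} (hf : IsRational f) : (∀ k, ‖hs X.D k f‖ * X.rX ^ k ≤ ‖f‖) ∧
    ∀ x y : X.Pt, ‖(x : CC K) - y‖ < X.rX → f x = ev (fun k => hs X.D k f y) (x - y) := by
  have hr := X.rX_pos
  obtain ⟨P, Q, hQ, hPQ, hc, hP, hQk⟩ := hf.exists_bound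
  have hprod : ∀ k, hs X.D k (aeval X.T P) =
      cauchyMul (fun i => hs X.D i f) (fun i => hs X.D i (aeval X.T Q)) k := fun k => by
    rw [hPQ, hs_mul X.D ddT_mul]
  have hprodx : ∀ (x : X.Pt), (fun k => hs X.D k (aeval X.T P) x) =
      cauchyMul (fun i => hs X.D i f x) (fun i => hs X.D i (aeval X.T Q) x) := fun x => by
    funext k
    rw [hprod, ← evalAt_apply, cauchyMul, map_sum]
    exact Finset.sum_congr rfl fun p _ => map_mul _ _ _
  have hbd : ∀ k (x : X.Pt), ‖hs X.D k f x‖ * X.rX ^ k ≤ ‖f‖ := by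
    intro k x
    have hQx : 0 < ‖aeval (x : CC K) Q‖ := norm_pos_iff.2 (hQ x)
    induction k using Nat.strong_induction_on with
    | _ k ih =>
      have h1 := congrFun (hprodx x) k
      rw [cauchyMul, Finset.Nat.sum_antidiagonal_eq_sum_range_succ
        (fun i j => hs X.D i f x * hs X.D j (aeval X.T Q) x), Finset.sum_range_succ, Nat.sub_self,
        hs_zero, aeval_T_apply] at h1
      have h2 : hs X.D k f x * aeval (x : CC K) Q = hs X.D k (aeval X.T P) x +
          -∑ i ∈ Finset.range k, hs X.D i f x * hs X.D (k - i) (aeval X.T Q) x := by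
        rw [h1]; ring
      refine le_of_mul_le_mul_right ?_ hQx
      rw [mul_right_comm, ← norm_mul, h2, ← le_div_iff₀ (by positivity)]
      refine (IsUltrametricDist.norm_add_le_max _ _).trans (max_le ?_ ?_)
      · rw [le_div_iff₀ (by positivity), hs_aeval_T_apply]
        exact hP x k
      · rw [norm_neg]
        refine IsUltrametricDist.norm_sum_le_of_forall_le_of_nonneg (by positivity) fun i hi => ?_
        rw [Finset.mem_range] at hi
        rw [le_div_iff₀ (by positivity), norm_mul, hs_aeval_T_apply]
        calc _ = (‖hs X.D i f x‖ * X.rX ^ i) *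
              (‖(taylor (x : CC K) (Q.map (algebraMap K (CC K)))).coeff (k - i)‖ *
                X.rX ^ (k - i)) := by
              rw [show X.rX ^ k = X.rX ^ i * X.rX ^ (k - i) by
                rw [← pow_add, Nat.add_sub_cancel' hi.le]]
              ring
          _ ≤ _ := by
              gcongr
              · exact ih i hi
              · exact hQk x (k - i)
  refine ⟨fun k => ?_, fun x y h => ?_⟩
  · rw [← le_div_iff₀ (by positivity), norm_le_iff (by positivity)]
    intro x
    rw [le_div_iff₀ (by positivity)]
    exact hbd k x
  · have h1 := ev_mul (F := CC K) (ρ := X.rX) (a := fun i => hs X.D i f y)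
      (b := fun i => hs X.D i (aeval X.T Q) y) ⟨‖f‖, norm_nonneg _, fun k => hbd k y⟩
      ⟨‖aeval (y : CC K) Q‖, norm_nonneg _, fun k => by
        simp only [hs_aeval_T_apply]; exact hQk y k⟩ h
    rw [← hprodx y] at h1
    simp only [hs_aeval_T_apply] at h1
    rw [← eval_eq_ev_taylor, ← eval_eq_ev_taylor, ← aeval_eq_eval_map, ← aeval_eq_eval_map] at h1
    refine mul_right_cancel₀ (hQ x) ?_
    rw [← h1, ← aeval_T_apply, ← aeval_T_apply, ← mul_apply, hPQ]

theorem norm_hs_le (f : X.H) (k : ℕ) : ‖hs X.D k f‖ * X.rX ^ k ≤ ‖f‖ :=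
  induction_on_rational (p := fun f => ‖hs X.D k f‖ * X.rX ^ k ≤ ‖f‖)
    (isClosed_le ((continuous_hs k).norm.mul continuous_const) continuous_norm)
    (fun _ hf => hf.hasse.1 k) f

theorem geoBdd_hs (f : X.H) : GeoBdd X.rX (fun k => hs X.D k f) :=
  ⟨‖f‖, norm_nonneg _, norm_hs_le f⟩

/-- The Taylor expansion of an analytic element. -/
theorem apply_eq_ev (f : X.H) (x y : X.Pt) (h : ‖(x : CC K) - y‖ < X.rX) :
    f x = ev (fun k => hs X.D k f y) (x - y) := by
  refine induction_on_rational (p := fun f => f x = ev (fun k => hs X.D k f y) (x - y))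
    (isClosed_eq (continuous_evalAt x) ?_) (fun f hf => hf.hasse.2 x y h) f
  -- The coefficient bounds make the Taylor sum 1-Lipschitz in f for the sup-norm, so the identity
  -- is a closed condition.
  refine (LipschitzWith.of_dist_le_mul (K := 1) fun f g => ?_).continuous
  rw [dist_eq_norm, dist_eq_norm, NNReal.coe_one, one_mul,
    ← ev_sub (geoBdd_apply X.rX_pos.le (geoBdd_hs f) y) (geoBdd_apply X.rX_pos.le (geoBdd_hs g) y) h]
  refine norm_ev_le (ρ := X.rX) (norm_nonneg _) (fun k => ?_) h.le
  rw [← sub_apply, ← map_sub]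
  have := X.rX_pos
  exact (mul_le_mul_of_nonneg_right (norm_apply_le _ y) (by positivity)).trans (norm_hs_le _ k)

end Affinoid

end QDiff

namespace QDiff

/-! ### Power series of matrices -/

section MatrixSeries

variable {l m n : Type*}

/-- All the entries have geometrically bounded coefficients. -/
def MBdd {E : Type*} [NormedAddCommGroup E] (ρ : ℝ) (a : ℕ → Matrix m n E) : Prop :=
  ∀ i j, GeoBdd ρ fun k => a k i j

/-- The Cauchy product of two sequences of matrices. -/
def mulSeq [Fintype m] {R : Type*} [NonUnitalNonAssocSemiring R] (a : ℕ → Matrix l m R)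
    (b : ℕ → Matrix m n R) (k : ℕ) : Matrix l n R :=
  ∑ p ∈ Finset.HasAntidiagonal.antidiagonal k, a p.1 * b p.2

/-- The sum of a power series of matrices at `u`. -/
noncomputable def mev {F : Type*} [NormedField F] (a : ℕ → Matrix m n F) (u : F) : Matrix m n F :=
  Matrix.of fun i j => ev (fun k => a k i j) u

/-- The coefficients of the expansion of `∑ a m (u + v) ^ m` in powers of `u`. -/
noncomputable def mrecenter {F : Type*} [NormedField F] (a : ℕ → Matrix m n F) (v : F) (k : ℕ) :
    Matrix m n F :=
  Matrix.of fun i j => recenter (fun k => a k i j) v k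

theorem mulSeq_apply [Fintype m] {R : Type*} [NonUnitalNonAssocSemiring R] (a : ℕ → Matrix l m R)
    (b : ℕ → Matrix m n R) (k : ℕ) (i : l) (j : n) :
    mulSeq a b k i j = ∑ t, cauchyMul (fun k => a k i t) (fun k => b k t j) k := by
  simp only [mulSeq, cauchyMul, Matrix.sum_apply, Matrix.mul_apply]
  exact Finset.sum_comm

theorem mulSeq_one [Fintype m] {R : Type*} [NonUnitalNonAssocSemiring R] (a : ℕ → Matrix l m R)
    (b : ℕ → Matrix m n R) : mulSeq a b 1 = a 0 * b 1 + a 1 * b 0 := by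
  rw [mulSeq, Finset.Nat.sum_antidiagonal_succ]
  simp

theorem map_mulSeq [Fintype m] {R S : Type*} [Semiring R] [Semiring S] (f : R →+* S) (a : ℕ → Matrix l m R)
    (b : ℕ → Matrix m n R) (k : ℕ) :
    (mulSeq a b k).map f = mulSeq (fun k => (a k).map f) (fun k => (b k).map f) k := by
  ext i j
  simp [mulSeq, Matrix.sum_apply, Matrix.mul_apply]

theorem MBdd.mulSeq [Fintype m] {E : Type*} [NormedRing E] [IsUltrametricDist E] {ρ : ℝ} (hρ : 0 ≤ ρ)
    {a : ℕ → Matrix l m E} {b : ℕ → Matrix m n E} (ha : MBdd ρ a) (hb : MBdd ρ b) :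
    MBdd ρ (mulSeq a b) := fun i j => by
  simp only [mulSeq_apply]
  exact GeoBdd.sum hρ _ fun t _ => (ha i t).cauchyMul hρ (hb t j)

theorem MBdd.mul_const [Fintype m] {E : Type*} [NormedRing E] {ρ : ℝ} (hρ : 0 ≤ ρ)
    {a : ℕ → Matrix l m E} (ha : MBdd ρ a) (C : Matrix m n E) :
    MBdd ρ (fun k => a k * C) := fun i j => by
  simp only [Matrix.mul_apply]
  exact GeoBdd.sum hρ _ fun t _ => (ha i t).mul_const hρ _

theorem MBdd.mono {E : Type*} [NormedAddCommGroup E] {ρ ρ' : ℝ} (h0 : 0 ≤ ρ) (h : ρ ≤ ρ')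
    {a : ℕ → Matrix m n E} (ha : MBdd ρ' a) : MBdd ρ a := fun i j => (ha i j).mono h0 h

variable {F : Type*} [NormedField F]

theorem mev_zero_right (a : ℕ → Matrix m n F) : mev a 0 = a 0 := by
  ext i j
  exact ev_zero_right _

theorem MBdd.mrecenter [IsUltrametricDist F] {ρ : ℝ} {a : ℕ → Matrix m n F} (ha : MBdd ρ a) {v : F}
    (hv : ‖v‖ < ρ) : MBdd ρ (mrecenter a v) := fun i j =>
  (ha i j).recenter ((norm_nonneg v).trans_lt hv) hv

variable [CompleteSpace F]

theorem mev_mul_const [Fintype m] {ρ : ℝ} {a : ℕ → Matrix l m F} (ha : MBdd ρ a)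
    (C : Matrix m n F) {u : F} (hu : ‖u‖ < ρ) : mev (fun k => a k * C) u = mev a u * C := by
  ext i j
  have hρ := (norm_nonneg u).trans hu.le
  rw [Matrix.mul_apply, mev, Matrix.of_apply]
  simp only [Matrix.mul_apply]
  rw [ev_sum _ (fun t _ => (ha i t).mul_const hρ _) hu]
  exact Finset.sum_congr rfl fun t _ => ev_mul_const _ _ _

variable [IsUltrametricDist F]

theorem mev_mulSeq [Fintype m] {ρ : ℝ} {a : ℕ → Matrix l m F} {b : ℕ → Matrix m n F}
    (ha : MBdd ρ a) (hb : MBdd ρ b) {u : F} (hu : ‖u‖ < ρ) :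
    mev (mulSeq a b) u = mev a u * mev b u := by
  ext i j
  have hρ := (norm_nonneg u).trans hu.le
  rw [Matrix.mul_apply, mev, Matrix.of_apply]
  simp only [mulSeq_apply]
  rw [ev_sum _ (fun t _ => (ha i t).cauchyMul hρ (hb t j)) hu]
  exact Finset.sum_congr rfl fun t _ => ev_mul (ha i t) (hb t j) hu

theorem mev_mrecenter {ρ : ℝ} {a : ℕ → Matrix m n F} (ha : MBdd ρ a) {u v : F} (hu : ‖u‖ < ρ)
    (hv : ‖v‖ < ρ) : mev (mrecenter a v) u = mev a (u + v) := by
  ext i j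
  exact ev_recenter (ha i j) hu hv

theorem eq_of_frequently_mev_eq {ρ : ℝ} (hρ : 0 < ρ) {a b : ℕ → Matrix m n F} (ha : MBdd ρ a)
    (hb : MBdd ρ b) (h : ∃ᶠ u in 𝓝[≠] (0 : F), mev a u = mev b u) (k : ℕ) : a k = b k := by
  ext i j
  exact congrFun (eq_of_frequently_ev_eq hρ (ha i j) (hb i j)
    (h.mono fun u hu => congrFun (congrFun hu i) j)) k

end MatrixSeries

/-! ### Solutions of differential and `q`-difference equations -/

namespace Affinoid

variable {K : Type u} [NontriviallyNormedField K] [IsUltrametricDist K] [CompleteSpace K]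
  {X : Affinoid K} {l m n : Type*}

theorem eventually_coe_ne_zero (x : X.Pt) : ∀ᶠ y : X.Pt in 𝓝[≠] x, (y : CC K) ≠ 0 := by
  by_cases hx : (x : CC K) = 0
  · filter_upwards [eventually_mem_nhdsWithin] with y hy h0
    exact hy (Subtype.ext (h0.trans hx.symm))
  · have : ∀ᶠ y : X.Pt in 𝓝 x, (y : CC K) ≠ 0 :=
      continuous_subtype_val.continuousAt.eventually_ne hx
    exact nhdsWithin_le_nhds this

/-- The value of a matrix of analytic elements at a point. -/
noncomputable def matAt (x : X.Pt) (A : Matrix m n X.H) : Matrix m n (CC K) := A.map (evalAt x)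

theorem matAt_mul [Fintype m] (x : X.Pt) (A : Matrix l m X.H) (B : Matrix m n X.H) :
    matAt x (A * B) = matAt x A * matAt x B := Matrix.map_mul

theorem matAt_add (x : X.Pt) (A B : Matrix m n X.H) : matAt x (A + B) = matAt x A + matAt x B :=
  Matrix.map_add _ (map_add _) A B

theorem matAt_one [DecidableEq n] (x : X.Pt) : matAt x (1 : Matrix n n X.H) = 1 :=
  Matrix.map_one _ (map_zero _) (map_one _)

theorem matAt_smul (x : X.Pt) (a : K) (A : Matrix m n X.H) :
    matAt x (a • A) = algebraMap K (CC K) a • matAt x A := by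
  ext i j
  exact smul_apply a (A i j) x

theorem mat_ext {A B : Matrix m n X.H} (h : ∀ x, matAt x A = matAt x B) : A = B := by
  ext1 i j
  exact H_ext fun x => congrFun (congrFun (h x) i) j

theorem mat_ext_of_ne_zero {A B : Matrix m n X.H}
    (h : ∀ x : X.Pt, (x : CC K) ≠ 0 → matAt x A = matAt x B) : A = B := by
  ext1 i j
  refine sub_eq_zero.1 (eq_zero_of_apply_eq_zero fun x hx => ?_)
  rw [sub_apply, sub_eq_zero]
  exact congrFun (congrFun (h x hx) i) j

theorem mbdd_matAt {ρ : ℝ} (hρ : 0 ≤ ρ) {Y : ℕ → Matrix m n X.H} (h : MBdd ρ Y) (x : X.Pt) :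
    MBdd ρ (fun k => matAt x (Y k)) := fun i j => geoBdd_apply hρ (h i j) x

/-- The value `∑ k, Y k (y) (x - y) ^ k`. -/
noncomputable def solEval (Y : ℕ → Matrix m n X.H) (x y : X.Pt) : Matrix m n (CC K) :=
  mev (fun k => matAt y (Y k)) ((x : CC K) - y)

theorem solEval_self (Y : ℕ → Matrix m n X.H) (x : X.Pt) : solEval Y x x = matAt x (Y 0) := by
  rw [solEval, sub_self, mev_zero_right]

/-- Boundedness at an intermediate radius forces decay at any smaller one. With its converse, this
replaces the tending to zero of terms by geometric bounds at all radii below R. -/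
theorem MBdd.convergesOn {n : ℕ} {R : ℝ} {Y : ℕ → Matrix (Fin n) (Fin n) X.H}
    (h : ∀ ρ, 0 < ρ → ρ < R → MBdd ρ Y) : ConvergesOn R Y := fun ρ h0 hρ i j => by
  obtain ⟨σ, hσ1, hσ2⟩ := exists_between hρ
  exact ((h σ (h0.trans_lt hσ1) hσ2 i j).tendsto h0 hσ1).tendsto_atTop_zero

theorem mbdd_of_convergesOn {n : ℕ} {R : ℝ} {Y : ℕ → Matrix (Fin n) (Fin n) X.H}
    (h : ConvergesOn R Y) {ρ : ℝ} (h0 : 0 ≤ ρ) (hρ : ρ < R) : MBdd ρ Y := fun i j => by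
  obtain ⟨C, hC⟩ := (h ρ h0 hρ i j).bddAbove_range
  exact ⟨C, (by positivity : 0 ≤ ‖Y 0 i j‖ * ρ ^ 0).trans (hC ⟨0, rfl⟩), fun k => hC ⟨k, rfl⟩⟩

theorem map_D_mul [Fintype m] (A : Matrix l m X.H) (B : Matrix m n X.H) :
    (A * B).map X.D = A.map X.D * B + A * B.map X.D := by
  ext1 i j
  simp only [Matrix.map_apply, Matrix.mul_apply, Matrix.add_apply, map_sum, ← Finset.sum_add_distrib]
  exact Finset.sum_congr rfl fun t _ => ddT_mul _ _

variable [CharZero K]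

theorem mbdd_hs (U : Matrix m n X.H) : MBdd X.rX fun k => U.map (hs X.D k) :=
  fun i j => geoBdd_hs (U i j)

theorem matAt_eq_mev (U : Matrix m n X.H) {x y : X.Pt} (h : ‖(x : CC K) - y‖ < X.rX) :
    matAt x U = mev (fun k => matAt y (U.map (hs X.D k))) (x - y) := by
  ext i j
  exact apply_eq_ev (U i j) x y h

/-- The coefficients `Y k` satisfy the relations between the matrices of `(d/dT) ^ k / k!`. -/
def IsHorizontal [Fintype n] [DecidableEq n] (Y : ℕ → Matrix n n X.H) : Prop :=
  Y 0 = 1 ∧ ∀ k : ℕ, ((k : K) + 1) • Y (k + 1) = (Y k).map X.D + Y k * Y 1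

/-- In characteristic zero the recursion determines a sequence from its initial term. The Leibniz
formula, applied row by row to the connection v ↦ v' + vG, produces the solution starting at U y_0.
-/
theorem eq_mulSeq_hs [Fintype m] [Fintype n] {G : Matrix n n X.H} (U : Matrix l m X.H) {y : ℕ → Matrix m n X.H}
    {w : ℕ → Matrix l n X.H} (hy : ∀ j : ℕ, ((j : K) + 1) • y (j + 1) = (y j).map X.D + y j * G)
    (hw : ∀ j : ℕ, ((j : K) + 1) • w (j + 1) = (w j).map X.D + w j * G) (h0 : w 0 = U * y 0)
    (k : ℕ) : w k = mulSeq (fun k => U.map (hs X.D k)) y k := by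
  let nab : (n → X.H) →ₗ[K] (n → X.H) :=
    { toFun := fun v => (fun j => X.D (v j)) + Matrix.vecMul v G
      map_add' := fun v w => by
        ext1 j
        simp only [Pi.add_apply, map_add, Matrix.add_vecMul]
        abel
      map_smul' := fun a v => by
        ext1 j
        simp [Matrix.smul_vecMul] }
  have leib : ∀ (f : X.H) (v : n → X.H), nab (f • v) = X.D f • v + f • nab v := fun f v => by
    ext1 j
    simp only [nab, LinearMap.coe_mk, AddHom.coe_mk, Pi.add_apply, Pi.smul_apply, smul_eq_mul,
      Matrix.smul_vecMul, D_apply, ddT_mul]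
    ring
  have hyr : ∀ t (j : ℕ), ((j : K) + 1) • y (j + 1) t = nab (y j t) := fun t j => by
    ext1 c
    exact congrFun (congrFun (hy j) t) c
  have hwr : ∀ t (j : ℕ), ((j : K) + 1) • w (j + 1) t = nab (w j t) := fun t j => by
    ext1 c
    exact congrFun (congrFun (hw j) t) c
  ext1 i j
  have h := eq_sum_hs_smul X.D nab leib (fun t => U i t) (fun t k => y k t) (fun k => w k i)
    hyr (hwr i) (by
      ext1 t
      simp only [h0, Matrix.mul_apply, Finset.sum_apply, Pi.smul_apply, smul_eq_mul]) k
  rw [mulSeq_apply]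
  have h' := congrFun h j
  simpa only [Finset.sum_apply, Pi.smul_apply, smul_eq_mul, cauchyMul, Matrix.map_apply] using h'

section Horizontal

variable [Fintype n] [DecidableEq n] {Y : ℕ → Matrix n n X.H} {ρ : ℝ}

/-- This is the k-th divided derivative in z of Y(z, x). The multiples C(m+k, k) Y_{m+k} obey the
horizontal recursion with initial term Y_k, so they form the Cauchy product of the Taylor
coefficients of Y_k with Y. -/
theorem IsHorizontal.matAt_mul_solEval (hY : IsHorizontal Y) (hb : MBdd ρ Y) (hρ : ρ ≤ X.rX)
    {x z : X.Pt} (h : ‖(z : CC K) - x‖ < ρ) (k : ℕ) :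
    matAt z (Y k) * solEval Y z x = mrecenter (fun k => matAt x (Y k)) (z - x) k := by
  have hρ0 : 0 ≤ ρ := (norm_nonneg _).trans h.le
  have h1 : ∀ m, (((m + k).choose k : ℕ) : K) • Y (m + k) =
      mulSeq (fun i => (Y k).map (hs X.D i)) Y m := by
    refine eq_mulSeq_hs (G := Y 1) (Y k) hY.2 (fun j => ?_) ?_
    · have e : ((j : K) + 1) * (((j + 1 + k).choose k : ℕ) : K) =
          (((j + k).choose k : ℕ) : K) * (((j + k : ℕ) : K) + 1) := by
        have := Nat.add_one_mul_choose_eq (j + k) j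
        rw [Nat.choose_symm_add,
          show j + k + 1 = (j + 1) + k by ring, Nat.choose_symm_add] at this
        have h2 := congrArg (Nat.cast : ℕ → K) this
        push_cast at h2 ⊢
        linear_combination -h2
      rw [smul_smul, e, ← smul_smul, show j + 1 + k = j + k + 1 by ring, hY.2, smul_add,
        Matrix.smul_mul]
      congr 1
      ext1 i t
      exact (map_smul X.D _ _).symm
    · simp [hY.1]
  have h2 := mev_mulSeq (mbdd_matAt hρ0 ((mbdd_hs (Y k)).mono hρ0 hρ) x) (mbdd_matAt hρ0 hb x) h
  rw [← matAt_eq_mev _ (h.trans_le hρ)] at h2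
  rw [solEval, ← h2]
  ext i j
  change ev _ _ = ev _ _
  congr 1
  funext m
  change mulSeq (fun k_1 => ((Y k).map (hs X.D k_1)).map (evalAt x))
    (fun k => (Y k).map (evalAt x)) m i j = _
  have h3 := map_mulSeq (evalAt x : X.H →ₐ[K] CC K).toRingHom
    (fun i => (Y k).map (hs X.D i)) Y m
  rw [← h1] at h3
  refine (congrFun (congrFun h3.symm i) j).trans ?_
  change ((((m + k).choose k : ℕ) : K) • Y (m + k) i j) x = _
  rw [smul_apply, map_natCast]
  rfl

/-- The matrices Y_k(y) Y(y, x) are the coefficients of Y(·, x) recentered at y; summing them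
against (z - y)^k gives the value at z. -/
theorem IsHorizontal.solEval_mul_solEval (hY : IsHorizontal Y) (hb : MBdd ρ Y) (hρ : ρ ≤ X.rX)
    {x y z : X.Pt} (h : ‖(z : CC K) - y‖ < ρ) (h' : ‖(y : CC K) - x‖ < ρ) :
    solEval Y z y * solEval Y y x = solEval Y z x := by
  have hρ0 : 0 ≤ ρ := (norm_nonneg _).trans h.le
  rw [solEval, ← mev_mul_const (mbdd_matAt hρ0 hb y) _ h]
  simp only [hY.matAt_mul_solEval hb hρ h']
  rw [mev_mrecenter (mbdd_matAt hρ0 hb x) h h', sub_add_sub_cancel]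
  rfl

variable {n' : Type*} [Fintype n'] [DecidableEq n'] {Y' : ℕ → Matrix n' n' X.H}

theorem IsHorizontal.mul_eq_mulSeq (hY : IsHorizontal Y) (hY' : IsHorizontal Y')
    {U : Matrix n n' X.H} (hU : Y 1 * U = U.map X.D + U * Y' 1) (k : ℕ) :
    Y k * U = mulSeq (fun k => U.map (hs X.D k)) Y' k := by
  refine eq_mulSeq_hs (w := fun k => Y k * U) U hY'.2 (fun j => ?_)
    (by rw [hY.1, hY'.1, Matrix.one_mul, Matrix.mul_one]) k
  rw [← Matrix.smul_mul, hY.2, map_D_mul, Matrix.add_mul, Matrix.mul_assoc, hU, Matrix.mul_add,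
    Matrix.mul_assoc, add_assoc]

/-- The hypothesis on U is commutation with d/dT; it makes Y_k U the Cauchy product of the Taylor
coefficients of U with Y', and summation gives the intertwining of the two solutions. -/
theorem IsHorizontal.solEval_mul_matAt (hY : IsHorizontal Y) (hY' : IsHorizontal Y')
    (hb : MBdd ρ Y) (hb' : MBdd ρ Y') (hρ : ρ ≤ X.rX)
    {U : Matrix n n' X.H} (hU : Y 1 * U = U.map X.D + U * Y' 1) {x z : X.Pt}
    (h : ‖(z : CC K) - x‖ < ρ) : solEval Y z x * matAt x U = matAt z U * solEval Y' z x := by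
  have hρ0 : 0 ≤ ρ := (norm_nonneg _).trans h.le
  rw [matAt_eq_mev U (h.trans_le hρ), solEval, solEval, ← mev_mul_const (mbdd_matAt hρ0 hb x) _ h,
    ← mev_mulSeq (mbdd_matAt hρ0 ((mbdd_hs U).mono hρ0 hρ) x) (mbdd_matAt hρ0 hb' x) h]
  congr 1
  funext k
  rw [← matAt_mul, hY.mul_eq_mulSeq hY' hU]
  exact map_mulSeq (evalAt x : X.H →ₐ[K] CC K).toRingHom _ _ k

end Horizontal

end Affinoid

end QDiff

namespace QDiff

/-! ### Powers of q near 1, and the passage from q-difference to differential equations. -/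

theorem norm_pow_sub_one_le {F : Type*} [NormedField F] [IsUltrametricDist F] {a : F}
    (ha : ‖a - 1‖ < 1) (k : ℕ) : ‖a ^ k - 1‖ ≤ ‖a - 1‖ := by
  have h1 : ‖a‖ ≤ 1 := by
    rw [← sub_add_cancel a 1]
    exact (IsUltrametricDist.norm_add_le_max _ _).trans (max_le ha.le norm_one.le)
  rw [← mul_geom_sum, norm_mul]
  refine mul_le_of_le_one_right (norm_nonneg _) ?_
  refine IsUltrametricDist.norm_sum_le_of_forall_le_of_nonneg zero_le_one fun i _ => ?_
  rw [norm_pow]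
  exact pow_le_one₀ (norm_nonneg _) h1

/-- Write b^p - 1 = (b - 1)(p + ∑ (b^i - 1)): every p-th power shrinks the distance to 1 by the
factor max(|p|, |a - 1|) < 1. -/
theorem tendsto_pow_prime_pow {F : Type*} [NormedField F] [IsUltrametricDist F] {p : ℕ}
    (hp : ‖(p : F)‖ < 1) {a : F} (ha : ‖a - 1‖ < 1) :
    Tendsto (fun n => a ^ p ^ n) atTop (𝓝 1) := by
  set c := max ‖(p : F)‖ ‖a - 1‖
  have hc0 : 0 ≤ c := le_max_of_le_left (norm_nonneg _)
  have hc : c < 1 := max_lt hp ha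
  have key : ∀ n, ‖a ^ p ^ n - 1‖ ≤ ‖a - 1‖ * c ^ n := fun n => by
    induction n with
    | zero => simp
    | succ n ih =>
      set b := a ^ p ^ n
      have hb : ‖b - 1‖ ≤ ‖a - 1‖ := norm_pow_sub_one_le ha _
      rw [pow_succ p, pow_mul, ← mul_geom_sum, norm_mul, pow_succ, ← mul_assoc]
      refine mul_le_mul ih ?_ (norm_nonneg _) (by positivity)
      have e : ∑ i ∈ Finset.range p, b ^ i = (p : F) + ∑ i ∈ Finset.range p, (b ^ i - 1) := by
        simp
      rw [e]
      refine (IsUltrametricDist.norm_add_le_max _ _).trans (max_le_max le_rfl ?_)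
      exact IsUltrametricDist.norm_sum_le_of_forall_le_of_nonneg (norm_nonneg _) fun i _ =>
        (norm_pow_sub_one_le (hb.trans_lt ha) i).trans hb
  rw [tendsto_iff_norm_sub_tendsto_zero]
  refine squeeze_zero (fun _ => norm_nonneg _) key ?_
  simpa using (tendsto_pow_atTop_nhds_zero_of_lt_one hc0 hc).const_mul ‖a - 1‖

namespace Affinoid

variable {K : Type u} [NontriviallyNormedField K] [IsUltrametricDist K] [CompleteSpace K]
  {X : Affinoid K}

theorem mem_disk_iff {q : X.Q} {r : ℝ} : q ∈ X.disk r ↔ ‖((q : Kˣ) : K) - 1‖ * X.sX < r :=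
  lt_div_iff₀ (sX_pos X)

theorem pos_of_mem_disk {q : X.Q} {r : ℝ} (h : q ∈ X.disk r) : 0 < r :=
  (mul_nonneg (norm_nonneg _) (sX_pos X).le).trans_lt (mem_disk_iff.1 h)

theorem norm_sub_one_lt {q : X.Q} {r : ℝ} (hr : r ≤ X.rX) (h : q ∈ X.disk r) :
    ‖((q : Kˣ) : K) - 1‖ < 1 :=
  lt_of_lt_of_le h ((div_le_one (sX_pos X)).2 (hr.trans X.rX_le_sX))

theorem coe_mulPt (q : X.Q) (x : X.Pt) :
    (X.mulPt q x : CC K) = algebraMap K (CC K) ((q : Kˣ) : K) * x := rfl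

theorem mulPt_mul (q q' : X.Q) (x : X.Pt) : X.mulPt (q * q') x = X.mulPt q (X.mulPt q' x) := by
  refine Subtype.ext ?_
  simp only [coe_mulPt, Subgroup.coe_mul, Units.val_mul, map_mul, mul_assoc]

theorem mulPt_one (x : X.Pt) : X.mulPt 1 x = x := by
  refine Subtype.ext ?_
  simp [coe_mulPt]

theorem coe_mulPt_sub (q : X.Q) (x : X.Pt) :
    (X.mulPt q x : CC K) - x = algebraMap K (CC K) (((q : Kˣ) : K) - 1) * x := by
  rw [coe_mulPt, map_sub, map_one]; ring

theorem norm_mulPt_sub_lt {q : X.Q} {r : ℝ} (h : q ∈ X.disk r) (x : X.Pt) :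
    ‖(X.mulPt q x : CC K) - x‖ < r := by
  rw [coe_mulPt_sub, norm_mul, norm_algebraMap']
  exact (mul_le_mul_of_nonneg_left (norm_coe_le x) (norm_nonneg _)).trans_lt (mem_disk_iff.1 h)

theorem one_mem_disk_of_pos {r : ℝ} (h : 0 < r) : (1 : X.Q) ∈ X.disk r := by
  simpa [mem_disk_iff] using h

theorem mul_mem_disk {q q' : X.Q} {r : ℝ} (hr : r ≤ X.rX) (h : q ∈ X.disk r)
    (h' : q' ∈ X.disk r) : q * q' ∈ X.disk r := by
  have h1 := norm_sub_one_lt hr h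
  have e : (((q * q' : X.Q) : Kˣ) : K) - 1 = (((q : Kˣ) : K) - 1) +
      (((q' : Kˣ) : K) - 1) * ((q : Kˣ) : K) := by
    simp only [Subgroup.coe_mul, Units.val_mul]; ring
  have h2 : ‖((q : Kˣ) : K)‖ ≤ 1 := by
    rw [← sub_add_cancel ((q : Kˣ) : K) 1]
    exact (IsUltrametricDist.norm_add_le_max _ _).trans (max_le h1.le norm_one.le)
  change ‖_‖ < _
  rw [e]
  refine (IsUltrametricDist.norm_add_le_max _ _).trans_lt (max_lt h ?_)
  rw [norm_mul]
  exact (mul_le_of_le_one_right (norm_nonneg _) h2).trans_lt h'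

theorem inv_mem_disk {q : X.Q} {r : ℝ} (hr : r ≤ X.rX) (h : q ∈ X.disk r) : q⁻¹ ∈ X.disk r := by
  have h1 := norm_sub_one_lt hr h
  have h2 : ‖((q : Kˣ) : K)‖ = 1 := by
    have := IsUltrametricDist.norm_add_eq_max_of_norm_ne_norm (x := ((q : Kˣ) : K) - 1)
      (y := (1 : K)) (by rw [norm_one]; exact h1.ne)
    rwa [sub_add_cancel, norm_one, max_eq_right h1.le] at this
  have hq : ((q : Kˣ) : K) ≠ 0 := (q : Kˣ).ne_zero
  have e : (((q⁻¹ : X.Q) : Kˣ) : K) - 1 = -(((q : Kˣ) : K) - 1) * (((q : Kˣ) : K))⁻¹ := by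
    simp only [Subgroup.coe_inv, Units.val_inv_eq_inv_val]
    field_simp
    ring
  change ‖_‖ < _
  rw [e, norm_mul, norm_neg, norm_inv, h2, inv_one, mul_one]
  exact h

variable (X) in
/-- The disk `D⁻(1, r / s_X)` as a subgroup of `Q(X)`. -/
def diskSubgroup (r : ℝ) (hr : r ≤ X.rX) (h0 : 0 < r) : Subgroup X.Q where
  carrier := X.disk r
  mul_mem' h h' := mul_mem_disk hr h h'
  one_mem' := one_mem_disk_of_pos h0
  inv_mem' h := inv_mem_disk hr h

/-- Source of the accumulation: |p| < 1 brings the points back to z, while infinite order of q and z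
≠ 0 keep them distinct from z. -/
theorem tendsto_mulPt_pow {p : ℕ} (hp0 : p ≠ 0) (hp : ‖(p : K)‖ < 1) {q : X.Q} {r : ℝ}
    (hr : r ≤ X.rX) (hq : q ∈ X.disk r) (hfin : ¬ IsOfFinOrder q) {z : X.Pt} (hz : (z : CC K) ≠ 0) :
    Tendsto (fun n => (X.mulPt (q ^ p ^ n) z : CC K) - z) atTop (𝓝[≠] 0) := by
  refine tendsto_nhdsWithin_iff.2 ⟨?_, Eventually.of_forall fun n => ?_⟩
  · have h1 := (tendsto_pow_prime_pow hp (norm_sub_one_lt hr hq)).sub_const 1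
    have h2 := (((algebraMapCLM K (CC K)).continuous.tendsto _).comp h1).mul_const (z : CC K)
    rw [sub_self, map_zero, zero_mul] at h2
    refine h2.congr fun n => ?_
    rw [coe_mulPt_sub]
    simp
  · simp only [Set.mem_compl_iff, Set.mem_singleton_iff]
    rw [coe_mulPt_sub]
    refine mul_ne_zero ((_root_.map_ne_zero _).2 fun h => hfin ?_) hz
    refine isOfFinOrder_iff_pow_eq_one.2 ⟨p ^ n, by positivity, ?_⟩
    exact Subtype.ext (Units.ext (sub_eq_zero.1 h))

theorem mulPt_pow_succ (q : X.Q) (N : ℕ) (x : X.Pt) :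
    X.mulPt (q ^ (N + 1)) x = X.mulPt q (X.mulPt (q ^ N) x) := by
  rw [pow_succ', mulPt_mul]

theorem pow_mem_disk {q : X.Q} {r : ℝ} (hr : r ≤ X.rX) (h : q ∈ X.disk r) (N : ℕ) :
    q ^ N ∈ X.disk r := (X.diskSubgroup r hr (pos_of_mem_disk h)).pow_mem h N

variable {n n' : ℕ} {ρ : ℝ} {q : X.Q} {A : Matrix (Fin n) (Fin n) X.H}
  {A' : Matrix (Fin n') (Fin n') X.H} {Y : ℕ → Matrix (Fin n) (Fin n) X.H}
  {Y' : ℕ → Matrix (Fin n') (Fin n') X.H}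

theorem isSolution_iff : IsSolution ρ q A Y ↔ ∀ x y : X.Pt, ‖(x : CC K) - y‖ < ρ →
    solEval Y (X.mulPt q x) y = matAt x A * solEval Y x y := Iff.rfl

/-- The cocycle relation along the q-orbit of z: as N grows both sides are multiplied on the left by
the same matrix A(q^N z), and they agree at N = 0 because Y_0 = 1. -/
theorem solEval_pow_mul_solEval (hρ : ρ ≤ X.rX) (hq : q ∈ X.disk ρ) (h0 : Y 0 = 1)
    (hs : IsSolution ρ q A Y) {x z : X.Pt} (hxz : ‖(z : CC K) - x‖ < ρ) (N : ℕ) :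
    solEval Y (X.mulPt (q ^ N) z) z * solEval Y z x = solEval Y (X.mulPt (q ^ N) z) x := by
  induction N with
  | zero => rw [pow_zero, mulPt_one, solEval_self, h0, matAt_one, one_mul]
  | succ N ih =>
    have h1 := norm_mulPt_sub_lt (pow_mem_disk hρ hq N) z
    rw [mulPt_pow_succ, isSolution_iff.1 hs _ _ h1, Matrix.mul_assoc, ih, isSolution_iff.1 hs]
    rw [← sub_add_sub_cancel _ (z : CC K)]
    exact (IsUltrametricDist.norm_add_le_max _ _).trans_lt (max_lt h1 hxz)

theorem matAt_map_sigma {m n : Type*} (x : X.Pt) (q : X.Q) (U : Matrix m n X.H) :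
    matAt x (U.map (X.sigma q)) = matAt (X.mulPt q x) U := rfl

theorem solEval_pow_mul_matAt (hρ : ρ ≤ X.rX) (hq : q ∈ X.disk ρ) (h0 : Y 0 = 1) (h0' : Y' 0 = 1)
    (hs : IsSolution ρ q A Y) (hs' : IsSolution ρ q A' Y') {U : Matrix (Fin n) (Fin n') X.H}
    (hU : A * U = U.map (X.sigma q) * A') (x : X.Pt) (N : ℕ) :
    solEval Y (X.mulPt (q ^ N) x) x * matAt x U =
      matAt (X.mulPt (q ^ N) x) U * solEval Y' (X.mulPt (q ^ N) x) x := by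
  induction N with
  | zero => rw [pow_zero, mulPt_one, solEval_self, solEval_self, h0, h0', matAt_one, matAt_one,
      Matrix.one_mul, Matrix.mul_one]
  | succ N ih =>
    have h1 := norm_mulPt_sub_lt (pow_mem_disk hρ hq N) x
    have h2 := congrArg (matAt (X.mulPt (q ^ N) x)) hU
    rw [matAt_mul, matAt_mul] at h2
    rw [mulPt_pow_succ, isSolution_iff.1 hs _ _ h1, isSolution_iff.1 hs' _ _ h1, Matrix.mul_assoc,
      ih, ← Matrix.mul_assoc, h2, Matrix.mul_assoc, matAt_map_sigma]

theorem map_hs_zero {m n : Type*} (U : Matrix m n X.H) : U.map (hs X.D 0) = U := by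
  ext1 i j
  exact hs_zero X.D (U i j)

theorem map_hs_one {m n : Type*} (U : Matrix m n X.H) : U.map (hs X.D 1) = U.map X.D := by
  ext1 i j
  exact hs_one X.D (U i j)

variable [CharZero K] {p : ℕ}

/-- Along the orbit of x, the map U intertwines the solutions Y and Y'. Both sides are power series
at x agreeing on points accumulating there, so they coincide; the coefficient of degree one is
commutation with d/dT. -/
theorem mul_eq_of_sigma (hp0 : p ≠ 0) (hp : ‖(p : K)‖ < 1)
    (hρ : ρ ≤ X.rX) (hq : q ∈ X.disk ρ) (hfin : ¬ IsOfFinOrder q) (h0 : Y 0 = 1) (h0' : Y' 0 = 1)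
    (hb : MBdd ρ Y) (hb' : MBdd ρ Y')
    (hs : IsSolution ρ q A Y) (hs' : IsSolution ρ q A' Y') {U : Matrix (Fin n) (Fin n') X.H}
    (hU : A * U = U.map (X.sigma q) * A') : Y 1 * U = U.map X.D + U * Y' 1 := by
  have hρ0 := pos_of_mem_disk hq
  refine mat_ext_of_ne_zero fun x hx => ?_
  have hb2 := (mbdd_matAt hρ0.le (hb) x).mul_const hρ0.le (matAt x U)
  have hb3 := mbdd_matAt hρ0.le ((mbdd_hs U).mono hρ0.le hρ) x
  have hb4 := mbdd_matAt hρ0.le hb' x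
  have key := eq_of_frequently_mev_eq hρ0 hb2 (hb3.mulSeq hρ0.le hb4)
    ((tendsto_mulPt_pow hp0 hp hρ hq hfin hx).frequently (Eventually.of_forall
      fun N => ?_).frequently) 1
  · rw [mulSeq_one, map_hs_zero, map_hs_one, h0', matAt_one, Matrix.mul_one] at key
    rw [matAt_mul, key, matAt_add, matAt_mul, add_comm]
  · have h1 := norm_mulPt_sub_lt (pow_mem_disk hρ hq (p ^ N)) x
    rw [mev_mul_const (mbdd_matAt hρ0.le hb x) _ h1, mev_mulSeq hb3 hb4 h1,
      ← matAt_eq_mev U (h1.trans_le hρ)]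
    exact solEval_pow_mul_matAt hρ hq h0 h0' hs hs' hU x _

/-- The normalized solution of a `q`-difference equation is horizontal for a connection. -/
theorem isHorizontal_of_isSolution (hp0 : p ≠ 0) (hp : ‖(p : K)‖ < 1)
    (hρ : ρ ≤ X.rX) (hq : q ∈ X.disk ρ) (hfin : ¬ IsOfFinOrder q) (h0 : Y 0 = 1)
    (hb : MBdd ρ Y) (hs : IsSolution ρ q A Y) : IsHorizontal Y := by
  have hρ0 := pos_of_mem_disk hq
  -- For fixed x and z, both sides are the coefficients of power series centered at z which agree at
  -- the points q^(p^N) z, by the orbit form of the cocycle relation.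
  have star : ∀ {x z : X.Pt}, (z : CC K) ≠ 0 → ‖(z : CC K) - x‖ < ρ → ∀ k,
      matAt z (Y k) * solEval Y z x = mrecenter (fun k => matAt x (Y k)) (z - x) k := by
    intro x z hz hzx k
    refine eq_of_frequently_mev_eq hρ0
      ((mbdd_matAt hρ0.le hb z).mul_const hρ0.le (solEval Y z x))
      ((mbdd_matAt hρ0.le hb x).mrecenter hzx)
      ((tendsto_mulPt_pow hp0 hp hρ hq hfin hz).frequently (Eventually.of_forall
        fun N => ?_).frequently) k
    have h1 := norm_mulPt_sub_lt (pow_mem_disk hρ hq (p ^ N)) z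
    rw [mev_mul_const (mbdd_matAt hρ0.le hb z) _ h1, mev_mrecenter (mbdd_matAt hρ0.le hb x) h1 hzx,
      sub_add_sub_cancel]
    exact solEval_pow_mul_solEval hρ hq h0 hs hzx _
  refine ⟨h0, fun k => mat_ext fun x => ?_⟩
  have hb2 := mbdd_matAt hρ0.le ((mbdd_hs (Y k)).mono hρ0.le hρ) x
  have hb3 := mbdd_matAt hρ0.le hb x
  have hb4 : MBdd ρ (fun m => (((m + k).choose k : ℕ) : CC K) • matAt x (Y (m + k))) :=
    fun i j => (hb3 i j).shift hρ0 k
  -- Now z varies: expanded in powers of z - x, `star` compares Y_k(z) Y(z, x) with ∑ C(m+k, k)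
  -- Y_{m+k}(x) (z - x)^m. The coefficient of degree one is the horizontal recursion.
  have key := eq_of_frequently_mev_eq hρ0 (hb2.mulSeq hρ0.le hb3) hb4
    ((tendsto_coe_sub x).frequently (Eventually.frequently ?_)) 1
  · rw [mulSeq_one, map_hs_zero, map_hs_one, h0, matAt_one, Matrix.mul_one] at key
    rw [matAt_smul, matAt_add, matAt_mul, add_comm k 1]
    rw [← Nat.choose_symm_add, Nat.choose_one_right] at key
    have e : (algebraMap K (CC K)) ((k : K) + 1) = ((1 + k : ℕ) : CC K) := by
      push_cast
      ring
    rw [e, ← key, add_comm]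
  · filter_upwards [eventually_coe_ne_zero x, eventually_norm_sub_lt x hρ0] with z hz hzx
    rw [mev_mulSeq hb2 hb3 hzx, ← matAt_eq_mev (Y k) (hzx.trans_le hρ)]
    refine (star hz hzx k).trans ?_
    rfl

end Affinoid

end QDiff

namespace QDiff

variable {K : Type u} [NontriviallyNormedField K] [IsUltrametricDist K] [CompleteSpace K]
  {X : Affinoid K}

open Affinoid

/-! ### Semilinear operators and connections in a basis -/

section Operators

variable {V W : Type*} [AddCommGroup V] [Module X.H V] [AddCommGroup W]
  [Module X.H W] {n n' : ℕ} (b : Module.Basis (Fin n) X.H V) (b' : Module.Basis (Fin n') X.H W)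

/-- The matrix of an operator in a basis: the `i`-th row contains the coordinates of `φ (b i)`. -/
noncomputable def opMat (φ : V → V) : Matrix (Fin n) (Fin n) X.H :=
  Matrix.of fun i j => b.repr (φ (b i)) j

/-- The matrix of a linear map, acting on rows. -/
noncomputable def linMat (f : V →ₗ[X.H] W) : Matrix (Fin n) (Fin n') X.H :=
  Matrix.of fun i j => b'.repr (f (b i)) j

theorem linMat_id : linMat b b LinearMap.id = 1 := by
  ext1 i j
  simp [linMat, Finsupp.single_apply, Matrix.one_apply]

theorem apply_eq_sum_opMat (φ : V → V) (i : Fin n) : φ (b i) = ∑ j, opMat b φ i j • b j :=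
  (b.sum_repr (φ (b i))).symm

theorem apply_eq_sum_linMat (f : V →ₗ[X.H] W) (i : Fin n) :
    f (b i) = ∑ j, linMat b b' f i j • b' j := (b'.sum_repr (f (b i))).symm

theorem linMat_mul_linMat {Z : Type*} [AddCommGroup Z] [Module X.H Z] {n'' : ℕ}
    (b'' : Module.Basis (Fin n'') X.H Z) (f : V →ₗ[X.H] W) (g : W →ₗ[X.H] Z) :
    linMat b b' f * linMat b' b'' g = linMat b b'' (g.comp f) := by
  ext1 i j
  rw [Matrix.mul_apply]
  conv_rhs => rw [linMat, Matrix.of_apply, LinearMap.comp_apply, apply_eq_sum_linMat b b' f i,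
    map_sum, map_sum, Finsupp.finsetSum_apply]
  refine Finset.sum_congr rfl fun t _ => ?_
  rw [map_smul, map_smul, Finsupp.smul_apply, smul_eq_mul]
  rfl

theorem linMat_apply_opMat (φ : V → V) (f : V →ₗ[X.H] W) (i : Fin n) (j : Fin n') :
    b'.repr (f (φ (b i))) j = (opMat b φ * linMat b b' f) i j := by
  rw [apply_eq_sum_opMat b φ i, map_sum, map_sum, Finsupp.finsetSum_apply, Matrix.mul_apply]
  refine Finset.sum_congr rfl fun t _ => ?_
  rw [map_smul, map_smul, Finsupp.smul_apply, smul_eq_mul]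
  rfl

/-- By semilinearity it is enough to compare on a basis. Coordinates are rows, hence composition
reverses the order of the matrix products. -/
theorem comm_sigma_iff {φ : V →+ V} {ψ : W →+ W} (s : X.H →+* X.H)
    (hφ : ∀ (c : X.H) v, φ (c • v) = s c • φ v) (hψ : ∀ (c : X.H) v, ψ (c • v) = s c • ψ v)
    (f : V →ₗ[X.H] W) :
    (∀ v, f (φ v) = ψ (f v)) ↔
      opMat b φ * linMat b b' f = (linMat b b' f).map s * opMat b' ψ := by
  have h2 : ∀ i j, b'.repr (ψ (f (b i))) j = ((linMat b b' f).map s * opMat b' ψ) i j := by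
    intro i j
    rw [apply_eq_sum_linMat b b' f i, map_sum, map_sum, Finsupp.finsetSum_apply, Matrix.mul_apply]
    refine Finset.sum_congr rfl fun t _ => ?_
    rw [hψ, map_smul, Finsupp.smul_apply, smul_eq_mul]
    rfl
  constructor
  · intro h
    ext1 i j
    rw [← linMat_apply_opMat, ← h2, h]
  · intro h v
    have hb : ∀ i, f (φ (b i)) = ψ (f (b i)) := fun i => b'.repr.injective (by
      ext1 j
      rw [linMat_apply_opMat b b' φ f i j, h, h2])
    rw [← b.sum_repr v]
    simp only [map_sum, hφ, map_smul, hψ, hb]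

theorem comm_delta_iff {φ : V →+ V} {ψ : W →+ W}
    (hφ : ∀ (c : X.H) v, φ (c • v) = X.delta c • v + c • φ v)
    (hψ : ∀ (c : X.H) v, ψ (c • v) = X.delta c • v + c • ψ v) (f : V →ₗ[X.H] W) :
    (∀ v, f (φ v) = ψ (f v)) ↔
      opMat b φ * linMat b b' f = (linMat b b' f).map X.delta + linMat b b' f * opMat b' ψ := by
  have h2 : ∀ i j, b'.repr (ψ (f (b i))) j =
      ((linMat b b' f).map X.delta + linMat b b' f * opMat b' ψ) i j := by
    intro i j
    rw [apply_eq_sum_linMat b b' f i, map_sum, map_sum, Finsupp.finsetSum_apply, Matrix.add_apply,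
      Matrix.mul_apply]
    simp only [hψ, map_add, map_smul, Finsupp.add_apply, Finsupp.smul_apply, smul_eq_mul,
      Finset.sum_add_distrib, Module.Basis.repr_self, Finsupp.single_apply]
    congr 1
    simp
  constructor
  · intro h
    ext1 i j
    rw [← linMat_apply_opMat, ← h2, h]
  · intro h v
    have hb : ∀ i, f (φ (b i)) = ψ (f (b i)) := fun i => b'.repr.injective (by
      ext1 j
      rw [linMat_apply_opMat b b' φ f i j, h, h2])
    rw [← b.sum_repr v]
    simp only [map_sum, hφ, map_smul, hψ, hb, map_add]

theorem equivFun_basis (i : Fin n) : b.equivFun (b i) = Pi.single i 1 := by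
  ext1 j
  rw [Module.Basis.equivFun_self, Pi.single_apply]
  simp only [eq_comm]

variable [Module K V] [IsScalarTower K X.H V]

/-- The operator on `V` with a given expression in coordinates. -/
noncomputable def opOf (L : (Fin n → X.H) →ₗ[K] (Fin n → X.H)) : V →ₗ[K] V :=
  (b.equivFun.symm.restrictScalars K).toLinearMap ∘ₗ L ∘ₗ
    (b.equivFun.restrictScalars K).toLinearMap

theorem opOf_apply (L : (Fin n → X.H) →ₗ[K] (Fin n → X.H)) (v : V) :
    opOf b L v = b.equivFun.symm (L (b.equivFun v)) := rfl

theorem opMat_opOf (L : (Fin n → X.H) →ₗ[K] (Fin n → X.H)) (i j : Fin n) :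
    opMat b (opOf b L) i j = L (Pi.single i 1) j := by
  rw [opMat, Matrix.of_apply, ← Module.Basis.equivFun_apply, opOf_apply,
    LinearEquiv.apply_symm_apply, equivFun_basis]

/-- The connection `δ (∑ c i • b i) = ∑ j, (δ (c j) + ∑ i, c i * G i j) • b j`. -/
noncomputable def connOf (G : Matrix (Fin n) (Fin n) X.H) : V →ₗ[K] V :=
  opOf b
    { toFun := fun c j => X.deltaL (c j) + Matrix.vecMul c G j
      map_add' := fun c d => by
        ext1 j
        simp only [Pi.add_apply, map_add, Matrix.add_vecMul]
        abel
      map_smul' := fun a c => by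
        ext1 j
        simp [Matrix.smul_vecMul] }

theorem delta_one : X.delta (1 : X.H) = 0 := by
  have := delta_mul (1 : X.H) 1
  simpa using this

theorem delta_zero : X.delta (0 : X.H) = 0 := map_zero X.deltaL

theorem equivFun_connOf (G : Matrix (Fin n) (Fin n) X.H) (v : V) : b.equivFun (connOf b G v) =
    fun j => X.deltaL (b.equivFun v j) + Matrix.vecMul (b.equivFun v) G j := by
  rw [connOf, opOf_apply, LinearEquiv.apply_symm_apply]
  rfl

theorem connOf_smul (G : Matrix (Fin n) (Fin n) X.H) (f : X.H) (v : V) :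
    connOf b G (f • v) = X.delta f • v + f • connOf b G v := by
  apply b.equivFun.injective
  rw [equivFun_connOf, map_add, map_smul, map_smul, map_smul, equivFun_connOf]
  ext1 j
  simp only [Pi.add_apply, Pi.smul_apply, smul_eq_mul,
    Matrix.smul_vecMul, deltaL_apply, delta_mul]
  ring

theorem opMat_connOf (G : Matrix (Fin n) (Fin n) X.H) : opMat b (connOf b G) = G := by
  ext1 i j
  rw [connOf, opMat_opOf]
  simp only [LinearMap.coe_mk, AddHom.coe_mk, Matrix.single_one_vecMul, Matrix.row_apply]
  by_cases h : j = i
  · subst h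
    simp [deltaL_apply, delta_one]
  · simp [h]

/-- The `σ_q`-semilinear operator with matrix `A`. -/
noncomputable def sigmaOf (q : X.Q) (A : Matrix (Fin n) (Fin n) X.H) : V →ₗ[K] V :=
  opOf b
    { toFun := fun c => Matrix.vecMul (fun i => X.sigma q (c i)) A
      map_add' := fun c d => by
        rw [← Matrix.add_vecMul]
        congr 1
      map_smul' := fun a c => by
        rw [RingHom.id_apply, ← Matrix.smul_vecMul]
        congr 1 }

theorem equivFun_sigmaOf (q : X.Q) (A : Matrix (Fin n) (Fin n) X.H) (v : V) :
    b.equivFun (sigmaOf b q A v) = Matrix.vecMul (fun i => X.sigma q (b.equivFun v i)) A := by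
  rw [sigmaOf, opOf_apply, LinearEquiv.apply_symm_apply]
  rfl

theorem sigmaOf_smul (q : X.Q) (A : Matrix (Fin n) (Fin n) X.H) (f : X.H) (v : V) :
    sigmaOf b q A (f • v) = X.sigma q f • sigmaOf b q A v := by
  apply b.equivFun.injective
  rw [equivFun_sigmaOf, map_smul, map_smul, equivFun_sigmaOf, ← Matrix.smul_vecMul]
  congr 1

theorem opMat_sigmaOf (q : X.Q) (A : Matrix (Fin n) (Fin n) X.H) :
    opMat b (sigmaOf b q A) = A := by
  ext1 i j
  rw [opMat, Matrix.of_apply, ← Module.Basis.equivFun_apply, equivFun_sigmaOf,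
    equivFun_basis]
  have : (fun t => X.sigma q ((Pi.single i 1 : Fin n → X.H) t)) = Pi.single i 1 := by
    ext1 t
    by_cases h : t = i
    · subst h; simp
    · simp [h]
  rw [this]
  simp

end Operators

/-! ### The action of the disk defined by a horizontal sequence -/

namespace Affinoid

variable {n : ℕ} {Y : ℕ → Matrix (Fin n) (Fin n) X.H} {ρ : ℝ}

/-- The matrix `A(q, x) = Y(q x, x)`. -/
noncomputable def sigMat (Y : ℕ → Matrix (Fin n) (Fin n) X.H) (q : X.Q) :
    Matrix (Fin n) (Fin n) X.H :=
  Matrix.of fun i j => ∑' k, ((((q : Kˣ) : K) - 1) ^ k) • (X.T ^ k * Y k i j)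

theorem T_pow_apply (k : ℕ) (x : X.Pt) : (X.T ^ k) x = (x : CC K) ^ k := map_pow (evalAt x) X.T k

theorem norm_T_pow_mul_le (k : ℕ) (f : X.H) : ‖X.T ^ k * f‖ ≤ X.sX ^ k * ‖f‖ := by
  have := sX_pos X
  refine (norm_le_iff (by positivity)).2 fun x => ?_
  rw [mul_apply, T_pow_apply, norm_mul, norm_pow]
  gcongr
  · exact norm_coe_le x
  · exact norm_apply_le f x

/-- The series converges already in H_K(X), because |(q - 1)x| ≤ |q - 1| s_X < ρ uniformly on X;
evaluation at x is continuous. -/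
theorem matAt_sigMat (hb : MBdd ρ Y) {q : X.Q} (hq : q ∈ X.disk ρ) (x : X.Pt) :
    matAt x (sigMat Y q) = solEval Y (X.mulPt q x) x := by
  ext i j
  have hs : Summable fun k => ((((q : Kˣ) : K) - 1) ^ k) • (X.T ^ k * Y k i j) := by
    have h1 := (hb i j).tendsto (mul_nonneg (norm_nonneg _) (sX_pos X).le) (mem_disk_iff.1 hq)
    refine Summable.of_norm_bounded h1 fun k => ?_
    rw [norm_smul, norm_pow, mul_pow]
    calc _ ≤ ‖((q : Kˣ) : K) - 1‖ ^ k * (X.sX ^ k * ‖Y k i j‖) := by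
          gcongr
          exact norm_T_pow_mul_le _ _
      _ = _ := by ring
  have h2 := hs.hasSum.map (evalAt x).toRingHom.toAddMonoidHom (continuous_evalAt x)
  refine h2.tsum_eq.symm.trans (tsum_congr fun k => ?_)
  change (((((q : Kˣ) : K) - 1) ^ k) • (X.T ^ k * Y k i j)) x = _
  rw [smul_apply, mul_apply, T_pow_apply, coe_mulPt_sub, map_pow, mul_pow]
  change _ = Y k i j x * _
  ring

/-- Put y = x in the functional equation: a normalized solution determines its q-difference matrix.
-/
theorem eq_sigMat_of_isSolution {A : Matrix (Fin n) (Fin n) X.H} (hb : MBdd ρ Y) {q : X.Q}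
    (hq : q ∈ X.disk ρ) (h0 : Y 0 = 1) (hs : IsSolution ρ q A Y) : A = sigMat Y q :=
  mat_ext fun x => by
    have := isSolution_iff.1 hs x x (by rw [sub_self, norm_zero]; exact pos_of_mem_disk hq)
    rw [matAt_sigMat hb hq, this, solEval_self, h0, matAt_one, Matrix.mul_one]

theorem sigMat_one (hY : Y 0 = 1) : sigMat Y 1 = 1 := by
  ext1 i j
  rw [sigMat, Matrix.of_apply, tsum_eq_single 0 (fun k hk => by simp [hk])]
  simp [hY]

variable [CharZero K]

theorem IsHorizontal.isSolution_sigMat {R : ℝ} (hR : R ≤ X.rX) (hY : IsHorizontal Y)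
    (hc : ConvergesOn R Y) {q : X.Q} (hq : q ∈ X.disk R) : IsSolution R q (sigMat Y q) Y := by
  refine isSolution_iff.2 fun x y h => ?_
  -- Geometric bounds exist only at radii below R, so a ρ < R is chosen for which both steps y → x →
  -- qx stay within distance ρ.
  obtain ⟨ρ, h1, h2⟩ := exists_between (max_lt h (mem_disk_iff.1 hq))
  have h3 : q ∈ X.disk ρ := mem_disk_iff.2 ((le_max_right _ _).trans_lt h1)
  have hb := mbdd_of_convergesOn hc (pos_of_mem_disk h3).le h2
  rw [matAt_sigMat hb h3]
  exact (hY.solEval_mul_solEval hb (h2.le.trans hR) (norm_mulPt_sub_lt h3 x)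
    ((le_max_left _ _).trans_lt h1)).symm

/-- The cocycle relation for the points x, qx and q'qx. -/
theorem IsHorizontal.sigMat_mul {r : ℝ} (hr : r ≤ X.rX) (hY : IsHorizontal Y)
    (hc : ConvergesOn r Y) {q q' : X.Q} (hq : q ∈ X.disk r) (hq' : q' ∈ X.disk r) :
    sigMat Y (q * q') = (sigMat Y q').map (X.sigma q) * sigMat Y q := by
  obtain ⟨ρ, h1, h2⟩ := exists_between (max_lt (mem_disk_iff.1 hq) (mem_disk_iff.1 hq'))
  have h3 : q ∈ X.disk ρ := mem_disk_iff.2 ((le_max_left _ _).trans_lt h1)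
  have h4 : q' ∈ X.disk ρ := mem_disk_iff.2 ((le_max_right _ _).trans_lt h1)
  have hb := mbdd_of_convergesOn hc (pos_of_mem_disk h3).le h2
  refine mat_ext fun x => ?_
  rw [matAt_mul, matAt_map_sigma, matAt_sigMat hb (mul_mem_disk (h2.le.trans hr) h3 h4),
    matAt_sigMat hb h3, matAt_sigMat hb h4, mul_comm q q', mulPt_mul,
    hY.solEval_mul_solEval hb (h2.le.trans hr) (norm_mulPt_sub_lt h4 _) (norm_mulPt_sub_lt h3 _)]

end Affinoid

section Action

variable {V : Type*} [AddCommGroup V] [Module K V] [Module X.H V] [IsScalarTower K X.H V] {n : ℕ}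
  (b : Module.Basis (Fin n) X.H V) {Y : ℕ → Matrix (Fin n) (Fin n) X.H} [CharZero K]

/-- The action of the disk `D⁻(1, r / s_X)` defined by a horizontal sequence. -/
noncomputable def diskAction {r : ℝ} (hr : r ≤ X.rX) (h0 : 0 < r) (hY : IsHorizontal Y)
    (hc : ConvergesOn r Y) : X.diskSubgroup r hr h0 →* Module.End K V where
  toFun q := sigmaOf b (q : X.Q) (sigMat Y q)
  map_one' := by
    ext v
    apply b.equivFun.injective
    rw [equivFun_sigmaOf, Subgroup.coe_one, sigMat_one hY.1, Matrix.vecMul_one]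
    ext1 i
    refine H_ext fun x => ?_
    rw [sigma_apply, mulPt_one]
    rfl
  map_mul' q q' := by
    ext v
    apply b.equivFun.injective
    rw [Module.End.mul_apply, equivFun_sigmaOf, equivFun_sigmaOf, equivFun_sigmaOf,
      Subgroup.coe_mul, hY.sigMat_mul hr hc q.2 q'.2, ← Matrix.vecMul_vecMul]
    congr 1
    ext1 j
    simp only [Matrix.vecMul, dotProduct, map_sum, map_mul, Matrix.map_apply]
    refine Finset.sum_congr rfl fun i _ => ?_
    congr 1
    refine H_ext fun x => ?_
    rw [sigma_apply, sigma_apply, sigma_apply, mul_comm (q : X.Q), mulPt_mul]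

end Action

end QDiff

namespace QDiff

variable {K : Type u} [NontriviallyNormedField K] [IsUltrametricDist K] [CompleteSpace K]
  {X : Affinoid K}

open Affinoid

/-! ### Taylor coefficients of a differential equation as horizontal sequences. -/

section Taylor

variable {n : ℕ} {Y F : ℕ → Matrix (Fin n) (Fin n) X.H} {G : Matrix (Fin n) (Fin n) X.H}

theorem map_delta_one : (1 : Matrix (Fin n) (Fin n) X.H).map X.delta = 0 := by
  ext1 i j
  rw [Matrix.map_apply, Matrix.one_apply]
  split_ifs
  · exact delta_one
  · exact delta_zero

theorem map_delta_eq {m n : Type*} (A : Matrix m n X.H) :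
    A.map X.delta = X.T • A.map X.D := rfl

theorem eq_of_T_smul_eq {m n : Type*} {A B : Matrix m n X.H} (h : X.T • A = X.T • B) :
    A = B := by
  ext1 i j
  exact eq_of_T_mul_eq (congrFun (congrFun h i) j)

/-- The origin may lie in X, where δ₁ degenerates; the existence of a matrix for d/dT already forces
divisibility by T. -/
theorem IsDerivMatrices.eq_T_smul (h : IsDerivMatrices G F) : G = X.T • taylorCoeff F 1 := by
  have h1 := h.2 0
  rw [h.1, map_delta_one, Matrix.one_mul] at h1
  rw [← zero_add G, ← h1, taylorCoeff]
  simp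

theorem isDerivMatrices_of_isHorizontal (h : IsHorizontal Y) :
    IsDerivMatrices (X.T • Y 1) (fun k => (k.factorial : K) • Y k) := by
  refine ⟨by simp [h.1], fun k => ?_⟩
  have e : ((k + 1).factorial : K) = (k.factorial : K) * ((k : K) + 1) := by
    rw [Nat.factorial_succ]; push_cast; ring
  change X.T • (((k + 1).factorial : K) • Y (k + 1)) =
    ((k.factorial : K) • Y k).map X.delta + ((k.factorial : K) • Y k) * (X.T • Y 1)
  rw [e, mul_smul, h.2, smul_comm X.T, smul_add, smul_add, ← map_delta_eq, Matrix.smul_mul,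
    Matrix.mul_smul]
  congr 1
  ext1 i j
  exact (map_smul X.deltaL _ _).symm

variable [CharZero K]

theorem succ_smul_taylorCoeff (F : ℕ → Matrix (Fin n) (Fin n) X.H) (k : ℕ) :
    ((k : K) + 1) • taylorCoeff F (k + 1) = ((k.factorial : K)⁻¹) • F (k + 1) := by
  have h1 : (k.factorial : K) ≠ 0 := by exact_mod_cast k.factorial_ne_zero
  have h2 : (k : K) + 1 ≠ 0 := Nat.cast_add_one_ne_zero k
  rw [taylorCoeff, smul_smul, Nat.factorial_succ]
  congr 1
  push_cast
  field_simp

theorem IsDerivMatrices.isHorizontal (h : IsDerivMatrices G F) : IsHorizontal (taylorCoeff F) := by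
  refine ⟨by rw [taylorCoeff, h.1]; simp, fun k => eq_of_T_smul_eq ?_⟩
  have hG := h.eq_T_smul
  rw [succ_smul_taylorCoeff, smul_comm X.T, h.2, smul_add, smul_add, ← map_delta_eq,
    ← Matrix.mul_smul (taylorCoeff F k), ← hG, taylorCoeff, Matrix.smul_mul]
  congr 1
  ext1 i j
  exact (map_smul X.deltaL _ _).symm

theorem taylorCoeff_factorial_smul (Y : ℕ → Matrix (Fin n) (Fin n) X.H) :
    taylorCoeff (fun k => (k.factorial : K) • Y k) = Y := by
  funext k
  have h1 : (k.factorial : K) ≠ 0 := by exact_mod_cast k.factorial_ne_zero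
  rw [taylorCoeff, inv_smul_smul₀ h1]

end Taylor

/-! ### Transfer of structure and morphisms between σ_q and δ₁. -/

section Transfer

variable {S : Set X.Q} {r : ℝ}

theorem IsSolution.mono {n : ℕ} {A : Matrix (Fin n) (Fin n) X.H}
    {Y : ℕ → Matrix (Fin n) (Fin n) X.H} {R R' : ℝ} {q : X.Q} (h : IsSolution R q A Y)
    (hR : R' ≤ R) : IsSolution R' q A Y := fun x y hxy => h x y (hxy.trans_le hR)

theorem matδ_eq (M : SigmaDeltaMod X S) {n : ℕ}
    (b : Module.Basis (Fin n) X.H M.carrier) : M.matδ b = opMat b M.δ := rfl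

theorem admσδ_mono {r' : ℝ} (hS : S ⊆ X.disk r') (h : r' ≤ r) {M : SigmaDeltaMod X S}
    (hM : admσδ X S r M) : admσδ X S r' M := by
  obtain ⟨-, n, b, R, Y, h1, h2⟩ := hM
  exact ⟨hS, n, b, R, Y, h.trans h1, h2⟩

theorem comm_op_iff {M N : SigmaMod X S} (f : M.carrier →ₗ[X.H] N.carrier) (q : X.Q)
    (hq : q ∈ S) {n n' : ℕ} (b : Module.Basis (Fin n) X.H M.carrier)
    (b' : Module.Basis (Fin n') X.H N.carrier) :
    (∀ m, f (M.op q hq m) = N.op q hq (f m)) ↔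
      M.matσ q hq b * linMat b b' f = (linMat b b' f).map (X.sigma q) * N.matσ q hq b' :=
  comm_sigma_iff b b' (φ := (M.op q hq).toLinearMap.toAddMonoidHom)
    (ψ := (N.op q hq).toLinearMap.toAddMonoidHom) (X.sigma q).toRingHom (M.σ_smul q hq)
    (N.σ_smul q hq) f

theorem comm_conn_iff {M N : SigmaDeltaMod X S} (f : M.carrier →ₗ[X.H] N.carrier)
    {n n' : ℕ} (b : Module.Basis (Fin n) X.H M.carrier)
    (b' : Module.Basis (Fin n') X.H N.carrier) :
    (∀ m, f (M.δ m) = N.δ (f m)) ↔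
      M.matδ b * linMat b b' f = (linMat b b' f).map X.delta + linMat b b' f * N.matδ b' :=
  comm_delta_iff b b' (φ := M.δ.toAddMonoidHom) (ψ := N.δ.toAddMonoidHom) M.leibniz N.leibniz f

theorem closure_le_diskSubgroup (hr : r ≤ X.rX) (h0 : 0 < r) (hS : S ⊆ X.disk r) :
    Subgroup.closure S ≤ X.diskSubgroup r hr h0 := (Subgroup.closure_le _).2 hS

theorem ConvergesOn.mono {n : ℕ} {R R' : ℝ} {Y : ℕ → Matrix (Fin n) (Fin n) X.H}
    (h : ConvergesOn R Y) (hR : R' ≤ R) : ConvergesOn R' Y :=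
  fun ρ h0 hρ => h ρ h0 (hρ.trans_le hR)

variable [CharZero K] {p : ℕ}

/-- A linear map commuting with `σ_q`, for some `q` which is not a root of unity, is horizontal. -/
theorem comm_conn_of_comm_op (hp0 : p ≠ 0) (hp : ‖(p : K)‖ < 1) (hr : r ≤ X.rX)
    {M N : SigmaDeltaMod X S} (hM : admσδ X S r M) (hN : admσδ X S r N) {q : X.Q} (hq : q ∈ S)
    (hfin : ¬ IsOfFinOrder q) (f : M.carrier →ₗ[X.H] N.carrier)
    (hf : ∀ m, f (M.op q hq m) = N.op q hq (f m)) (m : M.carrier) : f (M.δ m) = N.δ (f m) := by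
  obtain ⟨hS, n, b, R, F, hR, hRX, hF, hc, hs⟩ := hM
  obtain ⟨-, n', b', R', F', hR', hRX', hF', hc', hs'⟩ := hN
  -- The strict inequality |q - 1| s_X < r leaves room for a radius ρ < r at which the coefficients
  -- are bounded while q still belongs to the disk.
  obtain ⟨ρ, h1, h2⟩ := exists_between (mem_disk_iff.1 (hS hq))
  have hqρ : q ∈ X.disk ρ := mem_disk_iff.2 h1
  have hρ0 := (pos_of_mem_disk hqρ).le
  refine (comm_conn_iff f b b').2 ?_ m
  have key := mul_eq_of_sigma hp0 hp (h2.le.trans hr) hqρ hfin hF.isHorizontal.1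
    hF'.isHorizontal.1 (mbdd_of_convergesOn hc hρ0 (h2.trans_le hR))
    (mbdd_of_convergesOn hc' hρ0 (h2.trans_le hR')) ((hs q hq).mono (h2.le.trans hR))
    ((hs' q hq).mono (h2.le.trans hR')) ((comm_op_iff f q hq b b').1 hf)
  rw [hF.eq_T_smul, hF'.eq_T_smul, Matrix.smul_mul, key, map_delta_eq, Matrix.mul_smul, smul_add]

/-- A horizontal linear map commutes with `σ_q`. -/
theorem comm_op_of_comm_conn (hr : r ≤ X.rX)
    {M N : SigmaDeltaMod X S} (hM : admσδ X S r M) (hN : admσδ X S r N) {q : X.Q} (hq : q ∈ S)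
    (f : M.carrier →ₗ[X.H] N.carrier)
    (hf : ∀ m, f (M.δ m) = N.δ (f m)) (m : M.carrier) :
    f (M.op q hq m) = N.op q hq (f m) := by
  obtain ⟨hS, n, b, R, F, hR, hRX, hF, hc, hs⟩ := hM
  obtain ⟨-, n', b', R', F', hR', hRX', hF', hc', hs'⟩ := hN
  obtain ⟨ρ, h1, h2⟩ := exists_between (mem_disk_iff.1 (hS hq))
  have hqρ : q ∈ X.disk ρ := mem_disk_iff.2 h1
  have hρ0 := (pos_of_mem_disk hqρ).le
  have hb := mbdd_of_convergesOn hc hρ0 (h2.trans_le hR)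
  have hb' := mbdd_of_convergesOn hc' hρ0 (h2.trans_le hR')
  refine (comm_op_iff f q hq b b').2 ?_ m
  have h3 := (comm_conn_iff f b b').1 hf
  rw [hF.eq_T_smul, hF'.eq_T_smul, Matrix.smul_mul, map_delta_eq, Matrix.mul_smul,
    ← smul_add] at h3
  rw [eq_sigMat_of_isSolution hb hqρ hF.isHorizontal.1 ((hs q hq).mono (h2.le.trans hR)),
    eq_sigMat_of_isSolution hb' hqρ hF'.isHorizontal.1 ((hs' q hq).mono (h2.le.trans hR'))]
  refine mat_ext fun x => ?_
  rw [matAt_mul, matAt_mul, matAt_sigMat hb hqρ, matAt_sigMat hb' hqρ, matAt_map_sigma]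
  exact hF.isHorizontal.solEval_mul_matAt hF'.isHorizontal hb hb' (h2.le.trans hr)
    (eq_of_T_smul_eq h3) (norm_mulPt_sub_lt hqρ x)

/-- An admissible `σ`-module has a connection. -/
theorem exists_conn (hp0 : p ≠ 0) (hp : ‖(p : K)‖ < 1) (hr : r ≤ X.rX) {q : X.Q} (hq : q ∈ S)
    (hfin : ¬ IsOfFinOrder q) (M : SigmaMod X S) (hM : admσ X S r M) :
    ∃ N : SigmaDeltaMod X S, N.toSigmaMod = M ∧ admσδ X S r N := by
  obtain ⟨hS, n, b, R, Y, hR, hRX, h0, hc, hs⟩ := hM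
  obtain ⟨ρ, h1, h2⟩ := exists_between (mem_disk_iff.1 (hS hq))
  have hqρ : q ∈ X.disk ρ := mem_disk_iff.2 h1
  have hρ0 := (pos_of_mem_disk hqρ).le
  have hY : IsHorizontal Y := isHorizontal_of_isSolution hp0 hp (h2.le.trans hr) hqρ hfin h0
    (mbdd_of_convergesOn hc hρ0 (h2.trans_le hR)) ((hs q hq).mono (h2.le.trans hR))
  refine ⟨{ toSigmaMod := M, δ := connOf b (X.T • Y 1), leibniz := connOf_smul b _ }, rfl, hS, n, b,
    R, fun k => (k.factorial : K) • Y k, hR, hRX, ?_, ?_, ?_⟩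
  · rw [matδ_eq]
    change IsDerivMatrices (opMat b (connOf b (X.T • Y 1))) _
    rw [opMat_connOf]
    exact isDerivMatrices_of_isHorizontal hY
  · rwa [taylorCoeff_factorial_smul]
  · rw [taylorCoeff_factorial_smul]
    exact hs

/-- The `(σ, δ)`-module over `S` defined by a horizontal sequence. -/
noncomputable def ofHorizontal (V : Type u) [AddCommGroup V] [Module K V] [Module X.H V]
    [IsScalarTower K X.H V] {n : ℕ} (b : Module.Basis (Fin n) X.H V) (hr : r ≤ X.rX) (h0 : 0 < r)
    (hS : S ⊆ X.disk r) {Y : ℕ → Matrix (Fin n) (Fin n) X.H} (hY : IsHorizontal Y)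
    (hc : ConvergesOn r Y) : SigmaDeltaMod X S where
  carrier := V
  free := Module.Free.of_basis b
  finite := Module.Finite.of_basis b
  -- The disk is a group, so a monoid morphism into endomorphisms automatically takes invertible
  -- values.
  σ := ((LinearMap.GeneralLinearGroup.generalLinearEquiv K V).toMonoidHom.comp
    (diskAction b hr h0 hY hc).toHomUnits).comp
      (Subgroup.inclusion (closure_le_diskSubgroup hr h0 hS))
  σ_smul q _ f m := sigmaOf_smul b q (sigMat Y q) f m
  δ := connOf b (X.T • Y 1)
  leibniz := connOf_smul b _

/-- An admissible `(σ, δ)`-module over `S` extends to any `S'` contained in the disk. -/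
theorem exists_extension (hr : r ≤ X.rX) {S' : Set X.Q} (h : S ⊆ S') (hS' : S' ⊆ X.disk r)
    (hne : S.Nonempty) (M : SigmaDeltaMod X S) (hM : admσδ X S r M) :
    ∃ N : SigmaDeltaMod X S', admσδ X S' r N ∧ ∃ φ : N.carrier ≃ₗ[X.H] M.carrier,
      (∀ m, φ (N.δ m) = M.δ (φ m)) ∧
      ∀ q (hq : q ∈ S) m, φ (N.op q (h hq) m) = M.op q hq (φ m) := by
  obtain ⟨hS, n, b, R, F, hR, hRX, hF, hc, hs⟩ := hM
  have h0 : 0 < r := pos_of_mem_disk (hS hne.some_mem)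
  have hY := hF.isHorizontal
  -- The module and the connection are kept; the operators are rebuilt from the Taylor solution.
  -- They agree with the original σ_q for q ∈ S because the solution determines A(q, x).
  let N := ofHorizontal M.carrier b hr h0 hS' hY (hc.mono hR)
  have hNδ : N.matδ b = M.matδ b := by
    rw [matδ_eq]
    change opMat b (connOf b (X.T • taylorCoeff F 1)) = M.matδ b
    rw [opMat_connOf]
    exact hF.eq_T_smul.symm
  have hNσ : ∀ q hq, N.matσ q hq b = sigMat (taylorCoeff F) q := fun q hq =>
    opMat_sigmaOf b q _
  refine ⟨N, ⟨hS', n, b, r, F, le_rfl, hr, ?_, hc.mono hR, fun q hq => ?_⟩,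
    LinearEquiv.refl X.H M.carrier, ?_, ?_⟩
  · rwa [hNδ]
  · rw [hNσ]
    exact hY.isSolution_sigMat hr (hc.mono hR) (hS' hq)
  · refine (comm_delta_iff b b (φ := N.δ.toAddMonoidHom) (ψ := M.δ.toAddMonoidHom)
      N.leibniz M.leibniz LinearMap.id).2 ?_
    rw [linMat_id, map_delta_one, zero_add, Matrix.one_mul, Matrix.mul_one]
    exact hNδ
  · intro q hq
    obtain ⟨ρ, h1, h2⟩ := exists_between (mem_disk_iff.1 (hS hq))
    have hqρ : q ∈ X.disk ρ := mem_disk_iff.2 h1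
    have hρ0 := (pos_of_mem_disk hqρ).le
    have hb := mbdd_of_convergesOn hc hρ0 (h2.trans_le hR)
    refine (comm_sigma_iff b b (φ := (N.op q (h hq)).toLinearMap.toAddMonoidHom)
      (ψ := (M.op q hq).toLinearMap.toAddMonoidHom) (X.sigma q).toRingHom (N.σ_smul q (h hq))
      (M.σ_smul q hq) LinearMap.id).2 ?_
    have e : (1 : Matrix (Fin n) (Fin n) X.H).map (X.sigma q).toRingHom = 1 :=
      Matrix.map_one _ (map_zero _) (map_one _)
    rw [linMat_id, e, Matrix.one_mul, Matrix.mul_one]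
    exact (hNσ q (h hq)).trans (eq_sigMat_of_isSolution hb hqρ hY.1
      ((hs q hq).mono (h2.le.trans hR))).symm

end Transfer

end QDiff

namespace QDiff

/-! ### Change of basis -/

section Basis

variable {K : Type u} [NontriviallyNormedField K] [IsUltrametricDist K] [CompleteSpace K]
  {X : Affinoid K}

open Affinoid

/-- The sequence `w k = ∇ ^ k (U) / k!` where `∇ (U) = U' + U * G`. -/
noncomputable def covSeq {m n : Type*} [Fintype n] (U : Matrix m n X.H) (G : Matrix n n X.H) :
    ℕ → Matrix m n X.H
  | 0 => U
  | k + 1 => ((k : K) + 1)⁻¹ • ((covSeq U G k).map X.D + covSeq U G k * G)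

variable [CharZero K] {n n' : ℕ} {Y : ℕ → Matrix (Fin n) (Fin n) X.H}
  {U : Matrix (Fin n') (Fin n) X.H} {V : Matrix (Fin n) (Fin n') X.H} {S : Set X.Q} {r : ℝ}

theorem succ_smul_covSeq {m n : Type*} [Fintype n] (U : Matrix m n X.H) (G : Matrix n n X.H)
    (k : ℕ) : ((k : K) + 1) • covSeq U G (k + 1) = (covSeq U G k).map X.D + covSeq U G k * G := by
  rw [covSeq, smul_inv_smul₀ (Nat.cast_add_one_ne_zero k)]

theorem covSeq_eq_mulSeq (hY : IsHorizontal Y) (U : Matrix (Fin n') (Fin n) X.H) (k : ℕ) :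
    covSeq U (Y 1) k = mulSeq (fun k => U.map (hs X.D k)) Y k :=
  eq_mulSeq_hs U hY.2 (succ_smul_covSeq U (Y 1)) (by rw [hY.1, Matrix.mul_one, covSeq]) k

theorem covSeq_one (U : Matrix (Fin n') (Fin n) X.H) (G : Matrix (Fin n) (Fin n) X.H) :
    covSeq U G 1 = U.map X.D + U * G := by
  simp [covSeq]

/-- Here U and V are the change of basis matrices, and the sequence represents U(x) Y(x, y) V(y),
the normalized solution in the new basis; hV says that V is horizontal. -/
theorem isHorizontal_covSeq (hUV : U * V = 1)
    (hV : Y 1 * V = V.map X.D + V * (covSeq U (Y 1) 1 * V)) :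
    IsHorizontal fun k => covSeq U (Y 1) k * V := by
  refine ⟨hUV, fun k => ?_⟩
  rw [← Matrix.smul_mul, succ_smul_covSeq, map_D_mul, Matrix.add_mul, Matrix.mul_assoc, hV,
    Matrix.mul_add, Matrix.mul_assoc, add_assoc]

theorem solEval_covSeq {ρ : ℝ} (hρ : ρ ≤ X.rX) (hY : IsHorizontal Y) (hb : MBdd ρ Y)
    (U : Matrix (Fin n') (Fin n) X.H) (V : Matrix (Fin n) (Fin n') X.H) {x y : X.Pt}
    (h : ‖(x : CC K) - y‖ < ρ) :
    solEval (fun k => covSeq U (Y 1) k * V) x y = matAt x U * solEval Y x y * matAt y V := by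
  have hρ0 : 0 ≤ ρ := (norm_nonneg _).trans h.le
  have h1 := mbdd_matAt hρ0 ((mbdd_hs U).mono hρ0 hρ) y
  have h2 := mbdd_matAt hρ0 hb y
  rw [matAt_eq_mev U (h.trans_le hρ), solEval, solEval, ← mev_mulSeq h1 h2 h,
    ← mev_mul_const (h1.mulSeq hρ0 h2) _ h]
  congr 1
  funext k
  rw [matAt_mul, covSeq_eq_mulSeq hY]
  congr 1
  exact map_mulSeq (evalAt y : X.H →ₐ[K] CC K).toRingHom _ _ k

theorem convergesOn_covSeq {R : ℝ} (hR : R ≤ X.rX) (hY : IsHorizontal Y) (hc : ConvergesOn R Y)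
    (U : Matrix (Fin n') (Fin n) X.H) (V : Matrix (Fin n) (Fin n') X.H) :
    ConvergesOn R fun k => covSeq U (Y 1) k * V := by
  refine MBdd.convergesOn fun ρ h0 hρ => MBdd.mul_const h0.le ?_ V
  rw [funext (covSeq_eq_mulSeq hY U)]
  exact ((mbdd_hs U).mono h0.le (hρ.le.trans hR)).mulSeq h0.le (mbdd_of_convergesOn hc h0.le hρ)

/-- The condition defining admissible modules holds in every basis. -/
theorem exists_isDerivMatrices (hr : r ≤ X.rX) {M : SigmaDeltaMod X S} (hM : admσδ X S r M)
    (b' : Module.Basis (Fin n') X.H M.carrier) :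
    ∃ F : ℕ → Matrix (Fin n') (Fin n') X.H, IsDerivMatrices (M.matδ b') F ∧
      ConvergesOn r (taylorCoeff F) ∧
      ∀ q (hq : q ∈ S), IsSolution r q (M.matσ q hq b') (taylorCoeff F) := by
  obtain ⟨hS, n, b, R, F, hR, hRX, hF, hc, hs⟩ := hM
  have hY := hF.isHorizontal
  generalize hYF : taylorCoeff F = Y at *
  have hc' : ConvergesOn r Y := hc.mono hR
  have hUV : linMat b' b LinearMap.id * linMat b b' LinearMap.id = 1 := by
    rw [linMat_mul_linMat, LinearMap.id_comp, linMat_id]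
  have h1 : M.matδ b' * linMat b' b LinearMap.id =
      (linMat b' b LinearMap.id).map X.delta + linMat b' b LinearMap.id * M.matδ b :=
    (comm_conn_iff (M := M) (N := M) LinearMap.id b' b).1 fun _ => rfl
  have h2 : M.matδ b * linMat b b' LinearMap.id =
      (linMat b b' LinearMap.id).map X.delta + linMat b b' LinearMap.id * M.matδ b' :=
    (comm_conn_iff (M := M) (N := M) LinearMap.id b b').1 fun _ => rfl
  have h0 : M.matδ b = X.T • Y 1 := hYF ▸ hF.eq_T_smul
  have h7 := fun q (hq : q ∈ S) =>
    (comm_op_iff (M := M.toSigmaMod) (N := M.toSigmaMod) LinearMap.id q hq b' b).1 fun _ => rfl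
  generalize linMat b' b LinearMap.id = U at *
  generalize linMat b b' LinearMap.id = V at *
  have hG : M.matδ b' = X.T • (covSeq U (Y 1) 1 * V) := by
    rw [covSeq_one, ← Matrix.smul_mul, smul_add, ← map_delta_eq, ← Matrix.mul_smul,
      ← h0, ← h1, Matrix.mul_assoc, hUV, Matrix.mul_one]
  have hV : Y 1 * V = V.map X.D + V * (covSeq U (Y 1) 1 * V) := by
    have h3 : X.T • (Y 1 * V) = M.matδ b * V := by rw [← Matrix.smul_mul, ← h0]
    have h4 : V * M.matδ b' = X.T • (V * (covSeq U (Y 1) 1 * V)) := by rw [hG, Matrix.mul_smul]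
    exact eq_of_T_smul_eq (by rw [h3, h2, h4, smul_add, map_delta_eq])
  have hY' := isHorizontal_covSeq hUV hV
  have hcY' := convergesOn_covSeq hr hY hc' U V
  have hsol := fun ρ (hρ : ρ ≤ X.rX) (hb : MBdd ρ Y) (x y : X.Pt) =>
    solEval_covSeq hρ hY hb U V (x := x) (y := y)
  obtain ⟨Y', hdef⟩ : ∃ Y' : ℕ → Matrix (Fin n') (Fin n') X.H,
    Y' = fun k => covSeq U (Y 1) k * V := ⟨_, rfl⟩
  have hG' : M.matδ b' = X.T • Y' 1 := by rw [hG, hdef]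
  rw [← hdef] at hY' hcY'
  simp only [← hdef] at hsol
  refine ⟨fun k => (k.factorial : K) • Y' k, ?_, ?_, fun q hq => ?_⟩
  · rw [hG']
    exact isDerivMatrices_of_isHorizontal hY'
  · rwa [taylorCoeff_factorial_smul]
  · rw [taylorCoeff_factorial_smul]
    refine isSolution_iff.2 fun x y h => ?_
    obtain ⟨ρ, h3, h4⟩ := exists_between (max_lt h (mem_disk_iff.1 (hS hq)))
    have hqρ : q ∈ X.disk ρ := mem_disk_iff.2 ((le_max_right _ _).trans_lt h3)
    have hxy := (le_max_left _ _).trans_lt h3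
    have hb := mbdd_of_convergesOn hc' (pos_of_mem_disk hqρ).le h4
    have h5 : ‖(X.mulPt q x : CC K) - y‖ < ρ := by
      rw [← sub_add_sub_cancel _ (x : CC K)]
      exact (IsUltrametricDist.norm_add_le_max _ _).trans_lt
        (max_lt (norm_mulPt_sub_lt hqρ x) hxy)
    have h6 := congrArg (matAt x) (h7 q hq)
    rw [matAt_mul, matAt_mul, matAt_map_sigma] at h6
    rw [hsol ρ (h4.le.trans hr) hb _ _ h5, hsol ρ (h4.le.trans hr) hb _ _ hxy,
      ← Matrix.mul_assoc, ← Matrix.mul_assoc, h6,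
      isSolution_iff.1 ((hs q hq).mono (h4.le.trans hR)) x y hxy]
    simp only [Matrix.mul_assoc]

end Basis

end QDiff

namespace QDiff

/-! ### `q`-Taylor expansions -/

section QCoeff

variable {F : Type*} [Field F]

/-- The coefficients of the expansion `(x - y) ^ k = ∑ n, qCoeff q (k - n) n * y ^ (k - n) *
(x - y)_{q, n}`. -/
def qCoeff (q : F) : ℕ → ℕ → F
  | 0, _ => 1
  | _ + 1, 0 => 0
  | j + 1, n + 1 => qCoeff q (j + 1) n + (q ^ (n + 1) - 1) * qCoeff q j (n + 1)

theorem qCoeff_zero_left (q : F) (n : ℕ) : qCoeff q 0 n = 1 := by rw [qCoeff]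

theorem qCoeff_succ_zero (q : F) (j : ℕ) : qCoeff q (j + 1) 0 = 0 := by rw [qCoeff]

theorem qCoeff_succ_succ (q : F) (j n : ℕ) : qCoeff q (j + 1) (n + 1) =
    qCoeff q (j + 1) n + (q ^ (n + 1) - 1) * qCoeff q j (n + 1) := by rw [qCoeff]

theorem map_qCoeff {F' : Type*} [Field F'] (f : F →+* F') (q : F) (j n : ℕ) :
    f (qCoeff q j n) = qCoeff (f q) j n := by
  induction j generalizing n with
  | zero => rw [qCoeff_zero_left, qCoeff_zero_left, map_one]
  | succ j ih =>
    induction n with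
    | zero => rw [qCoeff_succ_zero, qCoeff_succ_zero, map_zero]
    | succ n ih' => rw [qCoeff_succ_succ, qCoeff_succ_succ, map_add, map_mul, ih, ih', map_sub,
        map_pow, map_one]

/-- Induction on n, then on l. Pascal's rule (`e1`) contributes q - 1 and the recursion of `qCoeff`
(`e2`) contributes (q^(n+1) - 1) q; their sum is q^(n+2) - 1, the factor in the recursion of the
right-hand side. -/
theorem sum_choose_mul_qCoeff (q : F) (l n : ℕ) :
    ∑ p ∈ Finset.HasAntidiagonal.antidiagonal l,
      ((n + l).choose p.1 : F) * (q - 1) ^ p.1 * (q ^ p.2 * qCoeff q p.2 n) =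
        qCoeff q l (n + 1) := by
  induction n generalizing l with
  | zero =>
    have h1 : qCoeff q l 1 = (q - 1) ^ l := by
      induction l with
      | zero => rw [qCoeff_zero_left, pow_zero]
      | succ l ih => rw [qCoeff_succ_succ, qCoeff_succ_zero, ih]; ring
    rw [zero_add, h1]
    rcases l with _ | l
    · simp [qCoeff_zero_left]
    · rw [Finset.Nat.sum_antidiagonal_succ']
      simp [qCoeff_succ_zero, qCoeff_zero_left]
  | succ n ih =>
    induction l with
    | zero => simp [qCoeff_zero_left]
    | succ l ih' =>
      rw [qCoeff_succ_succ, ← ih, ← ih']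
      have e1 : ∀ N : ℕ, ∑ p ∈ Finset.HasAntidiagonal.antidiagonal (l + 1),
          ((N + 1).choose p.1 : F) * (q - 1) ^ p.1 * (q ^ p.2 * qCoeff q p.2 (n + 1)) =
          ∑ p ∈ Finset.HasAntidiagonal.antidiagonal (l + 1),
            (N.choose p.1 : F) * (q - 1) ^ p.1 * (q ^ p.2 * qCoeff q p.2 (n + 1)) +
          (q - 1) * ∑ p ∈ Finset.HasAntidiagonal.antidiagonal l,
            (N.choose p.1 : F) * (q - 1) ^ p.1 * (q ^ p.2 * qCoeff q p.2 (n + 1)) := by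
        intro N
        rw [Finset.Nat.sum_antidiagonal_succ, Finset.Nat.sum_antidiagonal_succ, add_assoc,
          Finset.mul_sum, ← Finset.sum_add_distrib]
        congr 1
        · simp
        · refine Finset.sum_congr rfl fun p _ => ?_
          rw [Nat.choose_succ_succ]
          push_cast
          ring
      have e2 : ∀ N : ℕ, ∑ p ∈ Finset.HasAntidiagonal.antidiagonal (l + 1),
            (N.choose p.1 : F) * (q - 1) ^ p.1 * (q ^ p.2 * qCoeff q p.2 (n + 1)) =
          ∑ p ∈ Finset.HasAntidiagonal.antidiagonal (l + 1),
            (N.choose p.1 : F) * (q - 1) ^ p.1 * (q ^ p.2 * qCoeff q p.2 n) +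
          (q ^ (n + 1) - 1) * q * ∑ p ∈ Finset.HasAntidiagonal.antidiagonal l,
            (N.choose p.1 : F) * (q - 1) ^ p.1 * (q ^ p.2 * qCoeff q p.2 (n + 1)) := by
        intro N
        rw [Finset.Nat.sum_antidiagonal_succ', Finset.Nat.sum_antidiagonal_succ', add_assoc,
          Finset.mul_sum, ← Finset.sum_add_distrib]
        congr 1
        · simp [qCoeff_zero_left]
        · refine Finset.sum_congr rfl fun p _ => ?_
          rw [qCoeff_succ_succ]
          ring
      rw [show n + 1 + (l + 1) = (n + (l + 1)) + 1 by ring, e1, e2,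
        show n + 1 + l = n + (l + 1) by ring]
      ring

/-- Each increase of j brings in a factor q^i - 1, of norm at most |q - 1|. This decay makes all the
rearrangements converge when |q - 1| s_X is below the radius. -/
theorem norm_qCoeff_le {F : Type*} [NormedField F] [IsUltrametricDist F] {q : F} (hq : ‖q - 1‖ < 1)
    (j n : ℕ) : ‖qCoeff q j n‖ ≤ ‖q - 1‖ ^ j := by
  induction j generalizing n with
  | zero => rw [qCoeff_zero_left, pow_zero, norm_one]
  | succ j ih =>
    induction n with
    | zero => rw [qCoeff_succ_zero, norm_zero]; positivity
    | succ n ih' =>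
      rw [qCoeff_succ_succ]
      refine (IsUltrametricDist.norm_add_le_max _ _).trans (max_le ih' ?_)
      rw [norm_mul, pow_succ' ‖q - 1‖]
      exact mul_le_mul (norm_pow_sub_one_le hq _) (ih _) (norm_nonneg _) (norm_nonneg _)

end QCoeff

section QPow

variable {K : Type u} [NontriviallyNormedField K] [IsUltrametricDist K] [CompleteSpace K]

theorem qPow_succ (q : K) (x y : CC K) (n : ℕ) :
    qPow q x y (n + 1) = qPow q x y n * (x - algebraMap K (CC K) q ^ n * y) := by
  rw [qPow, Finset.prod_range_succ, map_pow, qPow]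

theorem norm_qPow_le {q : K} (hq : ‖q - 1‖ < 1) {x y : CC K} {w : ℝ} (h : ‖x - y‖ ≤ w)
    (h' : ‖q - 1‖ * ‖y‖ ≤ w) (n : ℕ) : ‖qPow q x y n‖ ≤ w ^ n := by
  induction n with
  | zero => simp [qPow]
  | succ n ih =>
    rw [qPow_succ, norm_mul, pow_succ]
    refine mul_le_mul ih ?_ (norm_nonneg _) (pow_nonneg ((norm_nonneg _).trans h) _)
    have e : x - algebraMap K (CC K) q ^ n * y = (x - y) + -algebraMap K (CC K) (q ^ n - 1) * y := by
      rw [map_sub, map_pow, map_one]; ring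
    rw [e]
    refine (IsUltrametricDist.norm_add_le_max _ _).trans (max_le h (le_trans ?_ h'))
    rw [norm_mul, norm_neg, norm_algebraMap']
    exact mul_le_mul_of_nonneg_right (norm_pow_sub_one_le hq n) (norm_nonneg _)

/-- Multiply (x - y)_{q,n} by x - y = (x - q^n y) + (q^n - 1) y: the two terms raise n and the power
of y respectively, which is the recursion of `qCoeff`. -/
theorem sub_pow_eq_sum_qPow (q : K) (x y : CC K) (k : ℕ) :
    (x - y) ^ k = ∑ p ∈ Finset.HasAntidiagonal.antidiagonal k,
      qCoeff (algebraMap K (CC K) q) p.2 p.1 * y ^ p.2 * qPow q x y p.1 := by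
  set a := algebraMap K (CC K) q
  induction k with
  | zero => simp [qCoeff_zero_left, qPow]
  | succ k ih =>
    -- The contributions of these two terms, extended by zero at n = 0 and at j = 0 so that both
    -- become sums over the larger antidiagonal.
    let t₁ : ℕ → ℕ → CC K := fun n j =>
      Nat.casesOn n 0 fun n => qCoeff a j n * y ^ j * qPow q x y (n + 1)
    let t₂ : ℕ → ℕ → CC K := fun n j =>
      Nat.casesOn j 0 fun j => (a ^ n - 1) * qCoeff a j n * y ^ (j + 1) * qPow q x y n
    have e : ∀ p ∈ Finset.HasAntidiagonal.antidiagonal (k + 1),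
        qCoeff a p.2 p.1 * y ^ p.2 * qPow q x y p.1 = t₁ p.1 p.2 + t₂ p.1 p.2 := by
      rintro ⟨n, j⟩ hp
      rw [Finset.HasAntidiagonal.mem_antidiagonal] at hp
      rcases n with _ | n <;> rcases j with _ | j
      · simp at hp
      · simp [t₁, t₂, qCoeff_succ_zero]
      · simp [t₁, t₂, qCoeff_zero_left]
      · simp only [t₁, t₂, qCoeff_succ_succ]
        ring
    rw [Finset.sum_congr rfl e, Finset.sum_add_distrib, Finset.Nat.sum_antidiagonal_succ,
      Finset.Nat.sum_antidiagonal_succ', pow_succ, ih, Finset.sum_mul]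
    change _ = (0 + ∑ p ∈ Finset.HasAntidiagonal.antidiagonal k,
        qCoeff a p.2 p.1 * y ^ p.2 * qPow q x y (p.1 + 1)) +
      (0 + ∑ p ∈ Finset.HasAntidiagonal.antidiagonal k,
        (a ^ p.1 - 1) * qCoeff a p.2 p.1 * y ^ (p.2 + 1) * qPow q x y p.1)
    rw [zero_add, zero_add, ← Finset.sum_add_distrib]
    refine Finset.sum_congr rfl fun p _ => ?_
    rw [qPow_succ]
    ring

end QPow

/-! ### Rearrangement of double series. -/

section Double

variable {F : Type*} [NormedField F]

theorem hasSum_antidiagonal {f : ℕ × ℕ → F} (hf : Summable f) :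
    HasSum (fun l => ∑ p ∈ Finset.HasAntidiagonal.antidiagonal l, f p) (∑' p, f p) := by
  have h := ((Finset.HasAntidiagonal.sigmaAntidiagonalEquivProd (A := ℕ)).hasSum_iff (f := f)).2
    hf.hasSum
  refine h.sigma fun l => ?_
  rw [← Finset.sum_coe_sort]
  exact hasSum_fintype _

variable [CompleteSpace F]

theorem summable_of_norm_le_antidiagonal {ρ w : ℝ} (hw : 0 ≤ w) (h : w < ρ) {a : ℕ → F}
    (ha : GeoBdd ρ a) {f : ℕ × ℕ → F} (hf : ∀ p, ‖f p‖ ≤ ‖a (p.1 + p.2)‖ * w ^ (p.1 + p.2)) :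
    Summable f := by
  obtain ⟨C, hC, h'⟩ := ha
  have hρ : 0 < ρ := hw.trans_lt h
  have h1 := summable_geometric_of_lt_one (div_nonneg hw hρ.le) ((div_lt_one hρ).2 h)
  refine Summable.of_norm_bounded ((h1.mul_of_nonneg h1 (fun _ => by positivity)
    (fun _ => by positivity)).mul_left C) fun p => ?_
  calc ‖f p‖ ≤ ‖a (p.1 + p.2)‖ * w ^ (p.1 + p.2) := hf p
    _ = ‖a (p.1 + p.2)‖ * ρ ^ (p.1 + p.2) * ((w / ρ) ^ p.1 * (w / ρ) ^ p.2) := by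
      rw [← pow_add, div_pow]; field_simp
    _ ≤ C * ((w / ρ) ^ p.1 * (w / ρ) ^ p.2) := by gcongr; exact h' _

theorem hasSum_rows {f : ℕ × ℕ → F} (hf : Summable f) :
    HasSum (fun i => ∑' j, f (i, j)) (∑' p, f p) :=
  hf.hasSum.prod_fiberwise fun i => (hf.prod_factor i).hasSum

end Double

end QDiff

namespace QDiff

theorem GeoBdd.comp_add_left {E : Type*} [NormedAddCommGroup E] {ρ : ℝ} (hρ : 0 < ρ) {a : ℕ → E}
    (ha : GeoBdd ρ a) (n : ℕ) : GeoBdd ρ fun j => a (n + j) := by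
  obtain ⟨C, hC, h⟩ := ha
  refine ⟨C / ρ ^ n, by positivity, fun j => ?_⟩
  rw [le_div_iff₀ (by positivity), mul_assoc, ← pow_add, add_comm j]
  exact h _

/-! ### From the Taylor series of a solution to its q-Taylor series. -/

section QTaylor

theorem qFactorial_succ {K : Type u} [NontriviallyNormedField K] (q : K) (n : ℕ) : qFactorial q (n + 1) =
    qFactorial q n * ∑ j ∈ Finset.range (n + 1), q ^ j := Finset.prod_range_succ _ n

theorem sub_one_mul_qFactorial_succ {K : Type u} [NontriviallyNormedField K] (q : K) (n : ℕ) :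
    (q - 1) * qFactorial q (n + 1) = (q ^ (n + 1) - 1) * qFactorial q n := by
  rw [qFactorial_succ, ← mul_geom_sum]; ring

variable {K : Type u} [NontriviallyNormedField K] [IsUltrametricDist K] [CompleteSpace K]
  {X : Affinoid K} {d : ℕ}

open Affinoid

/-- The matrices of the `q`-divided powers `d_q ^ n / [n]_q!` in terms of those of the divided
powers of `d/dT`. -/
noncomputable def qTaylorCoeff (q : K) (Y : ℕ → Matrix (Fin d) (Fin d) X.H) (n : ℕ) :
    Matrix (Fin d) (Fin d) X.H :=
  Matrix.of fun i t => ∑' j, qCoeff q j n • (X.T ^ j * Y (n + j) i t)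

variable {Y : ℕ → Matrix (Fin d) (Fin d) X.H} {ρ : ℝ} {q : X.Q}

theorem norm_qCoeff_mul_pow_le (hρ : ρ ≤ X.rX) (hq : q ∈ X.disk ρ) (j n : ℕ) (x : X.Pt) :
    ‖qCoeff (algebraMap K (CC K) ((q : Kˣ) : K)) j n * (x : CC K) ^ j‖ ≤
      (‖((q : Kˣ) : K) - 1‖ * X.sX) ^ j := by
  rw [← map_qCoeff, norm_mul, norm_algebraMap', norm_pow, mul_pow]
  gcongr
  · exact norm_qCoeff_le (norm_sub_one_lt hρ hq) j n
  · exact norm_coe_le x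

theorem hasSum_qTaylorCoeff_apply (hρ : ρ ≤ X.rX) (hq : q ∈ X.disk ρ) (hb : MBdd ρ Y) (n : ℕ)
    (i t : Fin d) (x : X.Pt) :
    HasSum (fun j => qCoeff (algebraMap K (CC K) ((q : Kˣ) : K)) j n * (x : CC K) ^ j *
      Y (n + j) i t x) (qTaylorCoeff ((q : Kˣ) : K) Y n i t x) := by
  have hs : Summable fun j => qCoeff ((q : Kˣ) : K) j n • (X.T ^ j * Y (n + j) i t) := by
    have h1 := ((hb i t).comp_add_left (pos_of_mem_disk hq) n).tendsto
      (mul_nonneg (norm_nonneg _) (sX_pos X).le) (mem_disk_iff.1 hq)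
    refine Summable.of_norm_bounded h1 fun j => ?_
    rw [norm_smul, mul_pow]
    calc _ ≤ ‖((q : Kˣ) : K) - 1‖ ^ j * (X.sX ^ j * ‖Y (n + j) i t‖) := by
          gcongr
          · exact norm_qCoeff_le (norm_sub_one_lt hρ hq) j n
          · exact norm_T_pow_mul_le _ _
      _ = _ := by ring
  have h2 := hs.hasSum.map (evalAt x).toRingHom.toAddMonoidHom (continuous_evalAt x)
  refine h2.congr_fun fun j => ?_
  change _ = (qCoeff ((q : Kˣ) : K) j n • (X.T ^ j * Y (n + j) i t)) x
  rw [Affinoid.smul_apply, Affinoid.mul_apply, T_pow_apply, map_qCoeff, mul_assoc]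

theorem qTaylorCoeff_zero (q : K) (Y : ℕ → Matrix (Fin d) (Fin d) X.H) :
    qTaylorCoeff q Y 0 = Y 0 := by
  ext1 i t
  rw [qTaylorCoeff, Matrix.of_apply, tsum_eq_single 0]
  · simp [qCoeff_zero_left]
  · intro j hj
    obtain ⟨j, rfl⟩ := Nat.exists_eq_succ_of_ne_zero hj
    rw [Nat.succ_eq_add_one, qCoeff_succ_zero, zero_smul]

theorem hasSum_qTaylorCoeff_add (hρ : ρ ≤ X.rX) (hq : q ∈ X.disk ρ) (hb : MBdd ρ Y) (n : ℕ)
    (i t : Fin d) (x : X.Pt) :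
    HasSum (fun l => qCoeff (algebraMap K (CC K) ((q : Kˣ) : K)) l (n + 1) * (x : CC K) ^ l *
      Y (n + l) i t x) (qTaylorCoeff ((q : Kˣ) : K) Y n i t x +
        (algebraMap K (CC K) ((q : Kˣ) : K) ^ (n + 1) - 1) * (x : CC K) *
          qTaylorCoeff ((q : Kˣ) : K) Y (n + 1) i t x) := by
  -- The term l = 0 is split off because the recursion of `qCoeff` applies only from l = 1; the
  -- remaining terms separate into the two series on the right.
  rw [← hasSum_nat_add_iff' 1]
  have h1 := (hasSum_nat_add_iff' 1).2 (hasSum_qTaylorCoeff_apply hρ hq hb n i t x)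
  have h2 := (hasSum_qTaylorCoeff_apply hρ hq hb (n + 1) i t x).mul_left
    ((algebraMap K (CC K) ((q : Kˣ) : K) ^ (n + 1) - 1) * (x : CC K))
  have h3 := h1.add h2
  rw [Finset.sum_range_one, qCoeff_zero_left] at h3 ⊢
  rw [add_sub_right_comm]
  refine h3.congr_fun fun l => ?_
  rw [qCoeff_succ_succ, ← add_assoc, add_right_comm n l 1, pow_succ]
  ring

variable [CharZero K]

/-- Since A(x) = Y(qx, x), each product Y_{n+j}(qx) A(x) is a recentered coefficient of Y at x.
Collecting the multiples of Y_{n+l}(x) leads to `sum_choose_mul_qCoeff`. -/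
theorem qTaylorCoeff_mul (hρ : ρ ≤ X.rX) (hq : q ∈ X.disk ρ) (hb : MBdd ρ Y)
    (hY : IsHorizontal Y) {A : Matrix (Fin d) (Fin d) X.H} (hs : IsSolution ρ q A Y) (n : ℕ)
    (i t : Fin d) (x : X.Pt) :
    HasSum (fun l => qCoeff (algebraMap K (CC K) ((q : Kˣ) : K)) l (n + 1) * (x : CC K) ^ l *
      Y (n + l) i t x) (((qTaylorCoeff ((q : Kˣ) : K) Y n).map (X.sigma q) * A) i t x) := by
  have hρ0 := pos_of_mem_disk hq
  set a := algebraMap K (CC K) ((q : Kˣ) : K) with ha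
  have hA : matAt x A = solEval Y (X.mulPt q x) x := by
    rw [isSolution_iff.1 hs x x (by rwa [sub_self, norm_zero]), solEval_self, hY.1, matAt_one,
      Matrix.mul_one]
  have hx := norm_mulPt_sub_lt hq x
  have hy := geoBdd_apply hρ0.le (hb i t) x
  have hv : (X.mulPt q x : CC K) - x = (a - 1) * x := by rw [coe_mulPt]; ring
  have hvn : ‖(a - 1) * (x : CC K)‖ ≤ ‖((q : Kˣ) : K) - 1‖ * X.sX := by
    rw [norm_mul, ha, ← map_one (algebraMap K (CC K)), ← map_sub, norm_algebraMap']
    gcongr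
    exact norm_coe_le x
  -- The first index is the one in the q-Taylor coefficient, the second comes from recentering by (q
  -- - 1)x. Rows sum to the product with A, antidiagonals to the asserted series.
  let f : ℕ × ℕ → CC K := fun p => qCoeff a p.1 n * (X.mulPt q x : CC K) ^ p.1 *
    (((p.2 + (n + p.1)).choose (n + p.1) : CC K) * Y (p.2 + (n + p.1)) i t x *
      ((a - 1) * (x : CC K)) ^ p.2)
  have hf : Summable f := by
    refine summable_of_norm_le_antidiagonal (mul_nonneg (norm_nonneg _) (sX_pos X).le)
      (mem_disk_iff.1 hq) (hy.comp_add_left hρ0 n) fun p => ?_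
    simp only [f]
    rw [norm_mul, pow_add, show n + (p.1 + p.2) = p.2 + (n + p.1) by ring]
    calc _ ≤ (‖((q : Kˣ) : K) - 1‖ * X.sX) ^ p.1 * (‖Y (p.2 + (n + p.1)) i t x‖ *
          (‖((q : Kˣ) : K) - 1‖ * X.sX) ^ p.2) := by
          gcongr
          · exact pow_nonneg (mul_nonneg (norm_nonneg _) (sX_pos X).le) _
          · exact norm_qCoeff_mul_pow_le hρ hq p.1 n (X.mulPt q x)
          · rw [norm_mul, norm_pow]
            gcongr
            exact norm_natCast_mul_le _ _
      _ = _ := by ring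
  have h1 : HasSum (fun j => ∑' m, f (j, m))
      (((qTaylorCoeff ((q : Kˣ) : K) Y n).map (X.sigma q) * A) i t x) := by
    have h2 : HasSum _ (∑ s, _) := hasSum_sum fun s (_ : s ∈ Finset.univ) =>
      (hasSum_qTaylorCoeff_apply hρ hq hb n i s (X.mulPt q x)).mul_right (A s t x)
    have e : ((qTaylorCoeff ((q : Kˣ) : K) Y n).map (X.sigma q) * A) i t x =
        ∑ s, qTaylorCoeff ((q : Kˣ) : K) Y n i s (X.mulPt q x) * A s t x := by
      change matAt x ((qTaylorCoeff ((q : Kˣ) : K) Y n).map (X.sigma q) * A) i t = _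
      rw [matAt_mul, Matrix.mul_apply]
      rfl
    rw [e]
    refine h2.congr_fun fun j => ?_
    have h3 := congrFun (congrFun (hY.matAt_mul_solEval hb hρ hx (n + j)) i) t
    rw [← hA, Matrix.mul_apply, hv] at h3
    simp only [f]
    rw [tsum_mul_left]
    refine (congrArg _ h3.symm).trans ?_
    rw [Finset.mul_sum]
    exact Finset.sum_congr rfl fun s _ => (mul_assoc _ _ _).symm
  have h3 := h1.unique (hasSum_rows hf)
  rw [h3]
  refine (hasSum_antidiagonal hf).congr_fun fun l => ?_
  rw [← sum_choose_mul_qCoeff, ← Finset.Nat.sum_antidiagonal_swap, Finset.sum_mul, Finset.sum_mul]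
  refine Finset.sum_congr rfl fun p hp => ?_
  rw [Finset.HasAntidiagonal.mem_antidiagonal] at hp
  subst hp
  simp only [f, Prod.fst_swap, Prod.snd_swap]
  rw [show p.2 + (n + p.1) = n + (p.1 + p.2) by ring, coe_mulPt, ← ha,
    show n + (p.1 + p.2) = (n + p.1) + p.2 by ring, Nat.choose_symm_add,
    mul_pow (a - 1)]
  ring

theorem qFactorial_ne_zero (hfin : ¬ IsOfFinOrder q) (n : ℕ) :
    qFactorial ((q : Kˣ) : K) n ≠ 0 := by
  induction n with
  | zero => simp [qFactorial]
  | succ n ih =>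
    have h : (((q : Kˣ) : K) ^ (n + 1) - 1) * qFactorial ((q : Kˣ) : K) n ≠ 0 := by
      refine mul_ne_zero (fun h => hfin ?_) ih
      refine isOfFinOrder_iff_pow_eq_one.2 ⟨n + 1, n.succ_pos, Subtype.ext (Units.ext ?_)⟩
      exact sub_eq_zero.1 h
    rw [← sub_one_mul_qFactorial_succ] at h
    exact right_ne_zero_of_mul h

/-- One and the same series computes σ_q(H_n) A and H_n + (q^(n+1) - 1) T H_{n+1} for the q-divided
powers H_n; the q-factorials turn q^(n+1) - 1 into q - 1. -/
theorem isQDerivMatrices_qTaylorCoeff (hρ : ρ ≤ X.rX) (hq : q ∈ X.disk ρ) (hb : MBdd ρ Y)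
    (hY : IsHorizontal Y) {A : Matrix (Fin d) (Fin d) X.H} (hs : IsSolution ρ q A Y) :
    IsQDerivMatrices q A fun n =>
      qFactorial ((q : Kˣ) : K) n • qTaylorCoeff ((q : Kˣ) : K) Y n := by
  refine ⟨by simp [qTaylorCoeff_zero, hY.1, qFactorial], fun n => ?_⟩
  have key : (qTaylorCoeff ((q : Kˣ) : K) Y n).map (X.sigma q) * A = qTaylorCoeff ((q : Kˣ) : K) Y n
      + ((((q : Kˣ) : K) ^ (n + 1) - 1) • X.T) • qTaylorCoeff ((q : Kˣ) : K) Y (n + 1) := by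
    ext1 i t
    refine H_ext fun x => ?_
    rw [(qTaylorCoeff_mul hρ hq hb hY hs n i t x).unique (hasSum_qTaylorCoeff_add hρ hq hb n i t x)]
    rw [Matrix.add_apply, Matrix.smul_apply, smul_eq_mul, Affinoid.add_apply, Affinoid.mul_apply,
      Affinoid.smul_apply, T_apply,
      map_sub, map_pow, map_one]
  have e : (qFactorial ((q : Kˣ) : K) n • qTaylorCoeff ((q : Kˣ) : K) Y n).map (X.sigma q) =
      qFactorial ((q : Kˣ) : K) n • (qTaylorCoeff ((q : Kˣ) : K) Y n).map (X.sigma q) := by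
    ext1 i t
    exact map_smul (X.sigma q) _ _
  rw [e, Matrix.smul_mul, key, smul_add, add_sub_cancel_left, smul_assoc, smul_assoc,
    smul_comm X.T, smul_smul, sub_one_mul_qFactorial_succ, smul_smul, mul_comm]

/-- A single summable double series: its antidiagonals give the Taylor series through the expansion
of (x - y)^k, and its rows give the q-Taylor series. -/
theorem hasQTaylorSum_qTaylorCoeff {r : ℝ} (hr : r ≤ X.rX) (hq : q ∈ X.disk r)
    (hfin : ¬ IsOfFinOrder q) (hc : ConvergesOn r Y) :
    HasQTaylorSum r q
      (fun n => qFactorial ((q : Kˣ) : K) n • qTaylorCoeff ((q : Kˣ) : K) Y n) Y := by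
  intro x y hxy i t
  set w := max ‖(x : CC K) - y‖ (‖((q : Kˣ) : K) - 1‖ * X.sX)
  obtain ⟨ρ, h1, h2⟩ := exists_between (max_lt hxy (mem_disk_iff.1 hq))
  have hqρ : q ∈ X.disk ρ := mem_disk_iff.2 ((le_max_right _ _).trans_lt h1)
  have hρ0 := pos_of_mem_disk hqρ
  have hb := mbdd_of_convergesOn hc hρ0.le h2
  set a := algebraMap K (CC K) ((q : Kˣ) : K)
  let f : ℕ × ℕ → CC K := fun p => qCoeff a p.2 p.1 * (y : CC K) ^ p.2 * Y (p.1 + p.2) i t y *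
    qPow ((q : Kˣ) : K) x y p.1
  have hw : 0 ≤ w := le_max_of_le_left (norm_nonneg _)
  have hf : Summable f := by
    refine summable_of_norm_le_antidiagonal hw h1 (geoBdd_apply hρ0.le (hb i t) y) fun p => ?_
    simp only [f]
    rw [norm_mul, norm_mul, pow_add]
    calc _ ≤ w ^ p.2 * ‖Y (p.1 + p.2) i t y‖ * w ^ p.1 := by
          gcongr
          · refine (norm_qCoeff_mul_pow_le (h2.le.trans hr) hqρ p.2 p.1 y).trans ?_
            have := sX_pos X
            gcongr
            exact le_max_right _ _
          · refine norm_qPow_le (norm_sub_one_lt hr hq) (le_max_left _ _) (le_trans ?_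
              (le_max_right _ _)) _
            gcongr
            exact norm_coe_le y
      _ = _ := by ring
  have h3 := (hasSum_antidiagonal hf).tsum_eq
  have h4 : diagEval Y x y i t = ∑' p, f p := by
    rw [← h3]
    refine tsum_congr fun k => ?_
    rw [sub_pow_eq_sum_qPow ((q : Kˣ) : K), Finset.mul_sum]
    refine Finset.sum_congr rfl fun p hp => ?_
    rw [Finset.HasAntidiagonal.mem_antidiagonal] at hp
    subst hp
    simp only [f]
    ring
  rw [h4]
  refine (hasSum_rows hf).congr_fun fun n => ?_
  have h5 := ((hasSum_qTaylorCoeff_apply (h2.le.trans hr) hqρ hb n i t y).mul_right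
    (qPow ((q : Kˣ) : K) x y n)).tsum_eq
  rw [h5]
  change (qFactorial ((q : Kˣ) : K) n • qTaylorCoeff ((q : Kˣ) : K) Y n i t) y * _ / _ = _
  rw [Affinoid.smul_apply]
  have h6 : algebraMap K (CC K) (qFactorial ((q : Kˣ) : K) n) ≠ 0 :=
    (_root_.map_ne_zero _).2 (qFactorial_ne_zero hfin n)
  field_simp

/-- The solution of a `q`-difference equation which is horizontal is the sum of its `q`-Taylor
series. -/
theorem exists_isQDerivMatrices {r : ℝ} (hr : r ≤ X.rX) (hq : q ∈ X.disk r)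
    (hfin : ¬ IsOfFinOrder q) (hY : IsHorizontal Y) (hc : ConvergesOn r Y)
    {A : Matrix (Fin d) (Fin d) X.H} (hs : IsSolution r q A Y) :
    ∃ H : ℕ → Matrix (Fin d) (Fin d) X.H, IsQDerivMatrices q A H ∧ HasQTaylorSum r q H Y := by
  obtain ⟨ρ, h1, h2⟩ := exists_between (mem_disk_iff.1 hq)
  have hqρ : q ∈ X.disk ρ := mem_disk_iff.2 h1
  exact ⟨_, isQDerivMatrices_qTaylorCoeff (h2.le.trans hr) hqρ
    (mbdd_of_convergesOn hc (pos_of_mem_disk hqρ).le h2) hY (fun x y h => hs x y (h.trans h2)),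
    hasQTaylorSum_qTaylorCoeff hr hq hfin hc⟩

end QTaylor

end QDiff

namespace QDiff

/-! ### Equivalences -/

section Categories

variable {K : Type u} [NontriviallyNormedField K] [IsUltrametricDist K] [CompleteSpace K]
  {X : Affinoid K} {S : Set X.Q} {r : ℝ}

open Affinoid

/-- Isomorphisms of `(σ, δ)`-modules from linear equivalences. -/
noncomputable def SigmaDeltaMod.isoMk {M N : SigmaDeltaMod X S} (φ : M.carrier ≃ₗ[X.H] N.carrier)
    (h : ∀ m, φ (M.δ m) = N.δ (φ m))
    (h' : ∀ q (hq : q ∈ S) m, φ (M.op q hq m) = N.op q hq (φ m)) : M ≅ N where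
  hom := ⟨φ.toLinearMap, h', h⟩
  inv := ⟨φ.symm.toLinearMap, fun q hq m => φ.injective (by simp [h']),
    fun m => φ.injective (by simp [h])⟩
  hom_inv_id := SigmaDeltaMod.Hom.ext (LinearMap.ext φ.symm_apply_apply)
  inv_hom_id := SigmaDeltaMod.Hom.ext (LinearMap.ext φ.apply_symm_apply)

/-- The linear equivalence underlying an isomorphism of `σ`-modules. -/
noncomputable def SigmaMod.linOfIso {M N : SigmaMod X S} (e : M ≅ N) : M.carrier ≃ₗ[X.H] N.carrier :=
  LinearEquiv.ofLinearMap (SigmaMod.Hom.lin e.hom) (SigmaMod.Hom.lin e.inv)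
    (congrArg SigmaMod.Hom.lin e.inv_hom_id) (congrArg SigmaMod.Hom.lin e.hom_inv_id)

theorem SigmaMod.matσ_map {M N : SigmaMod X S} (φ : M.carrier ≃ₗ[X.H] N.carrier) (q : X.Q)
    (hq : q ∈ S) (h : ∀ m, φ (M.op q hq m) = N.op q hq (φ m)) {n : ℕ}
    (b : Module.Basis (Fin n) X.H M.carrier) : N.matσ q hq (b.map φ) = M.matσ q hq b := by
  ext1 i j
  simp [SigmaMod.matσ, ← h]

instance : (forgetδr X S r).Faithful where
  map_injective h := ObjectProperty.hom_ext _ (SigmaDeltaMod.Hom.ext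
    (congrArg (fun f => SigmaMod.Hom.lin f.hom) h))

instance {S' : Set X.Q} (h : S' ⊆ S) : (resσδr h r).Faithful where
  map_injective h := ObjectProperty.hom_ext _ (SigmaDeltaMod.Hom.ext
    (congrArg (fun f => SigmaDeltaMod.Hom.lin f.hom) h))

instance : (forgetδAny X S).Faithful where
  map_injective h := ObjectProperty.hom_ext _ (SigmaDeltaMod.Hom.ext
    (congrArg (fun f => SigmaMod.Hom.lin f.hom) h))

instance (q : X.Q) : (germForgetδ X q).Faithful where
  map_injective h := GermSigmaDelta.Hom.ext (congrArg GermSigma.Hom.lin h)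

instance (q : X.Q) : (germResσδ X q).Faithful where
  map_injective h := GermSigmaDelta.Hom.ext
    (congrArg (fun f => SigmaDeltaMod.Hom.lin f.hom) h)

/-- Two objects of a union may be admissible for different radii; over a single q both become
admissible for the smaller one, so that they can be compared. -/
theorem admσδ_restrict_singleton {r' : ℝ} {M : SigmaDeltaMod X S} (hM : admσδ X S r M) {q : X.Q}
    (hq : q ∈ S) (hq' : q ∈ X.disk r') :
    admσδ X {q} (min r r') (M.restrict (Set.singleton_subset_iff.2 hq)) :=
  admσδ_mono (Set.singleton_subset_iff.2 (mem_disk_min.2 ⟨hM.1 hq, hq'⟩)) (min_le_left _ _)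
    (admσδ_restrict (Set.singleton_subset_iff.2 hq) M hM)

theorem admσδ_restrict_singleton' {r' : ℝ} {M : SigmaDeltaMod X S} (hM : admσδ X S r M) {q : X.Q}
    (hq : q ∈ S) (hq' : q ∈ X.disk r') :
    admσδ X {q} (min r' r) (M.restrict (Set.singleton_subset_iff.2 hq)) := by
  rw [min_comm]
  exact admσδ_restrict_singleton hM hq hq'

variable [CharZero K]

/-- No condition on the order of q: the connection is present on both sides, and it alone controls
the morphisms and the extension to S. -/
theorem isEquivalence_resσδr (hr : r ≤ X.rX) (hS : S ⊆ X.disk r) {q : X.Q} (hq : {q} ⊆ S) :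
    (resσδr hq r).IsEquivalence where
  full := ⟨fun {M N} f =>
    let g : ((resσδr hq r).obj M).obj.Hom ((resσδr hq r).obj N).obj := f.hom
    ⟨ObjectProperty.homMk ⟨g.lin, fun _ hq' m =>
      comm_op_of_comm_conn hr M.2 N.2 hq' g.lin g.comm_δ m, g.comm_δ⟩, rfl⟩⟩
  essSurj := ⟨fun M => by
    obtain ⟨N, hN, φ, h1, h2⟩ :=
      exists_extension hr hq hS (Set.singleton_nonempty q) M.obj M.property
    exact ⟨⟨N, hN⟩, ⟨ObjectProperty.isoMk _ (SigmaDeltaMod.isoMk φ h1 h2)⟩⟩⟩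

theorem isEquivalence_germResσδ (q : X.Q) : (germResσδ X q).IsEquivalence where
  full := ⟨fun {M N} f =>
    let g : ((germResσδ X q).obj M).obj.Hom ((germResσδ X q).obj N).obj := f.hom
    ⟨⟨g.lin, ⟨min M.r N.r, mem_disk_min.2 ⟨M.mem, N.mem⟩, fun q' _ hM hN m => by
      obtain ⟨r₁, h1, h1'⟩ := M.adm
      obtain ⟨r₂, h2, h2'⟩ := N.adm
      exact comm_op_of_comm_conn (q := q') ((min_le_left _ _).trans h1)
        (admσδ_restrict_singleton h1' hM (h2'.1 hN)) (admσδ_restrict_singleton' h2' hN (h1'.1 hM))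
        rfl g.lin g.comm_δ m⟩, g.comm_δ⟩, rfl⟩⟩
  essSurj := ⟨fun M => by
    obtain ⟨r, hr, hM⟩ := M.property
    obtain ⟨N, hN, φ, h1, h2⟩ :=
      exists_extension hr hM.1 subset_rfl (Set.singleton_nonempty q) M.obj hM
    -- The disk carrying the extension is the one attached to the admissibility radius of M itself.
    exact ⟨⟨r, hM.1 rfl, N, r, hr, hN⟩, ⟨ObjectProperty.isoMk _ (SigmaDeltaMod.isoMk φ h1 h2)⟩⟩⟩

variable {p : ℕ}

theorem isEquivalence_forgetδr (hp0 : p ≠ 0) (hp : ‖(p : K)‖ < 1) (hr : r ≤ X.rX) {q : X.Q}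
    (hq : q ∈ S) (hfin : ¬ IsOfFinOrder q) : (forgetδr X S r).IsEquivalence where
  full := ⟨fun {M N} f => ⟨ObjectProperty.homMk ⟨SigmaMod.Hom.lin f.hom,
    SigmaMod.Hom.comm f.hom, comm_conn_of_comm_op hp0 hp hr M.2 N.2 hq hfin _
      (SigmaMod.Hom.comm f.hom q hq)⟩, rfl⟩⟩
  essSurj := ⟨by
    rintro ⟨M, hM⟩
    obtain ⟨N, rfl, hN⟩ := exists_conn hp0 hp hr hq hfin M hM
    exact ⟨⟨N, hN⟩, ⟨Iso.refl _⟩⟩⟩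

theorem isEquivalence_forgetδAny (hp0 : p ≠ 0) (hp : ‖(p : K)‖ < 1) {q : X.Q}
    (hfin : ¬ IsOfFinOrder q) : (forgetδAny X {q}).IsEquivalence where
  full := ⟨fun {M N} f => ⟨ObjectProperty.homMk ⟨SigmaMod.Hom.lin f.hom,
    SigmaMod.Hom.comm f.hom, by
      obtain ⟨r₁, h1, h1'⟩ := M.property
      obtain ⟨r₂, h2, h2'⟩ := N.property
      exact comm_conn_of_comm_op hp0 hp ((min_le_left _ _).trans h1)
        (admσδ_restrict_singleton h1' rfl (h2'.1 rfl))
        (admσδ_restrict_singleton' h2' rfl (h1'.1 rfl)) rfl hfin _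
        (SigmaMod.Hom.comm f.hom q rfl)⟩, rfl⟩⟩
  essSurj := ⟨by
    rintro ⟨M, r, hr, hM⟩
    obtain ⟨N, rfl, hN⟩ := exists_conn hp0 hp hr (Set.mem_singleton q) hfin M hM
    exact ⟨⟨N, r, hr, hN⟩, ⟨Iso.refl _⟩⟩⟩

theorem isEquivalence_germForgetδ (hp0 : p ≠ 0) (hp : ‖(p : K)‖ < 1) {q : X.Q}
    (hfin : ¬ IsOfFinOrder q) : (germForgetδ X q).IsEquivalence where
  full := ⟨fun {M N} f => ⟨⟨GermSigma.Hom.lin f, GermSigma.Hom.comm f, by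
      obtain ⟨r₁, h1, h1'⟩ := M.adm
      obtain ⟨r₂, h2, h2'⟩ := N.adm
      obtain ⟨t, ht, hf⟩ := GermSigma.Hom.comm f
      exact comm_conn_of_comm_op (q := q) hp0 hp ((min_le_left _ _).trans h1)
        (admσδ_restrict_singleton h1' M.mem (h2'.1 N.mem))
        (admσδ_restrict_singleton' h2' N.mem (h1'.1 M.mem)) rfl hfin _
        (hf q ht M.mem N.mem)⟩, rfl⟩⟩
  essSurj := ⟨by
    rintro ⟨t, ht, M, r, hr, hM⟩
    obtain ⟨N, rfl, hN⟩ := exists_conn hp0 hp hr ht hfin M hM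
    exact ⟨⟨t, ht, N, r, hr, hN⟩, ⟨Iso.refl _⟩⟩⟩

/-- The other three sides of the square are equivalences and the square commutes on the nose, so the
fourth side follows by cancellation. -/
theorem isEquivalence_resσr (hp0 : p ≠ 0) (hp : ‖(p : K)‖ < 1) (hr : r ≤ X.rX)
    (hS : S ⊆ X.disk r) {q : X.Q} (hq : {q} ⊆ S) (hfin : ¬ IsOfFinOrder q) :
    (resσr hq r).IsEquivalence := by
  have h1 := isEquivalence_forgetδr hp0 hp hr (hq rfl) hfin
  have h2 := isEquivalence_forgetδr hp0 hp hr (Set.mem_singleton q) hfin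
  have h3 := isEquivalence_resσδr hr hS hq
  have h4 : (forgetδr X S r ⋙ resσr hq r).IsEquivalence :=
    inferInstanceAs (resσδr hq r ⋙ forgetδr X {q} r).IsEquivalence
  exact Functor.isEquivalence_of_comp_left (forgetδr X S r) _

theorem isEquivalence_germResσ (hp0 : p ≠ 0) (hp : ‖(p : K)‖ < 1) {q : X.Q}
    (hfin : ¬ IsOfFinOrder q) : (germResσ X q).IsEquivalence := by
  have h1 := isEquivalence_germForgetδ hp0 hp hfin
  have h2 := isEquivalence_forgetδAny hp0 hp hfin
  have h3 := isEquivalence_germResσδ q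
  have h4 : (germForgetδ X q ⋙ germResσ X q).IsEquivalence :=
    inferInstanceAs (germResσδ X q ⋙ forgetδAny X {q}).IsEquivalence
  exact Functor.isEquivalence_of_comp_left (germForgetδ X q) _

/-- An admissible `(σ, δ)`-module restricts to a `q`-difference module and to a differential module
with the same Taylor solution. -/
theorem sameTaylorSolution_restrict (hr : r ≤ X.rX) {q : X.Q} (hq : q ∈ S)
    (h1 : {1} ⊆ S) (hfin : ¬ IsOfFinOrder q) {N : SigmaDeltaMod X S} (hN : admσδ X S r N)
    {M : SigmaMod X {q}} (φ : M.carrier ≃ₗ[X.H] N.carrier)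
    (hφ : ∀ m, φ (M.op q rfl m) = N.op q hq (φ m)) : SameTaylorSolution r M (N.restrict h1) := by
  refine ⟨φ, fun n b => ?_⟩
  obtain ⟨F, hF, hc, hs⟩ := exists_isDerivMatrices hr hN (b.map φ)
  obtain ⟨H, hH, hH'⟩ :=
    exists_isQDerivMatrices hr (hN.1 hq) hfin hF.isHorizontal hc (hs q hq)
  refine ⟨H, F, ?_, hF, hc, hH'⟩
  rwa [← SigmaMod.matσ_map (N := (N.restrict (Set.singleton_subset_iff.2 hq)).toSigmaMod) φ q rfl hφ]

end Categories

end QDiff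

theorem mainTheorem3 {K : Type u} [NontriviallyNormedField K] [IsUltrametricDist K]
    [CompleteSpace K] [CharZero K] (p : ℕ) [Fact p.Prime] (hp : ‖(p : K)‖ < 1)
    (X : Affinoid K) (r : ℝ) (hr : r ≤ X.rX) :
    -- restriction from `S` to `{q}`, and forgetting the connection, in generic radius `≥ r`
    (∀ (S : Set X.Q), S ⊆ X.disk r → ∀ (q : X.Q) (hq : {q} ⊆ S), ¬ IsOfFinOrder q →
      (forgetδr X S r).IsEquivalence ∧ (resσr hq r).IsEquivalence ∧
      (resσδr hq r).IsEquivalence ∧ (forgetδr X {q} r).IsEquivalence ∧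
      Nonempty (forgetδr X S r ⋙ resσr hq r ≅ resσδr hq r ⋙ forgetδr X {q} r)) ∧
    -- the same for all admissible modules
    (∀ q ∈ X.disk r, ¬ IsOfFinOrder q →
      (germForgetδ X q).IsEquivalence ∧ (germResσ X q).IsEquivalence ∧
      (germResσδ X q).IsEquivalence ∧ (forgetδAny X {q}).IsEquivalence ∧
      Nonempty (germForgetδ X q ⋙ germResσ X q ≅ germResσδ X q ⋙ forgetδAny X {q})) ∧
    -- deformation of `σ_q`-modules
    (∀ (q q' : X.Q) (hq : {q} ⊆ X.disk r) (hq' : {q'} ⊆ X.disk r),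
      ¬ IsOfFinOrder q → ¬ IsOfFinOrder q' →
      ∃ _ : (resσr hq r).IsEquivalence, (defσ r hq hq').IsEquivalence) ∧
    -- deformation of `(σ_q, δ_q)`-modules, roots of unity included
    (∀ (q q' : X.Q) (hq : {q} ⊆ X.disk r) (hq' : {q'} ⊆ X.disk r),
      ∃ _ : (resσδr hq r).IsEquivalence, (defσδ r hq hq').IsEquivalence) ∧
    -- confluence
    (∀ (q : X.Q) (hq : {q} ⊆ X.disk r), ¬ IsOfFinOrder q →
      ∃ (_ : (forgetδr X {q} r).IsEquivalence) (_ : (resσδr hq r).IsEquivalence),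
        (conf r hq).IsEquivalence ∧
        ∀ M : SigmaModr X {q} r, SameTaylorSolution r M.obj ((conf r hq).obj M).obj) := by
  have hp0 : p ≠ 0 := (Fact.out : p.Prime).ne_zero
  have hσδ : ∀ {q : X.Q} (hq : {q} ⊆ X.disk r), (resσδr hq r).IsEquivalence := fun hq =>
    isEquivalence_resσδr hr subset_rfl hq
  refine ⟨fun S hS q hq hfin => ⟨isEquivalence_forgetδr hp0 hp hr (hq rfl) hfin,
      isEquivalence_resσr hp0 hp hr hS hq hfin, isEquivalence_resσδr hr hS hq,
      isEquivalence_forgetδr hp0 hp hr rfl hfin, ⟨Iso.refl _⟩⟩,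
    fun q _ hfin => ⟨isEquivalence_germForgetδ hp0 hp hfin, isEquivalence_germResσ hp0 hp hfin,
      isEquivalence_germResσδ q, isEquivalence_forgetδAny hp0 hp hfin, ⟨Iso.refl _⟩⟩,
    fun q q' hq hq' hfin hfin' => ?_, fun q q' hq hq' => ?_, fun q hq hfin => ?_⟩
  · have h1 := isEquivalence_resσr hp0 hp hr subset_rfl hq hfin
    have h2 := isEquivalence_resσr hp0 hp hr subset_rfl hq' hfin'
    exact ⟨h1, inferInstanceAs ((resσr hq r).inv ⋙ resσr hq' r).IsEquivalence⟩
  · have h1 := hσδ hq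
    have h2 := hσδ hq'
    exact ⟨h1, inferInstanceAs ((resσδr hq r).inv ⋙ resσδr hq' r).IsEquivalence⟩
  · have h1 := isEquivalence_forgetδr hp0 hp hr (Set.mem_singleton q) hfin
    have h2 := hσδ hq
    -- Here q = 1 is a root of unity, which restriction of (σ, δ)-modules tolerates.
    have h3 := hσδ (Affinoid.one_mem_disk hq)
    refine ⟨h1, h2, inferInstanceAs ((forgetδr X {q} r).inv ⋙ (resσδr hq r).inv ⋙
      resσδr (Affinoid.one_mem_disk hq) r).IsEquivalence, fun M => ?_⟩
    let N₁ := (forgetδr X {q} r).inv.obj M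
    let N₂ := (resσδr hq r).inv.obj N₁
    -- N₂ lives over the whole disk: its restriction to 1 is the confluence of M, and the two
    -- counits identify the σ_q-module underlying its restriction to q with M. Both therefore share
    -- the Taylor solution of N₂.
    let e : (forgetδr X {q} r).obj ((resσδr hq r).obj N₂) ≅ M :=
      (forgetδr X {q} r).mapIso ((resσδr hq r).asEquivalence.counitIso.app N₁) ≪≫
        (forgetδr X {q} r).asEquivalence.counitIso.app M
    let e' := (admσ X {q} r).ι.mapIso e.symm
    exact sameTaylorSolution_restrict (N := N₂.obj) (M := M.obj) hr (hq rfl) _ hfin N₂.property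
      (SigmaMod.linOfIso e') (SigmaMod.Hom.comm e'.hom q rfl)
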